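/- Let $c\ge 2$ be an integer and $0<\varepsilon<1$. Let $\gamma_c$ be the largest real root of $X^c-X^{c-1}-\dots-X-1$ and $\lambda_c=1/\log_2\gamma_c$; write $\log=\log_2$. A CNF formula $\varphi$ with $n$ variables and $m$ clauses is given together with a tree decomposition of its incidence graph (the bipartite graph of variables and clauses, in which a variable is adjacent to the clauses that contain it, negated or not). The tree has $N$ nodes and maximum degree at most $3$, and $\mathcal{TW}(\varphi)$ denotes the width of the given decomposition (the largest size of a bag minus one, read as $0$ if all bags are empty). Time and space are bit costs on a random access machine with logarithmic cost. Then there are a single algorithm, which depends only on $c$ and $\varepsilon$, and constants $A,k,N_0\in\mathbb N$ and $K\in\mathbb R$, which depend only on $c$ and $\varepsilon$, such that on every such input the algorithm halts, decides correctly whether $\varphi$ is satisfiable, and with $p=A\,(n+m+N)^k$: 1. if $N\ge N_0$, its running time is at most $p\cdot 3^{(\lambda_c(\log N-c)+c)(1-\varepsilon)\,\mathcal{TW}(\varphi)}$; 2. for every $N$, its running time is at most $p\cdot 3^{(\lambda_c(\log N-c)+c+K)(1-\varepsilon)\,\mathcal{TW}(\varphi)}$; 3. for every $N$, in the same run, the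 space that it uses is at most $p\cdot 2^{c\,\varepsilon\,\mathcal{TW}(\varphi)}$. That is, the algorithm runs simultaneously in time $O^*\bigl(3^{(\lambda_c(\log N-c)+c)(1-\varepsilon)\mathcal{TW}(\varphi)}\bigr)$ for all sufficiently large $N$ (with an additive constant in the factor $\lambda_c(\log N-c)+c$ for the remaining $N$) and in space $O^*\bigl(2^{c\varepsilon\mathcal{TW}(\varphi)}\bigr)$, where $O^*$ suppresses factors polynomial in $n+m+N$. -/

import Mathlib

namespace WidthSat

/-! ## CNF formulas, incidence graphs, tree decompositions -/

/-- A CNF formula with variables `x_0, …, x_{n-1}` and (not necessarily distinct) clauses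
`C_0, …, C_{m-1}`. A clause is a finite set of literals; `(x, true)` is the literal `x` and
`(x, false)` is its negation. -/
structure CNF (n m : ℕ) where
  clause : Fin m → Finset (Fin n × Bool)

namespace CNF

variable {n m : ℕ}

/-- Some truth assignment makes at least one literal true in every clause. -/
def Satisfiable (φ : CNF n m) : Prop :=
  ∃ a : Fin n → Bool, ∀ j, ∃ l ∈ φ.clause j, a l.1 = l.2

/-- The incidence graph: the vertices are the variables (`Sum.inl`) and the clauses (`Sum.inr`),
and a clause is adjacent to the variables that appear, negated or not, in it. -/
def incidenceGraph (φ : CNF n m) : SimpleGraph (Fin n ⊕ Fin m) :=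
  SimpleGraph.fromRel fun u v =>
    ∃ (x : Fin n) (j : Fin m) (b : Bool), u = Sum.inl x ∧ v = Sum.inr j ∧ (x, b) ∈ φ.clause j

end CNF

/-- A tree decomposition with `N` nodes of the graph `G`. -/
structure TreeDecomposition {V : Type*} (G : SimpleGraph V) (N : ℕ) where
  tree : SimpleGraph (Fin N)
  isTree : tree.IsTree
  bag : Fin N → Finset V
  cover : ∀ v, ∃ t, v ∈ bag t
  edge : ∀ u v, G.Adj u v → ∃ t, u ∈ bag t ∧ v ∈ bag t
  subtree : ∀ v, (tree.induce {t | v ∈ bag t}).Connected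

/-- The width: the largest size of a bag, minus one. (If all bags are empty, which happens only
for the graph without vertices, this is `0`.) -/
def TreeDecomposition.width {V : Type*} {G : SimpleGraph V} {N : ℕ}
    (D : TreeDecomposition G N) : ℕ :=
  (Finset.univ.sup fun t => (D.bag t).card) - 1

/-- Every node of the tree has at most `d` neighbours. -/
def TreeDecomposition.DegreeLE {V : Type*} {G : SimpleGraph V} {N : ℕ}
    (D : TreeDecomposition G N) (d : ℕ) : Prop :=
  ∀ t, (D.tree.neighborSet t).ncard ≤ d

/-! ## Random access machines with logarithmic cost

Cells hold natural numbers. The input is a list of numbers in a read-only array; the work memory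
is initially zero and is addressed directly or indirectly. Programs are built from assignments,
sequencing, conditionals and while-loops. Costs are bit costs: addition and subtraction are
charged the lengths of their operands, multiplication and division the product of these lengths,
and every access to a cell is charged the lengths of the address and of the content. -/

/-- The contents of the work memory: a natural number at every address, almost all of them 0. -/
abbrev Mem := ℕ →₀ ℕ

/-- The bits that a memory content occupies: the lengths of the addresses and of the contents of
all nonzero cells. -/
def Mem.bits (M : Mem) : ℕ := M.sum fun a v => a.size + v.size

/-- Expressions. -/
inductive Expr where
  | lit (k : ℕ)
  /-- the input cell whose index is the value of `e` -/
  | inp (e : Expr)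
  /-- the work memory cell whose address is the value of `e` -/
  | mem (e : Expr)
  | add (e f : Expr)
  /-- truncated subtraction -/
  | sub (e f : Expr)
  | mul (e f : Expr)
  /-- integer quotient, with value 0 for divisor 0 -/
  | div (e f : Expr)

namespace Expr

/-- The value of an expression on the input `I`, at the work memory `M`. Input cells beyond the
end of the input read as 0. -/
def eval (I : List ℕ) (M : Mem) : Expr → ℕ
  | lit k => k
  | inp e => I.getD (e.eval I M) 0
  | mem e => M (e.eval I M)
  | add e f => e.eval I M + f.eval I M
  | sub e f => e.eval I M - f.eval I M
  | mul e f => e.eval I M * f.eval I M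
  | div e f => e.eval I M / f.eval I M

/-- The bit cost of evaluating an expression. -/
def time (I : List ℕ) (M : Mem) : Expr → ℕ
  | lit k => 1 + k.size
  | inp e => e.time I M + (1 + (e.eval I M).size + (I.getD (e.eval I M) 0).size)
  | mem e => e.time I M + (1 + (e.eval I M).size + (M (e.eval I M)).size)
  | add e f => e.time I M + f.time I M + (1 + (e.eval I M).size + (f.eval I M).size)
  | sub e f => e.time I M + f.time I M + (1 + (e.eval I M).size + (f.eval I M).size)
  | mul e f => e.time I M + f.time I M + (1 + (e.eval I M).size) * (1 + (f.eval I M).size)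
  | div e f => e.time I M + f.time I M + (1 + (e.eval I M).size) * (1 + (f.eval I M).size)

/-- The scratch space for evaluating an expression: the lengths of all intermediate results. -/
def space (I : List ℕ) (M : Mem) : Expr → ℕ
  | lit k => k.size
  | inp e => e.space I M + ((inp e).eval I M).size
  | mem e => e.space I M + ((mem e).eval I M).size
  | add e f => e.space I M + f.space I M + ((add e f).eval I M).size
  | sub e f => e.space I M + f.space I M + ((sub e f).eval I M).size
  | mul e f => e.space I M + f.space I M + ((mul e f).eval I M).size
  | div e f => e.space I M + f.space I M + ((div e f).eval I M).size

end Expr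

/-- Programs. -/
inductive Prog where
  /-- write the value of `v` into the work memory cell whose address is the value of `a` -/
  | set (a v : Expr)
  | seq (p q : Prog)
  /-- run `p` if the value of `e` is not 0, and `q` otherwise -/
  | ite (e : Expr) (p q : Prog)
  /-- run `p` again and again as long as the value of `e` is not 0 -/
  | loop (e : Expr) (p : Prog)

/-- `Exec I p M M' t s`: on the input `I`, the program `p` started at the work memory `M` halts at
the work memory `M'`, after time `t`, and has used `s` bits of space (the maximum over all moments
of the run of the memory's bits, scratch space included). -/
inductive Exec (I : List ℕ) : Prog → Mem → Mem → ℕ → ℕ → Prop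
  | set (a v : Expr) (M : Mem) :
      Exec I (.set a v) M (M.update (a.eval I M) (v.eval I M))
        (a.time I M + v.time I M + (1 + (a.eval I M).size + (v.eval I M).size))
        (max (M.bits + a.space I M + v.space I M) (Mem.bits (M.update (a.eval I M) (v.eval I M))))
  | seq {p q : Prog} {M M' M'' : Mem} {t t' s s' : ℕ} :
      Exec I p M M' t s → Exec I q M' M'' t' s' →
      Exec I (.seq p q) M M'' (t + t') (max s s')
  | ite_true {e : Expr} {p q : Prog} {M M' : Mem} {t s : ℕ} :
      e.eval I M ≠ 0 → Exec I p M M' t s →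
      Exec I (.ite e p q) M M' (1 + e.time I M + t) (max (M.bits + e.space I M) s)
  | ite_false {e : Expr} {p q : Prog} {M M' : Mem} {t s : ℕ} :
      e.eval I M = 0 → Exec I q M M' t s →
      Exec I (.ite e p q) M M' (1 + e.time I M + t) (max (M.bits + e.space I M) s)
  | loop_stop {e : Expr} {p : Prog} {M : Mem} :
      e.eval I M = 0 →
      Exec I (.loop e p) M M (1 + e.time I M) (M.bits + e.space I M)
  | loop_step {e : Expr} {p : Prog} {M M' M'' : Mem} {t t' s s' : ℕ} :
      e.eval I M ≠ 0 → Exec I p M M' t s → Exec I (.loop e p) M' M'' t' s' →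
      Exec I (.loop e p) M M'' (1 + e.time I M + t + t') (max (M.bits + e.space I M) (max s s'))

/-- On the input `I` the program `p`, started at the all-zero work memory, halts with output `out`
(the content of cell 0) after time `t` and with space `s`. -/
def Prog.Computes (p : Prog) (I : List ℕ) (out t s : ℕ) : Prop :=
  ∃ M : Mem, Exec I p 0 M t s ∧ M 0 = out

/-! ## The input of the satisfiability problem -/

open Classical in
/-- 1 for a true proposition, 0 for a false one. -/
noncomputable def bit (p : Prop) : ℕ := if p then 1 else 0

/-- The `r × s` matrix of the truth values of a relation, row by row. -/
noncomputable def matrixBits {r s : ℕ} (R : Fin r → Fin s → Prop) : List ℕ :=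
  List.ofFn fun i : Fin (r * s) => bit (R i.divNat i.modNat)

/-- The input: the numbers of variables, of clauses and of nodes of the tree, then the 0-1 matrices
that tell which variables appear unnegated and negated in which clauses, which nodes of the tree are
adjacent, and which variables and which clauses are in which bags. -/
noncomputable def encode {n m N : ℕ} (φ : CNF n m)
    (D : TreeDecomposition φ.incidenceGraph N) : List ℕ :=
  [n, m, N] ++
    matrixBits (fun (j : Fin m) (x : Fin n) => (x, true) ∈ φ.clause j) ++
    matrixBits (fun (j : Fin m) (x : Fin n) => (x, false) ∈ φ.clause j) ++
    matrixBits (fun s t : Fin N => D.tree.Adj s t) ++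
    matrixBits (fun (t : Fin N) (x : Fin n) => Sum.inl x ∈ D.bag t) ++
    matrixBits (fun (t : Fin N) (j : Fin m) => Sum.inr j ∈ D.bag t)

/-! ## The constants -/

/-- The largest real root of `X^c - X^(c-1) - ⋯ - X - 1`. -/
noncomputable def gamma (c : ℕ) : ℝ :=
  sSup {x : ℝ | x ^ c - ∑ i ∈ Finset.range c, x ^ i = 0}

/-- For `c ≥ 2` (indeed `c ≥ 1`) the supremum in the definition of `gamma` is attained. -/
theorem isGreatest_gamma (c : ℕ) (hc : 2 ≤ c) :
    IsGreatest {x : ℝ | x ^ c - ∑ i ∈ Finset.range c, x ^ i = 0} (gamma c) := by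
  set S : Set ℝ := {x : ℝ | x ^ c - ∑ i ∈ Finset.range c, x ^ i = 0} with hS
  have hcont : Continuous fun x : ℝ => x ^ c - ∑ i ∈ Finset.range c, x ^ i := by fun_prop
  have hclosed : IsClosed S := isClosed_eq hcont continuous_const
  have hgeom : ∀ x : ℝ, (∑ i ∈ Finset.range c, x ^ i) * (x - 1) = x ^ c - 1 :=
    fun x => geom_sum_mul x c
  have hne : S.Nonempty := by
    have h := intermediate_value_Icc (show (1 : ℝ) ≤ 2 by norm_num) hcont.continuousOn
    have h2 := hgeom 2
    have hc' : (2 : ℝ) ≤ c := by exact_mod_cast hc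
    have h0 : (0 : ℝ) ∈ Set.Icc ((1 : ℝ) ^ c - ∑ i ∈ Finset.range c, (1 : ℝ) ^ i)
        ((2 : ℝ) ^ c - ∑ i ∈ Finset.range c, (2 : ℝ) ^ i) := by
      constructor
      · simp; linarith
      · linarith
    obtain ⟨x, -, hx⟩ := h h0
    exact ⟨x, hx⟩
  have hbdd : BddAbove S := by
    refine ⟨2, fun x hx => ?_⟩
    by_contra! h
    have hx' : x ^ c = ∑ i ∈ Finset.range c, x ^ i := sub_eq_zero.mp hx
    have h1 := hgeom x
    rw [← hx'] at h1
    have h3 : (0 : ℝ) < x ^ c := by positivity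
    nlinarith
  exact hclosed.isGreatest_csSup hne hbdd

/-- `λ_c = 1 / log₂ γ_c`. -/
noncomputable def lam (c : ℕ) : ℝ := 1 / Real.logb 2 (gamma c)

end WidthSat

/-! Counting. The satisfying assignments are counted by inclusion-exclusion. A pair of an assignment
and a set of selected clauses gets weight 0 if some selected clause is true under the assignment,
and otherwise -1 to the number of selected clauses. For a fixed assignment the sum over the sets is
a product over the clauses, with factor 1 + 0 for a true clause and 1 - 1 for a false one; so it is
1 for a satisfying assignment and 0 for any other (`Inst.sum_weight`). The restriction of a pair to
a bag is a state of the node, with one bit for every vertex of the bag. Every incidence edge lies in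
a bag and the nodes that contain a vertex are connected, so the pairs correspond to the families of
states that agree along the edges of the tree, and the weight is a product of factors that belong to
single nodes. Everything is computed modulo `2 ^ n + 1`, which exceeds the number of assignments.

Divide and conquer. The tree is rooted at 0. A component consists of the descendants of `r` that are
not descendants of `b`; it touches the rest of the tree only at the parent of `r` and at `b`.
Removing a node `u` between `r` and `b` leaves components of the same kind. If `u` is the lowest
node that keeps more than 5/8 of the component below it, then the depth `d` of this recursion is
sufficient as soon as `(8/5) ^ d` exceeds `N` (`Inst.Rooted.small_piece`), and `d ≤ 3/2 * log N + 1`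
can be achieved (`exists_depth`).

Time against space. Let `W` be the largest bag size and `q` about `ε * W`. The `q` low bits of a
state are tabulated, the others are tried one after the other. The table of a component has one
entry for every choice of the low parts of its two boundary states, that is `Q ^ 2` entries with `Q
= 2 ^ q`. To fill it, the tables of the pieces are recomputed for each of the `Y = 2 ^ (W - q)` high
parts of the state of `u`, and the `Q` low parts are summed up. Apart from polynomial factors this
takes time `Y ^ d * Q ^ 3` and space `Q ^ 2`. The recursion needs no stack: the components are laid
out in postorder (`Inst.Layout`), and a single while-loop moves a pointer either to the next
position or back to the start of the current interval (`Inst.Good.wp_component`).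

Comparison. To base 2, the exponent of the time is about `(3 + 3/2 * (1 - ε) * log N) * width`. As
`γ_c ≤ 2`, one has `λ_c ≥ 1`, so the factor `λ_c * (log N - c) + c` is at least `log N` once `log N
≥ c`; and `3/2 < log 3` leaves a margin that absorbs the summand 3 for large `N`. The space exponent
`2 * q` is at most `c * ε * width + 2` because `c ≥ 2`.

The program is written and verified in a small language with named arrays; `HRun.compile` transfers
step counts and bounds on indices and values to the machine. -/

namespace WidthSat

/-! ## A language with named arrays -/

/-- Names of arrays. -/
inductive Arr where
  | out | par | anc | sz | R | B | U | best | e | pw | first | full | seen | cnt | z | w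
  | M | Q | Y | ptr | Tab | br | acc | f | sg | pr | i | j | k | t | v
  deriving DecidableEq

/-- The residue modulo 64 of the addresses at which an array is stored. -/
def Arr.code : Arr → ℕ
  | out => 0 | par => 1 | anc => 2 | sz => 3 | R => 4 | B => 5 | U => 6 | best => 7 | e => 8
  | pw => 9 | first => 10 | full => 11 | seen => 12 | cnt => 13 | z => 14 | w => 15 | M => 16
  | Q => 17 | Y => 18 | ptr => 19 | Tab => 20 | br => 21 | acc => 22 | f => 23 | sg => 24
  | pr => 25 | i => 26 | j => 27 | k => 28 | t => 29 | v => 30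

theorem Arr.code_lt (a : Arr) : a.code < 64 := by cases a <;> decide

theorem Arr.code_injective : Function.Injective Arr.code := by
  intro a b h
  cases a <;> cases b <;> first | rfl | exact absurd h (by decide)

/-- The contents of all arrays. -/
abbrev St := Arr → ℕ → ℕ

def St.upd (σ : St) (a : Arr) (x v : ℕ) : St :=
  fun b y => if b = a then (if y = x then v else σ b y) else σ b y

/-- Expressions over arrays. -/
inductive AExpr where
  | lit (k : ℕ)
  | inp (e : AExpr)
  | arr (a : Arr) (e : AExpr)
  | add (e f : AExpr)
  | sub (e f : AExpr)
  | mul (e f : AExpr)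
  | div (e f : AExpr)

namespace AExpr

instance : Add AExpr := ⟨add⟩
instance : Sub AExpr := ⟨sub⟩
instance : Mul AExpr := ⟨mul⟩
instance : Div AExpr := ⟨div⟩
instance (k : ℕ) : OfNat AExpr k := ⟨lit k⟩

def eval (I : List ℕ) (σ : St) : AExpr → ℕ
  | lit k => k
  | inp e => I.getD (e.eval I σ) 0
  | arr a e => σ a (e.eval I σ)
  | add e f => e.eval I σ + f.eval I σ
  | sub e f => e.eval I σ - f.eval I σ
  | mul e f => e.eval I σ * f.eval I σ
  | div e f => e.eval I σ / f.eval I σ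

variable (I : List ℕ) (σ : St)

@[simp] theorem eval_lit (k : ℕ) : (lit k).eval I σ = k := rfl
@[simp] theorem eval_ofNat (k : ℕ) :
    eval I σ (no_index (OfNat.ofNat k : AExpr)) = OfNat.ofNat k := rfl
@[simp] theorem eval_inp (e : AExpr) : (inp e).eval I σ = I.getD (e.eval I σ) 0 := rfl
@[simp] theorem eval_arr (a : Arr) (e : AExpr) : (arr a e).eval I σ = σ a (e.eval I σ) := rfl
@[simp] theorem eval_add (e f : AExpr) : (e + f).eval I σ = e.eval I σ + f.eval I σ := rfl
@[simp] theorem eval_sub (e f : AExpr) : (e - f).eval I σ = e.eval I σ - f.eval I σ := rfl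
@[simp] theorem eval_mul (e f : AExpr) : (e * f).eval I σ = e.eval I σ * f.eval I σ := rfl
@[simp] theorem eval_div (e f : AExpr) : (e / f).eval I σ = e.eval I σ / f.eval I σ := rfl

/-- The value 0 or 1 of `e ≠ 0`. -/
def nz (e : AExpr) : AExpr := 1 - (1 - e)
/-- The value 0 or 1 of `e = f`. -/
def eq (e f : AExpr) : AExpr := 1 - ((e - f) + (f - e))
/-- The value 0 or 1 of `e < f`. -/
def lt (e f : AExpr) : AExpr := nz (f - e)
/-- Remainder. -/
def mod (e f : AExpr) : AExpr := e - (e / f) * f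

@[simp] theorem eval_nz (e : AExpr) : (nz e).eval I σ = if e.eval I σ = 0 then 0 else 1 := by
  simp only [nz, eval_sub, eval_ofNat]; split_ifs <;> omega
@[simp] theorem eval_eq (e f : AExpr) :
    (eq e f).eval I σ = if e.eval I σ = f.eval I σ then 1 else 0 := by
  simp only [eq, eval_sub, eval_add, eval_ofNat]; split_ifs <;> omega
@[simp] theorem eval_lt (e f : AExpr) :
    (lt e f).eval I σ = if e.eval I σ < f.eval I σ then 1 else 0 := by
  rw [lt, eval_nz, eval_sub]
  by_cases h : e.eval I σ < f.eval I σ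
  · rw [if_pos h, if_neg (by omega)]
  · rw [if_neg h, if_pos (by omega)]
@[simp] theorem eval_mod (e f : AExpr) : (mod e f).eval I σ = e.eval I σ % f.eval I σ := by
  simp only [mod, eval_sub, eval_mul, eval_div]
  have := Nat.div_add_mod (e.eval I σ) (f.eval I σ)
  rw [Nat.mul_comm] at this
  omega

/-- Every array owns a residue class of addresses modulo 64, so arrays of unknown lengths share the
memory without collisions. -/
def compile : AExpr → Expr
  | lit k => .lit k
  | inp e => .inp e.compile
  | arr a e => .mem (.add (.mul (.lit 64) e.compile) (.lit a.code))
  | add e f => .add e.compile f.compile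
  | sub e f => .sub e.compile f.compile
  | mul e f => .mul e.compile f.compile
  | div e f => .div e.compile f.compile

end AExpr

/-- Programs over arrays. -/
inductive Cmd where
  | set (a : Arr) (x v : AExpr)
  | seq (p q : Cmd)
  | ite (e : AExpr) (p q : Cmd)
  | loop (e : AExpr) (p : Cmd)

namespace Cmd

def addr (a : Arr) (x : AExpr) : Expr := .add (.mul (.lit 64) x.compile) (.lit a.code)

def compile : Cmd → Prog
  | set a x v => .set (addr a x) v.compile
  | seq p q => .seq p.compile q.compile
  | ite e p q => .ite e.compile p.compile q.compile
  | loop e p => .loop e.compile p.compile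

/-- The arrays that a program may change. -/
@[simp] def writes : Cmd → Arr → Prop
  | set a _ _, b => b = a
  | seq p q, b => p.writes b ∨ q.writes b
  | ite _ p q, b => p.writes b ∨ q.writes b
  | loop _ p, b => p.writes b

end Cmd

/-- `HRun I A V p σ σ' c`: on the input `I` the program `p` runs from `σ` to `σ'` in `c` steps and
writes only values below `V`, at indices below `A`. -/
inductive HRun (I : List ℕ) (A V : ℕ) : Cmd → St → St → ℕ → Prop
  | set {a x v σ} : x.eval I σ < A → v.eval I σ < V →
      HRun I A V (.set a x v) σ (σ.upd a (x.eval I σ) (v.eval I σ)) 1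
  | seq {p q σ σ' σ'' c c'} : HRun I A V p σ σ' c → HRun I A V q σ' σ'' c' →
      HRun I A V (.seq p q) σ σ'' (c + c')
  | ite_true {e p q σ σ' c} : AExpr.eval I σ e ≠ 0 → HRun I A V p σ σ' c →
      HRun I A V (.ite e p q) σ σ' (c + 1)
  | ite_false {e p q σ σ' c} : AExpr.eval I σ e = 0 → HRun I A V q σ σ' c →
      HRun I A V (.ite e p q) σ σ' (c + 1)
  | loop_exit {e p σ} : AExpr.eval I σ e = 0 → HRun I A V (.loop e p) σ σ 1
  | loop_step {e p σ σ' σ'' c c'} : AExpr.eval I σ e ≠ 0 → HRun I A V p σ σ' c →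
      HRun I A V (.loop e p) σ' σ'' c' → HRun I A V (.loop e p) σ σ'' (c + c' + 1)

theorem HRun.frame {I A V p σ σ' c} (h : HRun I A V p σ σ' c) :
    ∀ b, ¬ p.writes b → σ' b = σ b := by
  induction h with
  | set => intro b hb; funext y; simp [Cmd.writes] at hb; simp [St.upd, hb]
  | seq _ _ h1 h2 =>
    intro b hb; simp only [Cmd.writes, not_or] at hb; rw [h2 b hb.2, h1 b hb.1]
  | ite_true _ _ h1 => intro b hb; simp only [Cmd.writes, not_or] at hb; exact h1 b hb.1
  | ite_false _ _ h1 => intro b hb; simp only [Cmd.writes, not_or] at hb; exact h1 b hb.2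
  | loop_exit => intro b _; rfl
  | loop_step _ _ _ h1 h2 => intro b hb; rw [h2 b hb, h1 b hb]

/-! ## Compilation -/

theorem Nat.size_add_le (a b : ℕ) : (a + b).size ≤ a.size + b.size + 1 := by
  rw [Nat.size_le]
  have h1 := Nat.lt_size_self a
  have h2 := Nat.lt_size_self b
  calc a + b < 2 ^ a.size + 2 ^ b.size := by omega
    _ ≤ 2 ^ (a.size + b.size) + 2 ^ (a.size + b.size) := by
        gcongr <;> omega
    _ = _ := by ring

theorem Nat.size_mul_le (a b : ℕ) : (a * b).size ≤ a.size + b.size := by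
  rw [Nat.size_le, pow_add]
  exact Nat.mul_lt_mul'' (Nat.lt_size_self a) (Nat.lt_size_self b)

/-- If all cells have length at most `L`, then lengths grow only additively along an expression and
remain linear in `L`; the charges for products and quotients make the time quadratic. The factor
depends on the expression alone, hence only on the program in the end. -/
theorem Expr.exists_weight (e : Expr) : ∃ w : ℕ, ∀ (I : List ℕ) (M : Mem) (L : ℕ), 1 ≤ L →
    (∀ x, (I.getD x 0).size ≤ L) → (∀ x, (M x).size ≤ L) →
    (e.eval I M).size ≤ w * L ∧ e.time I M ≤ w * L ^ 2 ∧ e.space I M ≤ w * L := by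
  have key : ∀ w L : ℕ, 1 ≤ L → w * L ≤ w * L ^ 2 := fun w L hL =>
    Nat.mul_le_mul_left w (by nlinarith)
  induction e with
  | lit k =>
    refine ⟨k.size + 1, fun I M L hL _ _ => ?_⟩
    simp only [eval, time, space]
    have h1 := key (k.size + 1) L hL
    have h2 := Nat.mul_le_mul_left (k.size + 1) hL
    omega
  | inp e he =>
    obtain ⟨w, he⟩ := he
    refine ⟨2 * w + 2, fun I M L hL hI hM => ?_⟩
    obtain ⟨h1, h2, h3⟩ := he I M L hL hI hM
    have h4 := hI (e.eval I M)
    have h5 := key w L hL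
    have h6 := key 1 L hL
    have e1 : (2 * w + 2) * L = 2 * (w * L) + 2 * L := by ring
    have e2 : (2 * w + 2) * L ^ 2 = 2 * (w * L ^ 2) + 2 * L ^ 2 := by ring
    simp only [eval, time, space]
    rw [e1, e2]
    omega
  | mem e he =>
    obtain ⟨w, he⟩ := he
    refine ⟨2 * w + 2, fun I M L hL hI hM => ?_⟩
    obtain ⟨h1, h2, h3⟩ := he I M L hL hI hM
    have h4 := hM (e.eval I M)
    have h5 := key w L hL
    have h6 := key 1 L hL
    have e1 : (2 * w + 2) * L = 2 * (w * L) + 2 * L := by ring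
    have e2 : (2 * w + 2) * L ^ 2 = 2 * (w * L ^ 2) + 2 * L ^ 2 := by ring
    simp only [eval, time, space]
    rw [e1, e2]
    omega
  | add e f he hf =>
    obtain ⟨w, he⟩ := he
    obtain ⟨u, hf⟩ := hf
    refine ⟨2 * w + 2 * u + 1 + w * u, fun I M L hL hI hM => ?_⟩
    obtain ⟨h1, h2, h3⟩ := he I M L hL hI hM
    obtain ⟨k1, k2, k3⟩ := hf I M L hL hI hM
    have h4 := Nat.size_add_le (e.eval I M) (f.eval I M)
    have h5 := key w L hL
    have h6 := key u L hL
    have h7 := key 1 L hL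
    have e1 : (2 * w + 2 * u + 1 + w * u) * L = 2 * (w * L) + 2 * (u * L) + L + w * u * L := by
      ring
    have e2 : (2 * w + 2 * u + 1 + w * u) * L ^ 2 =
        2 * (w * L ^ 2) + 2 * (u * L ^ 2) + L ^ 2 + w * u * L ^ 2 := by ring
    simp only [eval, time, space]
    rw [e1, e2]
    omega
  | sub e f he hf =>
    obtain ⟨w, he⟩ := he
    obtain ⟨u, hf⟩ := hf
    refine ⟨2 * w + 2 * u + 1 + w * u, fun I M L hL hI hM => ?_⟩
    obtain ⟨h1, h2, h3⟩ := he I M L hL hI hM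
    obtain ⟨k1, k2, k3⟩ := hf I M L hL hI hM
    have h4 := Nat.size_le_size (Nat.sub_le (e.eval I M) (f.eval I M))
    have h5 := key w L hL
    have h6 := key u L hL
    have h7 := key 1 L hL
    have e1 : (2 * w + 2 * u + 1 + w * u) * L = 2 * (w * L) + 2 * (u * L) + L + w * u * L := by
      ring
    have e2 : (2 * w + 2 * u + 1 + w * u) * L ^ 2 =
        2 * (w * L ^ 2) + 2 * (u * L ^ 2) + L ^ 2 + w * u * L ^ 2 := by ring
    simp only [eval, time, space]
    rw [e1, e2]
    omega
  | mul e f he hf =>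
    obtain ⟨w, he⟩ := he
    obtain ⟨u, hf⟩ := hf
    refine ⟨2 * w + 2 * u + 1 + w * u, fun I M L hL hI hM => ?_⟩
    obtain ⟨h1, h2, h3⟩ := he I M L hL hI hM
    obtain ⟨k1, k2, k3⟩ := hf I M L hL hI hM
    have h4 := Nat.size_mul_le (e.eval I M) (f.eval I M)
    have h5 := key w L hL
    have h6 := key u L hL
    have h7 := key 1 L hL
    have e1 : (2 * w + 2 * u + 1 + w * u) * L = 2 * (w * L) + 2 * (u * L) + L + w * u * L := by
      ring
    have e2 : (2 * w + 2 * u + 1 + w * u) * L ^ 2 =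
        2 * (w * L ^ 2) + 2 * (u * L ^ 2) + L ^ 2 + w * u * L ^ 2 := by ring
    -- The charge for a product contains the product of the two lengths; this is what the summand `w
    -- * u` of the weight pays for.
    have h8 := Nat.mul_le_mul h1 k1
    have e3 : w * L * (u * L) = w * u * L ^ 2 := by ring
    have e4 : (1 + (e.eval I M).size) * (1 + (f.eval I M).size) = 1 + (e.eval I M).size +
      (f.eval I M).size + (e.eval I M).size * (f.eval I M).size := by ring
    simp only [eval, time, space]
    rw [e1, e2, e4]
    omega
  | div e f he hf =>
    obtain ⟨w, he⟩ := he
    obtain ⟨u, hf⟩ := hf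
    refine ⟨2 * w + 2 * u + 1 + w * u, fun I M L hL hI hM => ?_⟩
    obtain ⟨h1, h2, h3⟩ := he I M L hL hI hM
    obtain ⟨k1, k2, k3⟩ := hf I M L hL hI hM
    have h4 := Nat.size_le_size (Nat.div_le_self (e.eval I M) (f.eval I M))
    have h5 := key w L hL
    have h6 := key u L hL
    have h7 := key 1 L hL
    have e1 : (2 * w + 2 * u + 1 + w * u) * L = 2 * (w * L) + 2 * (u * L) + L + w * u * L := by
      ring
    have e2 : (2 * w + 2 * u + 1 + w * u) * L ^ 2 =
        2 * (w * L ^ 2) + 2 * (u * L ^ 2) + L ^ 2 + w * u * L ^ 2 := by ring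
    have h8 := Nat.mul_le_mul h1 k1
    have e3 : w * L * (u * L) = w * u * L ^ 2 := by ring
    have e4 : (1 + (e.eval I M).size) * (1 + (f.eval I M).size) = 1 + (e.eval I M).size +
      (f.eval I M).size + (e.eval I M).size * (f.eval I M).size := by ring
    simp only [eval, time, space]
    rw [e1, e2, e4]
    omega

/-- `w` bounds the cost of evaluating `e` relative to the lengths of the numbers. -/
def Expr.HasWeight (e : Expr) (w : ℕ) : Prop := ∀ (I : List ℕ) (M : Mem) (L : ℕ), 1 ≤ L →
    (∀ x, (I.getD x 0).size ≤ L) → (∀ x, (M x).size ≤ L) →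
    (e.eval I M).size ≤ w * L ∧ e.time I M ≤ w * L ^ 2 ∧ e.space I M ≤ w * L

theorem Expr.HasWeight.mono {e : Expr} {w w' : ℕ} (h : e.HasWeight w) (hw : w ≤ w') :
    e.HasWeight w' := fun I M L hL hI hM =>
  have h' := h I M L hL hI hM
  ⟨h'.1.trans (by gcongr), h'.2.1.trans (by gcongr), h'.2.2.trans (by gcongr)⟩

/-- `w` bounds the cost of evaluating any expression in the program. -/
def Cmd.HasWeight : Cmd → ℕ → Prop
  | .set a x v, w => (Cmd.addr a x).HasWeight w ∧ v.compile.HasWeight w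
  | .seq p q, w => p.HasWeight w ∧ q.HasWeight w
  | .ite e p q, w => e.compile.HasWeight w ∧ p.HasWeight w ∧ q.HasWeight w
  | .loop e p, w => e.compile.HasWeight w ∧ p.HasWeight w

theorem Cmd.HasWeight.mono {p : Cmd} {w w' : ℕ} (h : p.HasWeight w) (hw : w ≤ w') :
    p.HasWeight w' := by
  induction p with
  | set a x v => exact ⟨h.1.mono hw, h.2.mono hw⟩
  | seq p q hp hq => exact ⟨hp h.1, hq h.2⟩
  | ite e p q hp hq => exact ⟨h.1.mono hw, hp h.2.1, hq h.2.2⟩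
  | loop e p hp => exact ⟨h.1.mono hw, hp h.2⟩

theorem Cmd.exists_weight (p : Cmd) : ∃ w, p.HasWeight w := by
  induction p with
  | set a x v =>
    obtain ⟨w1, h1⟩ := (Cmd.addr a x).exists_weight
    obtain ⟨w2, h2⟩ := v.compile.exists_weight
    exact ⟨w1 + w2, Expr.HasWeight.mono h1 (by omega), Expr.HasWeight.mono h2 (by omega)⟩
  | seq p q hp hq =>
    obtain ⟨w1, h1⟩ := hp
    obtain ⟨w2, h2⟩ := hq
    exact ⟨w1 + w2, h1.mono (by omega), h2.mono (by omega)⟩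
  | ite e p q hp hq =>
    obtain ⟨w1, h1⟩ := hp
    obtain ⟨w2, h2⟩ := hq
    obtain ⟨w3, h3⟩ := e.compile.exists_weight
    exact ⟨w1 + w2 + w3, Expr.HasWeight.mono h3 (by omega), h1.mono (by omega),
      h2.mono (by omega)⟩
  | loop e p hp =>
    obtain ⟨w1, h1⟩ := hp
    obtain ⟨w3, h3⟩ := e.compile.exists_weight
    exact ⟨w1 + w3, Expr.HasWeight.mono h3 (by omega), h1.mono (by omega)⟩

/-- The memory `M` stores the arrays `σ`, all whose nonzero entries are below `V`, at indices below
`A`. -/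
structure Stores (A V : ℕ) (M : Mem) (σ : St) : Prop where
  rep : ∀ a x, M (64 * x + a.code) = σ a x
  lt_value : ∀ x, M x < V
  lt_index : ∀ x, M x ≠ 0 → x < 64 * A

theorem Stores.zero {A V : ℕ} (hV : 0 < V) : Stores A V 0 (fun _ _ => 0) :=
  ⟨fun _ _ => rfl, fun _ => hV, fun _ h => absurd rfl h⟩

theorem Stores.update {A V : ℕ} {M : Mem} {σ : St} (h : Stores A V M σ) (a : Arr) {x v : ℕ}
    (hx : x < A) (hv : v < V) : Stores A V (M.update (64 * x + a.code) v) (σ.upd a x v) := by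
  have ha := a.code_lt
  refine ⟨fun b y => ?_, fun y => ?_, fun y => ?_⟩
  · have hb := b.code_lt
    rw [Finsupp.coe_update, Function.update_apply, h.rep]
    by_cases hab : b = a
    · subst hab
      simp [St.upd]
    · have : b.code ≠ a.code := fun h => hab (Arr.code_injective h)
      simp only [St.upd, if_neg hab]
      rw [if_neg (by omega)]
  · rw [Finsupp.coe_update, Function.update_apply]
    split_ifs
    · exact hv
    · exact h.lt_value y
  · rw [Finsupp.coe_update, Function.update_apply]
    split_ifs with hy
    · intro _; omega
    · exact h.lt_index y

theorem AExpr.eval_compile {A V : ℕ} {I : List ℕ} {M : Mem} {σ : St} (h : Stores A V M σ)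
    (e : AExpr) : e.compile.eval I M = e.eval I σ := by
  induction e with
  | lit k => rfl
  | inp e he => simp [compile, Expr.eval, eval, he]
  | arr a e he => simp [compile, Expr.eval, eval, he, h.rep]
  | add e f he hf => simp [compile, Expr.eval, eval, he, hf]
  | sub e f he hf => simp [compile, Expr.eval, eval, he, hf]
  | mul e f he hf => simp [compile, Expr.eval, eval, he, hf]
  | div e f he hf => simp [compile, Expr.eval, eval, he, hf]

/-- At most `64 * A` cells are nonzero, and each contributes an address and a content of length at
most `L`. -/
theorem Stores.bits_le {A V L : ℕ} {M : Mem} {σ : St} (h : Stores A V M σ)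
    (hL : (64 * A).size ≤ L) (hV : V.size ≤ L) : M.bits ≤ 64 * A * (2 * L) := by
  unfold Mem.bits Finsupp.sum
  have hsub : M.support ⊆ Finset.range (64 * A) := by
    intro x hx
    exact Finset.mem_range.2 (h.lt_index x (Finsupp.mem_support_iff.1 hx))
  calc _ ≤ ∑ x ∈ Finset.range (64 * A), (x.size + (M x).size) :=
        Finset.sum_le_sum_of_subset hsub
    _ ≤ ∑ x ∈ Finset.range (64 * A), 2 * L := by
        refine Finset.sum_le_sum fun x hx => ?_
        have h1 := Nat.size_le_size (Finset.mem_range.1 hx).le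
        have h2 := Nat.size_le_size (h.lt_value x).le
        omega
    _ = _ := by simp

/-- One step of the array language evaluates at most two expressions and writes one value: two
evaluations cost `2 * w * L ^ 2`, and the charge for the write is at most `1 + 2 * w * L`. This
explains `4 * w + 1`. The space is that of the stored arrays, plus the scratch of two expressions.
-/
theorem HRun.compile {I : List ℕ} {A V L w : ℕ} (hL : 1 ≤ L) (hA : (64 * A).size ≤ L)
    (hV : V.size ≤ L) (hI : ∀ x, (I.getD x 0).size ≤ L) {p : Cmd} {σ σ' : St} {c : ℕ}
    (hr : HRun I A V p σ σ' c) (hw : p.HasWeight w) {M : Mem} (hM : Stores A V M σ) :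
    ∃ (M' : Mem) (t s : ℕ), Exec I p.compile M M' t s ∧ Stores A V M' σ' ∧
      t ≤ c * ((4 * w + 1) * L ^ 2) ∧ s ≤ 64 * A * (2 * L) + 2 * (w * L) := by
  have key : ∀ {M : Mem} {σ : St}, Stores A V M σ → ∀ x, (M x).size ≤ L := fun h x =>
    (Nat.size_le_size (h.lt_value x).le).trans hV
  have hLL : L ≤ L ^ 2 := by nlinarith
  have hwL : w * L ≤ w * L ^ 2 := Nat.mul_le_mul_left w hLL
  have hexp : (4 * w + 1) * L ^ 2 = 4 * (w * L ^ 2) + L ^ 2 := by ring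
  induction hr generalizing M with
  | @set a x v σ hx hv =>
    obtain ⟨w1, w2⟩ := hw
    obtain ⟨a1, a2, a3⟩ := w1 I M L hL hI (key hM)
    obtain ⟨b1, b2, b3⟩ := w2 I M L hL hI (key hM)
    have haddr : (Cmd.addr a x).eval I M = 64 * x.eval I σ + a.code := by
      simp [Cmd.addr, Expr.eval, AExpr.eval_compile hM]
    have hval := AExpr.eval_compile (I := I) hM v
    have hs := hM.update a hx hv
    refine ⟨_, _, _, Exec.set _ _ _, ?_, ?_, ?_⟩
    · rw [haddr, hval]; exact hs
    · rw [one_mul, hexp]; omega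
    · have h1 := hM.bits_le hA hV
      have h2 := hs.bits_le hA hV
      rw [haddr, hval]
      refine max_le ?_ ?_ <;> omega
  | seq _ _ h1 h2 =>
    obtain ⟨M1, t1, s1, e1, st1, ht1, hs1⟩ := h1 hw.1 hM
    obtain ⟨M2, t2, s2, e2, st2, ht2, hs2⟩ := h2 hw.2 st1
    refine ⟨_, _, _, Exec.seq e1 e2, st2, ?_, max_le hs1 hs2⟩
    rw [add_mul]; omega
  | ite_true he _ h1 =>
    obtain ⟨w1, w2, w3⟩ := hw
    obtain ⟨a1, a2, a3⟩ := w1 I M L hL hI (key hM)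
    obtain ⟨M1, t1, s1, e1, st1, ht1, hs1⟩ := h1 w2 hM
    have hb := hM.bits_le hA hV
    refine ⟨_, _, _, Exec.ite_true (by rwa [AExpr.eval_compile hM]) e1, st1, ?_,
      max_le (by omega) hs1⟩
    rw [add_mul, one_mul]; rw [hexp] at *; nlinarith
  | ite_false he _ h1 =>
    obtain ⟨w1, w2, w3⟩ := hw
    obtain ⟨a1, a2, a3⟩ := w1 I M L hL hI (key hM)
    obtain ⟨M1, t1, s1, e1, st1, ht1, hs1⟩ := h1 w3 hM
    have hb := hM.bits_le hA hV
    refine ⟨_, _, _, Exec.ite_false (by rwa [AExpr.eval_compile hM]) e1, st1, ?_,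
      max_le (by omega) hs1⟩
    rw [add_mul, one_mul]; rw [hexp] at *; nlinarith
  | loop_exit he =>
    obtain ⟨w1, w2⟩ := hw
    obtain ⟨a1, a2, a3⟩ := w1 I M L hL hI (key hM)
    have hb := hM.bits_le hA hV
    refine ⟨_, _, _, Exec.loop_stop (by rwa [AExpr.eval_compile hM]), hM, ?_, by omega⟩
    rw [one_mul, hexp]; nlinarith
  | loop_step he _ _ h1 h2 =>
    obtain ⟨a1, a2, a3⟩ := hw.1 I M L hL hI (key hM)
    obtain ⟨M1, t1, s1, e1, st1, ht1, hs1⟩ := h1 hw.2 hM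
    obtain ⟨M2, t2, s2, e2, st2, ht2, hs2⟩ := h2 hw st1
    have hb := hM.bits_le hA hV
    refine ⟨_, _, _, Exec.loop_step (by rwa [AExpr.eval_compile hM]) e1 e2, st2, ?_,
      max_le (by omega) (max_le hs1 hs2)⟩
    rw [add_mul, add_mul, one_mul]; rw [hexp] at *; nlinarith

/-! ## Reasoning about programs -/

/-- From `σ`, the program halts after at most `C` steps in a state with `post`. -/
def WP (I : List ℕ) (A V : ℕ) (p : Cmd) (σ : St) (C : ℕ) (post : St → Prop) : Prop :=
  ∃ σ' c, HRun I A V p σ σ' c ∧ c ≤ C ∧ post σ'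

section
variable {I : List ℕ} {A V : ℕ} {p q : Cmd} {σ : St} {C C' : ℕ} {post post' : St → Prop}

theorem WP.mono (h : WP I A V p σ C post) (hC : C ≤ C') (hp : ∀ τ, post τ → post' τ) :
    WP I A V p σ C' post' :=
  let ⟨σ', c, h1, h2, h3⟩ := h; ⟨σ', c, h1, h2.trans hC, hp _ h3⟩

theorem WP.frame (h : WP I A V p σ C post) :
    WP I A V p σ C fun τ => post τ ∧ ∀ b, ¬ p.writes b → τ b = σ b :=
  let ⟨σ', c, h1, h2, h3⟩ := h; ⟨σ', c, h1, h2, h3, h1.frame⟩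

theorem WP.set {a : Arr} {x v : AExpr} (hx : x.eval I σ < A) (hv : v.eval I σ < V)
    (h : post (σ.upd a (x.eval I σ) (v.eval I σ))) : WP I A V (.set a x v) σ 1 post :=
  ⟨_, _, .set hx hv, le_rfl, h⟩

theorem WP.seq (h : WP I A V p σ C fun τ => WP I A V q τ C' post) :
    WP I A V (.seq p q) σ (C + C') post :=
  let ⟨_, _, h1, h2, _, _, k1, k2, k3⟩ := h; ⟨_, _, .seq h1 k1, add_le_add h2 k2, k3⟩

theorem WP.ite {e : AExpr} (h1 : e.eval I σ ≠ 0 → WP I A V p σ C post)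
    (h2 : e.eval I σ = 0 → WP I A V q σ C post) : WP I A V (.ite e p q) σ (C + 1) post := by
  by_cases he : e.eval I σ = 0
  · obtain ⟨σ', c, k1, k2, k3⟩ := h2 he
    exact ⟨σ', _, .ite_false he k1, by omega, k3⟩
  · obtain ⟨σ', c, k1, k2, k3⟩ := h1 he
    exact ⟨σ', _, .ite_true he k1, by omega, k3⟩

theorem WP.loop_exit {e : AExpr} (he : e.eval I σ = 0) (h : post σ) :
    WP I A V (.loop e p) σ 1 post := ⟨_, _, .loop_exit he, le_rfl, h⟩

theorem WP.loop_step {e : AExpr} (he : e.eval I σ ≠ 0)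
    (h : WP I A V p σ C fun τ => WP I A V (.loop e p) τ C' post) :
    WP I A V (.loop e p) σ (C + C' + 1) post :=
  let ⟨_, _, h1, h2, _, _, k1, k2, k3⟩ := h
  ⟨_, _, .loop_step he h1 k1, by omega, k3⟩

/-- A while-loop whose body decreases a measure. -/
theorem WP.loop {e : AExpr} (inv : ℕ → St → Prop)
    (hexit : ∀ τ, inv 0 τ → e.eval I τ = 0)
    (hstep : ∀ d τ, inv (d + 1) τ → e.eval I τ ≠ 0 ∧
      WP I A V p τ C fun τ' => ∃ d' ≤ d, inv d' τ')
    (d : ℕ) (h : inv d σ) :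
    WP I A V (.loop e p) σ (d * (C + 1) + 1) fun τ => inv 0 τ := by
  induction d using Nat.strong_induction_on generalizing σ with
  | _ d ih =>
    rcases d with - | d
    · simpa using WP.loop_exit (hexit σ h) h
    · obtain ⟨he, hw⟩ := hstep d σ h
      refine (WP.loop_step (C' := d * (C + 1) + 1) he
        (hw.mono le_rfl fun τ hτ => ?_)).mono (by ring_nf; omega) fun _ h => h
      obtain ⟨d', hd, h'⟩ := hτ
      exact (ih d' (by omega) h').mono (by gcongr) fun _ h => h

/-- `for x := 0, …, e - 1 do p`. -/
def Cmd.for (x : Arr) (e : AExpr) (p : Cmd) : Cmd :=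
  .seq (.set x 0 0) (.loop (e - .arr x 0) (.seq p (.set x 0 (.arr x 0 + 1))))

@[simp] theorem Cmd.writes_for {x : Arr} {e : AExpr} {p : Cmd} {b : Arr} :
    (Cmd.for x e p).writes b ↔ b = x ∨ p.writes b := by
  simp only [Cmd.for, Cmd.writes]; tauto

@[simp] theorem St.upd_same (σ : St) (a : Arr) (x v : ℕ) : σ.upd a x v a x = v := by simp [St.upd]

theorem St.upd_ne (σ : St) {a b : Arr} (h : b ≠ a) (x v : ℕ) : σ.upd a x v b = σ b := by
  funext y; simp [St.upd, h]

/-- The bound `e` is evaluated anew in every round, so `he` asks that nothing the body may change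
affects it. The invariant is demanded after the counter has been raised, hence always in states in
which the counter shows the index of the invariant. -/
theorem WP.for {x : Arr} {e : AExpr} {n : ℕ} (inv : ℕ → St → Prop) (hA : 0 < A) (hn : n < V)
    (hx : ¬ p.writes x)
    (he : ∀ τ, (∀ b, ¬ p.writes b → b ≠ x → τ b = σ b) → e.eval I τ = n)
    (h0 : inv 0 (σ.upd x 0 0))
    (hs : ∀ k < n, ∀ τ, (∀ b, ¬ p.writes b → b ≠ x → τ b = σ b) → τ x 0 = k → inv k τ →
      WP I A V p τ C fun τ' => inv (k + 1) (τ'.upd x 0 (k + 1))) :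
    WP I A V (.for x e p) σ (n * (C + 2) + 2) fun τ => inv n τ ∧
      (∀ b, ¬ p.writes b → b ≠ x → τ b = σ b) ∧ τ x 0 = n := by
  have := WP.loop (I := I) (A := A) (V := V) (e := e - .arr x 0) (C := C + 1)
    (p := .seq p (.set x 0 (.arr x 0 + 1)))
    (σ := σ.upd x 0 0)
    (fun d τ => d ≤ n ∧ inv (n - d) τ ∧ (∀ b, ¬ p.writes b → b ≠ x → τ b = σ b) ∧ τ x 0 = n - d)
    (fun τ ⟨_, _, h2, h3⟩ => by simp [he τ h2, h3]) ?_ n ?_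
  · refine (WP.seq (C := 1) (WP.set ?_ ?_ (this))).mono (by ring_nf; omega) fun τ h => ?_
    · simpa using hA
    · simp; omega
    · simpa using h.2
  · rintro d τ ⟨hd, h1, h2, h3⟩
    refine ⟨by simp [he τ h2, h3]; omega, ?_⟩
    refine WP.seq ((hs _ (by omega) τ h2 h3 h1).frame.mono le_rfl fun τ' ⟨h4, h5⟩ => ?_)
    have hx' : τ' x 0 = n - (d + 1) := by rw [h5 x hx, h3]
    refine WP.set (by simpa using hA) (by simp [hx']; omega) ⟨d, le_rfl, by omega, ?_, ?_, ?_⟩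
    · simp only [AExpr.eval_ofNat, AExpr.eval_add, AExpr.eval_arr, hx']
      rwa [show n - (d + 1) + 1 = n - d by omega] at *
    · intro b hb hbx
      rw [St.upd_ne _ hbx, h5 b hb, h2 b hb hbx]
    · simp [hx']; omega
  · exact ⟨le_rfl, by simpa using h0, fun b _ hb => St.upd_ne _ hb _ _, by simp⟩

/-- `y := ∑ x < e, body`. -/
def Cmd.sum (x y : Arr) (e body : AExpr) : Cmd :=
  .seq (.set y 0 0) (.for x e (.set y 0 (.arr y 0 + body)))

@[simp] theorem Cmd.writes_sum {x y : Arr} {e body : AExpr} {b : Arr} :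
    (Cmd.sum x y e body).writes b ↔ b = y ∨ b = x := by
  simp [Cmd.sum]; tauto

theorem WP.sum {x y : Arr} {e body : AExpr} {n : ℕ} (F : ℕ → ℕ) (hxa : x ≠ y) (hA : 0 < A)
    (hn : n < V) (hF : ∑ k ∈ Finset.range n, F k < V)
    (he : ∀ τ, (∀ b, b ≠ y → b ≠ x → τ b = σ b) → e.eval I τ = n)
    (hb : ∀ k < n, ∀ τ, (∀ b, b ≠ y → b ≠ x → τ b = σ b) → τ x 0 = k → body.eval I τ = F k) :
    WP I A V (.sum x y e body) σ (3 * n + 3) fun τ =>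
      τ y 0 = ∑ k ∈ Finset.range n, F k ∧ ∀ b, b ≠ y → b ≠ x → τ b = σ b := by
  refine (WP.seq (C := 1) (C' := n * (1 + 2) + 2) (WP.set (by simpa using hA)
    (by simp; omega) ?_)).mono (by omega) fun τ h => h
  set σ1 := σ.upd y 0 0
  have hσ1 : ∀ b, b ≠ y → σ1 b = σ b := fun b hb => St.upd_ne _ hb _ _
  refine (WP.for (σ := σ1) (fun k τ => τ y 0 = ∑ i ∈ Finset.range k, F i) hA hn (by simpa using hxa) ?_ ?_ ?_).mono le_rfl
    ?_
  · intro τ h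
    exact he τ fun b h1 h2 => by rw [h b h1 h2, hσ1 b h1]
  · simp [St.upd_ne _ hxa.symm, σ1]
  · intro k hk τ h1 h2 h3
    have hv := hb k hk τ (fun b h4 h5 => by rw [h1 b h4 h5, hσ1 b h4]) h2
    refine WP.set (by simpa using hA) ?_ ?_
    · simp only [AExpr.eval_add, AExpr.eval_arr, AExpr.eval_ofNat, hv, h3]
      rw [← Finset.sum_range_succ]
      refine lt_of_le_of_lt (Finset.sum_le_sum_of_subset ?_) hF
      exact Finset.range_subset_range.2 hk
    · simp only [AExpr.eval_add, AExpr.eval_arr, AExpr.eval_ofNat, hv, h3,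
        Finset.sum_range_succ, St.upd_ne _ hxa.symm, St.upd_same]
  · rintro τ ⟨h1, h2, h3⟩
    exact ⟨h1, fun b h4 h5 => by rw [h2 b h4 h5, hσ1 b h4]⟩

end


/-! ## Sums over single coordinates -/

section
variable {R : Type*} [CommRing R] (X : ℕ) (U : ℕ → ℕ)

/-- Sum over the values below `X` of the coordinate `t`. -/
def sumAt (t : ℕ) (F : (ℕ → ℕ) → R) : (ℕ → ℕ) → R := fun x =>
  ∑ y ∈ Finset.range X, F (Function.update x t y)

/-- Sum over the coordinates `U l, …, U (h - 1)`. -/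
def sumOut (l : ℕ) : ℕ → ((ℕ → ℕ) → R) → (ℕ → ℕ) → R
  | 0, F => F
  | h + 1, F => if l ≤ h then sumAt X (U h) (sumOut l h F) else F

variable {X U}

theorem sumOut_of_le {l h : ℕ} (hl : h ≤ l) (F : (ℕ → ℕ) → R) : sumOut X U l h F = F := by
  cases h with
  | zero => rfl
  | succ h => exact if_neg (by omega)

theorem sumOut_succ {l h : ℕ} (hl : l ≤ h) (F : (ℕ → ℕ) → R) :
    sumOut X U l (h + 1) F = sumAt X (U h) (sumOut X U l h F) := if_pos hl

theorem sumOut_trans {l k h : ℕ} (hlk : l ≤ k) (hkh : k ≤ h) (F : (ℕ → ℕ) → R) :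
    sumOut X U l h F = sumOut X U k h (sumOut X U l k F) := by
  induction h, hkh using Nat.le_induction with
  | base => rw [sumOut_of_le le_rfl]
  | succ h hkh ih => rw [sumOut_succ (hlk.trans hkh), sumOut_succ hkh, ih]

theorem sumAt_mul {t : ℕ} {S : Set ℕ} {G : (ℕ → ℕ) → R} (hG : DependsOn G S) (ht : t ∉ S)
    (F : (ℕ → ℕ) → R) : sumAt X t (G * F) = G * sumAt X t F := by
  funext x
  simp only [sumAt, Pi.mul_apply, Finset.mul_sum]
  refine Finset.sum_congr rfl fun y _ => ?_
  congr 1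
  refine hG fun s hs => Function.update_of_ne ?_ _ _
  rintro rfl; exact ht hs

theorem sumOut_mul {l h : ℕ} {S : Set ℕ} {G : (ℕ → ℕ) → R} (hG : DependsOn G S)
    (hS : ∀ e, l ≤ e → e < h → U e ∉ S) (F : (ℕ → ℕ) → R) :
    sumOut X U l h (G * F) = G * sumOut X U l h F := by
  induction h with
  | zero => rfl
  | succ h ih =>
    by_cases hl : l ≤ h
    · rw [sumOut_succ hl, sumOut_succ hl, ih fun e h1 h2 => hS e h1 (by omega),
        sumAt_mul hG (hS h hl (by omega))]
    · rw [sumOut_of_le (by omega), sumOut_of_le (by omega)]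

theorem dependsOn_sumAt {t : ℕ} {S : Set ℕ} {F : (ℕ → ℕ) → R} (hF : DependsOn F S) :
    DependsOn (sumAt X t F) (S \ {t}) := by
  intro x y hxy
  refine Finset.sum_congr rfl fun z _ => hF fun s hs => ?_
  by_cases h : s = t
  · subst h; simp
  · rw [Function.update_of_ne h, Function.update_of_ne h]
    exact hxy s ⟨hs, h⟩

theorem dependsOn_sumOut {l h : ℕ} {S : Set ℕ} {F : (ℕ → ℕ) → R} (hF : DependsOn F S) :
    DependsOn (sumOut X U l h F) (S \ {t | ∃ e, l ≤ e ∧ e < h ∧ U e = t}) := by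
  induction h with
  | zero => exact hF.mono fun s hs => ⟨hs, fun ⟨e, _, he, _⟩ => by omega⟩
  | succ h ih =>
    by_cases hl : l ≤ h
    · rw [sumOut_succ hl]
      refine (dependsOn_sumAt ih).mono fun s hs => ⟨hs.1.1, ?_⟩
      rintro ⟨e, h1, h2, h3⟩
      rcases (show e < h ∨ e = h by omega) with h4 | rfl
      · exact hs.1.2 ⟨e, h1, h4, h3⟩
      · exact hs.2 h3.symm
    · rw [sumOut_of_le (by omega)]
      exact hF.mono fun s hs => ⟨hs, fun ⟨e, _, he, _⟩ => by omega⟩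

/-- The total weight of the positions from `l` to `h - 1`, where position `e` contributes the
factor `g e`. -/
def partSum (X : ℕ) (U : ℕ → ℕ) (g : ℕ → (ℕ → ℕ) → R) (l h : ℕ) : (ℕ → ℕ) → R :=
  sumOut X U l h (∏ e ∈ Finset.Ico l h, g e)

variable {g : ℕ → (ℕ → ℕ) → R} {S : ℕ → Set ℕ}

theorem dependsOn_prod {s : Finset ℕ} {D : Set ℕ} (hg : ∀ e ∈ s, DependsOn (g e) D) :
    DependsOn (∏ e ∈ s, g e) D := by
  intro x y hxy
  rw [Finset.prod_apply, Finset.prod_apply]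
  exact Finset.prod_congr rfl fun e he => hg e he hxy

theorem partSum_self (l : ℕ) : partSum X U g l l = 1 := by
  simp [partSum, sumOut_of_le]

/-- Fubini for independent blocks: by `h1` the factors of the right block are constants for the sum
over the left block; by `h2` the resulting left sum is a constant for the sum over the right block.
-/
theorem partSum_trans (hg : ∀ e, DependsOn (g e) (S e)) {l k h : ℕ} (hlk : l ≤ k) (hkh : k ≤ h)
    (h1 : ∀ e, k ≤ e → e < h → ∀ e', l ≤ e' → e' < k → U e' ∉ S e)
    (h2 : ∀ e, k ≤ e → e < h → ∀ e', l ≤ e' → e' < k → U e ∉ S e') :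
    partSum X U g l h = partSum X U g l k * partSum X U g k h := by
  unfold partSum
  rw [sumOut_trans hlk hkh, ← Finset.prod_Ico_consecutive g hlk hkh, mul_comm (∏ _ ∈ _, _)]
  rw [sumOut_mul (S := ⋃ e ∈ Finset.Ico k h, S e), mul_comm]
  · rw [sumOut_mul (S := (⋃ e ∈ Finset.Ico l k, S e) \ {t | ∃ e, l ≤ e ∧ e < k ∧ U e = t})]
    · exact dependsOn_sumOut (dependsOn_prod fun e he => (hg e).mono
        (Set.subset_biUnion_of_mem (u := fun e => S e) (by simpa using he)))
    · rintro e he1 he2 ⟨he3, -⟩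
      simp only [Finset.mem_Ico, Set.mem_iUnion] at he3
      obtain ⟨e', ⟨h4, h5⟩, h6⟩ := he3
      exact h2 e he1 he2 e' h4 h5 h6
  · exact dependsOn_prod fun e he => (hg e).mono
        (Set.subset_biUnion_of_mem (u := fun e => S e) (by simpa using he))
  · intro e he1 he2 he3
    simp only [Finset.mem_Ico, Set.mem_iUnion] at he3
    obtain ⟨e', ⟨h4, h5⟩, h6⟩ := he3
    exact h1 e' h4 h5 e he1 he2 h6

theorem partSum_succ (hg : ∀ e, DependsOn (g e) (S e)) {l p : ℕ} (hlp : l ≤ p)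
    (h1 : ∀ e, l ≤ e → e < p → U e ∉ S p) :
    partSum X U g l (p + 1) = sumAt X (U p) (g p * partSum X U g l p) := by
  unfold partSum
  rw [sumOut_succ hlp, Finset.prod_Ico_succ_top hlp, mul_comm (∏ _ ∈ _, _), sumOut_mul (hg p) h1]

/-- The point with the coordinates `y` at `U 0, …, U (h - 1)` and those of `x` elsewhere. -/
def extendBy (U : ℕ → ℕ) : (h : ℕ) → (Fin h → ℕ) → (ℕ → ℕ) → ℕ → ℕ
  | 0, _, x => x
  | h + 1, y, x => extendBy U h (fun i => y i.castSucc) (Function.update x (U h) (y (Fin.last h)))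

theorem extendBy_of_ne {h : ℕ} {t : ℕ} (ht : ∀ e < h, U e ≠ t) (y : Fin h → ℕ) (x : ℕ → ℕ) :
    extendBy U h y x t = x t := by
  induction h generalizing x with
  | zero => rfl
  | succ h ih =>
    rw [extendBy, ih (fun e he => ht e (by omega)), Function.update_of_ne (ht h (by omega)).symm]

theorem extendBy_apply {h : ℕ} (hU : ∀ e < h, ∀ e' < h, U e = U e' → e = e') (y : Fin h → ℕ)
    (x : ℕ → ℕ) (i : Fin h) : extendBy U h y x (U i) = y i := by
  induction h generalizing x with
  | zero => exact i.elim0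
  | succ h ih =>
    rw [extendBy]
    rcases Fin.eq_castSucc_or_eq_last i with ⟨j, rfl⟩ | rfl
    · exact ih (fun e he e' he' => hU e (by omega) e' (by omega)) _ _ j
    · rw [extendBy_of_ne, Fin.val_last, Function.update_self]
      intro e he h2
      exact absurd (hU e (by omega) h (by omega) h2) (by omega)

/-- The outermost sum of `sumOut` belongs to the last coordinate, which `Fin.snocEquiv` splits off
from a tuple. -/
theorem sumOut_eq_sum (h : ℕ) (F : (ℕ → ℕ) → R) (x : ℕ → ℕ) :
    sumOut X U 0 h F x = ∑ y : Fin h → Fin X, F (extendBy U h (fun i => y i) x) := by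
  induction h generalizing x with
  | zero => simp [sumOut, extendBy]
  | succ h ih =>
    rw [sumOut_succ (Nat.zero_le _), ← (Fin.snocEquiv fun _ => Fin X).sum_comp,
      Fintype.sum_prod_type, sumAt, Finset.sum_range]
    refine Finset.sum_congr rfl fun z _ => ?_
    rw [ih]
    refine Finset.sum_congr rfl fun y _ => ?_
    simp [Fin.snocEquiv, extendBy]

end

/-! ## Binary digits -/

/-- The digit of `x` at the place of value `p` (0 if `p = 0`). -/
def digit (x p : ℕ) : ℕ := x / p % 2

theorem digit_lt (x p : ℕ) : digit x p < 2 := Nat.mod_lt _ two_pos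

section
variable (b : ℕ → Prop) [DecidablePred b]

/-- The number that has the digits `a v` for the `v < k` with `b v`. -/
def packBits (a : ℕ → ℕ) (k : ℕ) : ℕ :=
  ∑ v ∈ Finset.range k, if b v then a v * 2 ^ Nat.count b v else 0

variable {b}

theorem packBits_lt {a : ℕ → ℕ} (ha : ∀ v, a v < 2) (k : ℕ) :
    packBits b a k < 2 ^ Nat.count b k := by
  induction k with
  | zero => simp [packBits]
  | succ k ih =>
    rw [packBits, Finset.sum_range_succ, ← packBits, Nat.count_succ]
    split_ifs
    · have : a k * 2 ^ Nat.count b k ≤ 1 * 2 ^ Nat.count b k := by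
        gcongr; have := ha k; omega
      rw [pow_succ]; omega
    · simpa using ih

theorem digit_packBits {a : ℕ → ℕ} (ha : ∀ v, a v < 2) {k v : ℕ} (hv : v < k) (hb : b v) :
    digit (packBits b a k) (2 ^ Nat.count b v) = a v := by
  induction k with
  | zero => omega
  | succ k ih =>
    rw [packBits, Finset.sum_range_succ, ← packBits]
    rcases (show v < k ∨ v = k by omega) with h | rfl
    · rw [← ih h]
      split_ifs with hk
      · have hc : Nat.count b v + 1 ≤ Nat.count b k := by
          rw [← Nat.count_succ_eq_succ_count_iff.2 hb]
          exact Nat.count_monotone b h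
        obtain ⟨d, hd⟩ := Nat.exists_eq_add_of_le hc
        unfold digit
        rw [hd, show a k * 2 ^ (Nat.count b v + 1 + d) =
          2 ^ Nat.count b v * (2 * (a k * 2 ^ d)) by ring, Nat.add_mul_div_left _ _ (by positivity),
          Nat.add_mul_mod_self_left]
      · simp
    · rw [if_pos hb, digit, Nat.add_mul_div_right _ _ (by positivity),
        Nat.div_eq_of_lt (packBits_lt ha v), zero_add]
      exact Nat.mod_eq_of_lt (ha v)

theorem packBits_digit {x k : ℕ} (hx : x < 2 ^ Nat.count b k) :
    packBits b (fun v => digit x (2 ^ Nat.count b v)) k = x := by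
  -- For the induction the bound on `x` is dropped: packing the digits of the first positions gives
  -- a remainder.
  have key : ∀ k, packBits b (fun v => digit x (2 ^ Nat.count b v)) k = x % 2 ^ Nat.count b k := by
    intro k
    induction k with
    | zero => simp [packBits, Nat.mod_one]
    | succ k ih =>
      rw [packBits, Finset.sum_range_succ, ← packBits, ih, Nat.count_succ]
      split_ifs
      · rw [pow_succ, Nat.mod_mul, digit, mul_comm]
      · simp
  rw [key, Nat.mod_eq_of_lt hx]

theorem packBits_congr {a a' : ℕ → ℕ} {k : ℕ} (h : ∀ v < k, b v → a v = a' v) :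
    packBits b a k = packBits b a' k := by
  refine Finset.sum_congr rfl fun v hv => ?_
  split_ifs with hb
  · rw [h v (Finset.mem_range.1 hv) hb]
  · rfl

end


/-! ## Instances in terms of natural numbers, and the count of their satisfying assignments -/

/-- A CNF formula with a tree decomposition. Variables are `0, …, n - 1`, clauses `0, …, m - 1`,
nodes `0, …, N - 1`; in bags, clause `j` is the vertex `n + j`. -/
structure Inst where
  n : ℕ
  m : ℕ
  N : ℕ
  pos : ℕ → ℕ → Prop
  neg : ℕ → ℕ → Prop
  adj : ℕ → ℕ → Prop
  inB : ℕ → ℕ → Prop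
  N_pos : 0 < N
  adj_symm : ∀ {s t}, adj s t → adj t s
  adj_lt : ∀ {s t}, adj s t → s < N
  adj_ne : ∀ {s t}, adj s t → s ≠ t
  connected : ∀ t < N, Relation.ReflTransGen adj 0 t
  card_adj : {p : ℕ × ℕ | adj p.1 p.2}.ncard = 2 * (N - 1)
  inB_lt : ∀ {t v}, inB t v → t < N ∧ v < n + m
  cover : ∀ v < n + m, ∃ t, inB t v
  edge : ∀ j < m, ∀ u < n, pos j u ∨ neg j u → ∃ t, inB t u ∧ inB t (n + j)
  subtree : ∀ {v s t}, inB s v → inB t v →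
    Relation.ReflTransGen (fun a b => adj a b ∧ inB a v ∧ inB b v) s t

namespace Inst
open Classical

variable (T : Inst) {R : Type*} [CommRing R]

/-- The place value of the digit that represents the vertex `v` at the node `t`. -/
noncomputable def pw (t v : ℕ) : ℕ := if T.inB t v then 2 ^ Nat.count (T.inB t) v else 0

/-- The number of states of the node `t`. -/
noncomputable def full (t : ℕ) : ℕ := 2 ^ Nat.count (T.inB t) (T.n + T.m)

/-- `t` is the node with the smallest number that contains `v`. -/
def first (t v : ℕ) : Prop := T.inB t v ∧ ∀ s < t, ¬ T.inB s v

/-- In the state `x` of the node `t`, the clause `j` is selected, but contains the true literal with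
the variable `u`. -/
def Clash (t x j u : ℕ) : Prop := digit x (T.pw t (T.n + j)) = 1 ∧
  ((T.pos j u ∧ digit x (T.pw t u) = 1) ∨
    (T.neg j u ∧ T.inB t u ∧ digit x (T.pw t u) = 0))

/-- The weight of the state `x` of the node `t`. -/
noncomputable def nodeWeight (R : Type*) [CommRing R] (t x : ℕ) : R :=
  if x < T.full t ∧ ∀ j < T.m, ∀ u < T.n, ¬ T.Clash t x j u then
    ∏ j ∈ Finset.range T.m, if T.first t (T.n + j) ∧ digit x (T.pw t (T.n + j)) = 1 then -1 else 1
  else 0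

/-- The states `x` of `s` and `y` of `t` agree on the common vertices. -/
def Agree (s t x y : ℕ) : Prop :=
  ∀ v, T.inB s v → T.inB t v → digit x (T.pw s v) = digit y (T.pw t v)

variable {T} in
theorem Agree.symm {s t x y : ℕ} (h : T.Agree s t x y) : T.Agree t s y x :=
  fun v h1 h2 => (h v h2 h1).symm

/-- The weight of a choice of states for all nodes. -/
noncomputable def weight (R : Type*) [CommRing R] (x : ℕ → ℕ) : R :=
  (∏ t ∈ Finset.range T.N, T.nodeWeight R t (x t)) *
    if ∀ s t, T.adj s t → T.Agree s t (x s) (x t) then 1 else 0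

/-- Some literal of the clause `j` is true. -/
def ClauseTrue (α : Fin T.n → Bool) (j : ℕ) : Prop :=
  ∃ u : Fin T.n, (T.pos j u ∧ α u = true) ∨ (T.neg j u ∧ α u = false)

/-- The satisfying assignments. -/
noncomputable def models : Finset (Fin T.n → Bool) :=
  Finset.univ.filter fun α => ∀ j < T.m, T.ClauseTrue α j

/-- The truth values as digits. -/
def digitOf (a : (Fin T.n → Bool) × (Fin T.m → Bool)) (v : ℕ) : ℕ :=
  if h : v < T.n then (a.1 ⟨v, h⟩).toNat else
    if h : v - T.n < T.m then (a.2 ⟨v - T.n, h⟩).toNat else 0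

variable {T}

theorem digitOf_lt (a : (Fin T.n → Bool) × (Fin T.m → Bool)) (v : ℕ) : T.digitOf a v < 2 := by
  unfold digitOf
  split_ifs
  · exact Bool.toNat_lt _
  · exact Bool.toNat_lt _
  · exact two_pos

theorem digitOf_var (a : (Fin T.n → Bool) × (Fin T.m → Bool)) (u : Fin T.n) :
    T.digitOf a u = (a.1 u).toNat := by simp [digitOf]

theorem digitOf_clause (a : (Fin T.n → Bool) × (Fin T.m → Bool)) (j : Fin T.m) :
    T.digitOf a (T.n + j) = (a.2 j).toNat := by simp [digitOf]

theorem digitOf_surj {c : ℕ → ℕ} (hc : ∀ v, c v < 2) :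
    ∃ a, ∀ v < T.n + T.m, T.digitOf a v = c v := by
  refine ⟨(fun u => decide (c u = 1), fun j => decide (c (T.n + j) = 1)), fun v hv => ?_⟩
  have := hc v
  by_cases h : v < T.n
  · simp only [digitOf, dif_pos h]
    by_cases h1 : c v = 1
    · simp [h1]
    · simp [h1]; omega
  · have h2 : v - T.n < T.m := by omega
    simp only [digitOf, dif_neg h, dif_pos h2, show T.n + (v - T.n) = v by omega]
    by_cases h1 : c v = 1
    · simp [h1]
    · simp [h1]; omega

/-- The state of the node `t` that the truth values determine. -/
noncomputable def stateOf (a : (Fin T.n → Bool) × (Fin T.m → Bool)) (t : ℕ) : ℕ :=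
  packBits (T.inB t) (T.digitOf a) (T.n + T.m)

theorem stateOf_lt (a : (Fin T.n → Bool) × (Fin T.m → Bool)) (t : ℕ) : stateOf a t < T.full t :=
  packBits_lt (digitOf_lt a) _

theorem digit_stateOf (a : (Fin T.n → Bool) × (Fin T.m → Bool)) {t v : ℕ} (h : T.inB t v) :
    digit (stateOf a t) (T.pw t v) = T.digitOf a v := by
  rw [pw, if_pos h]
  exact digit_packBits (digitOf_lt a) (T.inB_lt h).2 h

theorem digit_pw_of_not {t v : ℕ} (h : ¬ T.inB t v) (x : ℕ) : digit x (T.pw t v) = 0 := by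
  simp [pw, if_neg h, digit]

theorem exists_first {v : ℕ} (hv : v < T.n + T.m) : ∃ t, T.first t v :=
  ⟨Nat.find (T.cover v hv), Nat.find_spec (T.cover v hv),
    fun _ hs => Nat.find_min (T.cover v hv) hs⟩

theorem first_unique {s t v : ℕ} (hs : T.first s v) (ht : T.first t v) : s = t := by
  rcases lt_trichotomy s t with h | h | h
  · exact absurd hs.1 (ht.2 s h)
  · exact h
  · exact absurd ht.1 (hs.2 t h)

/-- The second component of `a` is the set of selected clauses. States read off from one pair agree
everywhere. A selected true clause shows up as a clash in a bag that contains the clause and the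
variable of a true literal; otherwise each selected clause contributes its sign exactly once, at the
first node that contains it. -/
theorem weight_stateOf (a : (Fin T.n → Bool) × (Fin T.m → Bool)) {x : ℕ → ℕ}
    (hx : ∀ t < T.N, x t = stateOf a t) :
    T.weight R x = ∏ j : Fin T.m,
      if a.2 j = true then (if T.ClauseTrue a.1 j then 0 else -1) else 1 := by
  have hd : ∀ {t v}, T.inB t v → digit (x t) (T.pw t v) = T.digitOf a v := fun h => by
    rw [hx _ (T.inB_lt h).1, digit_stateOf a h]
  rw [weight, if_pos, mul_one]
  swap
  · intro s t _ v h1 h2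
    rw [hd h1, hd h2]
  by_cases hc : ∃ j : Fin T.m, a.2 j = true ∧ T.ClauseTrue a.1 j
  · obtain ⟨j, hj, u, hu⟩ := hc
    rw [Finset.prod_eq_zero (Finset.mem_univ j) (by rw [if_pos hj, if_pos ⟨u, hu⟩])]
    obtain ⟨t, ht1, ht2⟩ := T.edge j j.2 u u.2 (by tauto)
    refine Finset.prod_eq_zero (Finset.mem_range.2 (T.inB_lt ht1).1) ?_
    rw [nodeWeight, if_neg]
    rintro ⟨-, h⟩
    refine h j j.2 u u.2 ⟨?_, ?_⟩
    · rw [hd ht2, digitOf_clause, hj]; rfl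
    · rw [hd ht1, digitOf_var]
      rcases hu with ⟨h1, h2⟩ | ⟨h1, h2⟩
      · exact Or.inl ⟨h1, by rw [h2]; rfl⟩
      · exact Or.inr ⟨h1, ht1, by rw [h2]; rfl⟩
  · push Not at hc
    have h1 : ∀ t ∈ Finset.range T.N, T.nodeWeight R t (x t) = ∏ j ∈ Finset.range T.m,
        if T.first t (T.n + j) ∧ T.digitOf a (T.n + j) = 1 then -1 else 1 := by
      intro t ht
      rw [nodeWeight, if_pos]
      · refine Finset.prod_congr rfl fun j _ => ?_
        by_cases hf : T.first t (T.n + j)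
        · rw [hd hf.1]
        · simp [hf]
      · refine ⟨by rw [hx t (Finset.mem_range.1 ht)]; exact stateOf_lt a t, ?_⟩
        rintro j hj u hu ⟨h1, h2⟩
        have hb : T.inB t (T.n + j) := by
          by_contra hb
          rw [digit_pw_of_not hb] at h1
          exact zero_ne_one h1
        rw [hd hb, digitOf_clause a ⟨j, hj⟩] at h1
        refine hc ⟨j, hj⟩ (by simpa using h1) ⟨⟨u, hu⟩, ?_⟩
        rcases h2 with ⟨h3, h4⟩ | ⟨h3, h4, h5⟩
        · left
          have hb : T.inB t u := by
            by_contra hb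
            rw [digit_pw_of_not hb] at h4
            exact zero_ne_one h4
          rw [hd hb, digitOf_var a ⟨u, hu⟩] at h4
          exact ⟨h3, by simpa using h4⟩
        · right
          rw [hd h4, digitOf_var a ⟨u, hu⟩] at h5
          exact ⟨h3, by simpa using h5⟩
    -- With the two products exchanged, the inner product over the nodes has a nontrivial factor at
    -- most at the first node of the clause.
    rw [Finset.prod_congr rfl h1, Finset.prod_comm, Finset.prod_range]
    refine Finset.prod_congr rfl fun j _ => ?_
    obtain ⟨t, ht⟩ := T.exists_first (v := T.n + j) (by omega)
    rw [Finset.prod_eq_single t]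
    · rw [digitOf_clause]
      by_cases hj : a.2 j = true
      · simp [ht, hj, hc j hj]
      · simp [hj]
    · intro s _ hs
      rw [if_neg]
      rintro ⟨h, -⟩
      exact hs (first_unique h ht)
    · intro h
      exact absurd (Finset.mem_range.2 (T.inB_lt ht.1).1) h

/-- A nonzero weight forces agreement along edges. The nodes whose bags contain a vertex are
connected by edges inside this set, so the digit of the vertex is the same in all these bags, and it
may be read off from any of them. -/
theorem exists_stateOf {x : ℕ → ℕ} (hx : T.weight R x ≠ 0) :
    ∃ a : (Fin T.n → Bool) × (Fin T.m → Bool), ∀ t < T.N, x t = stateOf a t := by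
  have hok : ∀ s t, T.adj s t → T.Agree s t (x s) (x t) := by
    by_contra h
    exact hx (by rw [weight, if_neg h, mul_zero])
  have hlt : ∀ t < T.N, x t < T.full t := by
    intro t ht
    by_contra h
    refine hx ?_
    rw [weight, Finset.prod_eq_zero (Finset.mem_range.2 ht), zero_mul]
    rw [nodeWeight, if_neg fun h' => h h'.1]
  have hag : ∀ {v s t}, T.inB s v → T.inB t v →
      digit (x s) (T.pw s v) = digit (x t) (T.pw t v) := by
    intro v s t hs ht
    have := T.subtree hs ht
    clear ht
    induction this with
    | refl => rfl
    | tail _ h2 ih => rw [ih, hok _ _ h2.1 v h2.2.1 h2.2.2]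
  choose node hnode using T.cover
  obtain ⟨a, ha⟩ := T.digitOf_surj
    (c := fun v => if h : v < T.n + T.m then digit (x (node v h)) (T.pw (node v h) v) else 0) (by
      intro v
      split_ifs
      · exact digit_lt _ _
      · exact two_pos)
  refine ⟨a, fun t ht => ?_⟩
  rw [stateOf, ← packBits_digit (hlt t ht)]
  refine packBits_congr fun v hv hb => ?_
  rw [ha v hv]
  simp only [dif_pos hv]
  rw [hag (hnode v hv) hb, pw, if_pos hb]

/-- The inclusion-exclusion step. Numbers between `T.full t` and `X` are not states and have weight
0, so any common bound `X` will do; the order `U` in which the nodes are summed is irrelevant. -/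
theorem sum_weight {X : ℕ} {U : ℕ → ℕ} (hU : ∀ e < T.N, ∀ e' < T.N, U e = U e' → e = e')
    (hU' : ∀ e < T.N, U e < T.N) (hX : ∀ t < T.N, T.full t ≤ X) (x : ℕ → ℕ) :
    sumOut X U 0 T.N (T.weight R) x = (T.models.card : R) := by
  rw [sumOut_eq_sum]
  have hsurj : ∀ t < T.N, ∃ i : Fin T.N, U i = t := by
    intro t ht
    have hinj : Function.Injective fun i : Fin T.N => (⟨U i, hU' i i.2⟩ : Fin T.N) := by
      intro i j h
      exact Fin.ext (hU i i.2 j j.2 (by simpa using h))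
    obtain ⟨i, hi⟩ := (Finite.injective_iff_surjective.1 hinj) ⟨t, ht⟩
    exact ⟨i, by simpa using hi⟩
  let st : (Fin T.n → Bool) × (Fin T.m → Bool) → Fin T.N → Fin X := fun a i =>
    ⟨stateOf a (U i), (stateOf_lt a _).trans_le (hX _ (hU' i i.2))⟩
  have hst : ∀ (y : Fin T.N → Fin X) a, (∀ t < T.N, extendBy U T.N (fun i => y i) x t = stateOf a t)
      ↔ y = st a := by
    intro y a
    constructor
    · intro h
      funext i
      refine Fin.ext ?_
      have := h (U i) (hU' i i.2)
      rwa [extendBy_apply hU] at this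
    · rintro rfl t ht
      obtain ⟨i, rfl⟩ := hsurj t ht
      rw [extendBy_apply hU]
  -- Only families of states that come from a pair contribute, and distinct pairs give distinct
  -- families since every vertex is in some bag. So the sum is one over pairs.
  rw [← Fintype.sum_of_injective st ?_ (fun a => ∏ j : Fin T.m,
      if a.2 j = true then (if T.ClauseTrue a.1 j then (0 : R) else -1) else 1)]
  · rw [Fintype.sum_prod_type]
    have h1 : ∀ α : Fin T.n → Bool, ∑ s : Fin T.m → Bool, ∏ j : Fin T.m,
        (if s j = true then (if T.ClauseTrue α j then (0 : R) else -1) else 1) =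
        if ∀ j < T.m, T.ClauseTrue α j then 1 else 0 := by
      intro α
      -- By distributivity, the sum over all sets of clauses is a product over the clauses of sums
      -- with two terms.
      have h2 := Finset.prod_univ_sum (fun _ : Fin T.m => (Finset.univ : Finset Bool))
        (fun j b => if b = true then (if T.ClauseTrue α j then (0 : R) else -1) else 1)
      rw [Fintype.piFinset_univ] at h2
      rw [← h2]
      split_ifs with h3
      · refine Finset.prod_eq_one fun j _ => ?_
        simp [h3 j j.2]
      · push Not at h3
        obtain ⟨j, hj, h4⟩ := h3
        exact Finset.prod_eq_zero (Finset.mem_univ ⟨j, hj⟩) (by simp [h4])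
    simp only [h1, models]
    rw [Finset.sum_boole]
  · intro y hy
    by_contra h
    obtain ⟨a, ha⟩ := exists_stateOf h
    exact hy ⟨a, ((hst y a).1 ha).symm⟩
  · intro a
    exact (weight_stateOf a ((hst _ a).2 rfl)).symm
  · intro a b hab
    have h1 : ∀ v < T.n + T.m, T.digitOf a v = T.digitOf b v := by
      intro v hv
      obtain ⟨t, ht⟩ := T.cover v hv
      obtain ⟨i, rfl⟩ := hsurj t (T.inB_lt ht).1
      rw [← digit_stateOf a ht, ← digit_stateOf b ht]
      have := congrArg (fun y => (y i : ℕ)) hab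
      simp only [st] at this
      rw [this]
    refine Prod.ext (funext fun u => ?_) (funext fun j => ?_)
    · have := h1 u (by omega)
      rw [digitOf_var, digitOf_var] at this
      revert this; cases a.1 u <;> cases b.1 u <;> simp
    · have := h1 (T.n + j) (by omega)
      rw [digitOf_clause, digitOf_clause] at this
      revert this; cases a.2 j <;> cases b.2 j <;> simp

theorem card_models_le : T.models.card ≤ 2 ^ T.n := by
  refine (Finset.card_le_univ _).trans ?_
  simp

end Inst
namespace Inst
open Classical

/-! ## Rooted trees and their decomposition -/

/-- `par` and `anc` are the parents and the ancestors (a node is an ancestor of itself) when the tree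
is rooted at `0`; the parent of the root is `N`. -/
structure Rooted (T : Inst) (par : ℕ → ℕ) (anc : ℕ → ℕ → Prop) (rk : ℕ → ℕ) : Prop where
  par_zero : par 0 = T.N
  adj_par : ∀ {t}, t ≠ 0 → t < T.N → T.adj (par t) t
  anc_zero : ∀ {a}, anc a 0 ↔ a = 0
  anc_step : ∀ {a t}, t ≠ 0 → t < T.N → (anc a t ↔ a = t ∨ anc a (par t))
  anc_lt : ∀ {a t}, anc a t → t < T.N
  rk_lt : ∀ {t}, t ≠ 0 → t < T.N → rk (par t) < rk t
  adj_cases : ∀ {s t}, T.adj s t → t ≠ 0 ∧ par t = s ∨ s ≠ 0 ∧ par s = t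

/-- The number of descendants. -/
noncomputable def size (T : Inst) (anc : ℕ → ℕ → Prop) (a : ℕ) : ℕ :=
  ((Finset.range T.N).filter fun t => anc a t).card

/-- The descendants of `r` that are not descendants of `b`. -/
noncomputable def comp (T : Inst) (anc : ℕ → ℕ → Prop) (r b : ℕ) : Finset ℕ :=
  (Finset.range T.N).filter fun t => anc r t ∧ ¬ anc b t

/-- `b` is a proper descendant of `r`, or missing. -/
def Valid (T : Inst) (anc : ℕ → ℕ → Prop) (r b : ℕ) : Prop :=
  r < T.N ∧ (b = T.N ∨ anc r b ∧ b ≠ r)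

/-- The nodes that lie between `r` and `b` and have a large part of the component below them. -/
def Cand (T : Inst) (anc : ℕ → ℕ → Prop) (r b t : ℕ) : Prop :=
  anc r t ∧ (b = T.N ∨ anc t b) ∧ t ≠ b ∧
    5 * (T.size anc r - T.size anc b) < 8 * (T.size anc t - T.size anc b)

/-- `u` is the lowest candidate. -/
def Split (T : Inst) (anc : ℕ → ℕ → Prop) (r b u : ℕ) : Prop :=
  T.Cand anc r b u ∧ ∀ t, T.Cand anc r b t → T.size anc u ≤ T.size anc t

/-- `(r', b')` is one of the components that arise from `(r, b)` when `u` is removed. -/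
def Piece (T : Inst) (par : ℕ → ℕ) (anc : ℕ → ℕ → Prop) (r b u r' b' : ℕ) : Prop :=
  (r' = r ∧ b' = u ∧ r ≠ u) ∨
  (r' ≠ 0 ∧ r' < T.N ∧ par r' = u ∧ (b' = if anc r' b then b else T.N) ∧ r' ≠ b)

/-- The component is small enough for a decomposition of depth `d`. -/
def Small (T : Inst) (anc : ℕ → ℕ → Prop) (d r b : ℕ) : Prop :=
  b = T.N ∧ (T.size anc r - T.size anc b) * 5 ^ d < 8 ^ d ∨
    (T.size anc r - T.size anc b) * 5 ^ d * 8 < 8 ^ d * 5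

namespace Rooted
variable {T : Inst} {par : ℕ → ℕ} {anc : ℕ → ℕ → Prop} {rk : ℕ → ℕ} (h : T.Rooted par anc rk)
include h

theorem par_lt {t : ℕ} (h0 : t ≠ 0) (ht : t < T.N) : par t < T.N := T.adj_lt (h.adj_par h0 ht)

theorem refl {t : ℕ} (ht : t < T.N) : anc t t := by
  by_cases h0 : t = 0
  · subst h0; exact h.anc_zero.2 rfl
  · exact (h.anc_step h0 ht).2 (Or.inl rfl)

/-- Induction from the root to the leaves. -/
theorem induction {P : ℕ → Prop} (h0 : P 0)
    (hs : ∀ t, t ≠ 0 → t < T.N → P (par t) → P t) : ∀ t < T.N, P t := by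
  intro t
  induction hk : rk t using Nat.strong_induction_on generalizing t with
  | _ k ih =>
    intro ht
    by_cases h1 : t = 0
    · subst h1; exact h0
    · exact hs t h1 ht (ih _ (hk ▸ h.rk_lt h1 ht) _ rfl (h.par_lt h1 ht))

theorem anc_lt_left {a t : ℕ} (hat : anc a t) : a < T.N := by
  have := h.induction (P := fun t => ∀ a, anc a t → a < T.N)
    (fun a ha => by rw [h.anc_zero.1 ha]; exact T.N_pos)
    (fun t h0 ht ih a ha => by
      rcases (h.anc_step h0 ht).1 ha with rfl | h1
      · exact ht
      · exact ih a h1) t (h.anc_lt hat)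
  exact this a hat

theorem not_anc_left (t : ℕ) : ¬ anc T.N t := fun h1 => lt_irrefl _ (h.anc_lt_left h1)

theorem not_anc_right (t : ℕ) : ¬ anc t T.N := fun h1 => lt_irrefl _ (h.anc_lt h1)

theorem root {t : ℕ} (ht : t < T.N) : anc 0 t :=
  h.induction (P := fun t => anc 0 t) (h.anc_zero.2 rfl)
    (fun _ h0 ht ih => (h.anc_step h0 ht).2 (Or.inr ih)) t ht

theorem trans {a b t : ℕ} (hab : anc a b) (hbt : anc b t) : anc a t := by
  refine h.induction (P := fun t => anc b t → anc a t) ?_ ?_ t (h.anc_lt hbt) hbt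
  · intro h1; rw [h.anc_zero] at h1; rwa [h1] at hab
  · intro t h0 ht ih h1
    rcases (h.anc_step h0 ht).1 h1 with rfl | h2
    · exact hab
    · exact (h.anc_step h0 ht).2 (Or.inr (ih h2))

theorem rk_of_anc {a t : ℕ} (hat : anc a t) : a = t ∨ rk a < rk t := by
  refine h.induction (P := fun t => ∀ a, anc a t → a = t ∨ rk a < rk t) ?_ ?_ t (h.anc_lt hat) a hat
  · intro a ha; exact Or.inl (h.anc_zero.1 ha)
  · intro t h0 ht ih a ha
    rcases (h.anc_step h0 ht).1 ha with rfl | h2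
    · exact Or.inl rfl
    · right
      have := h.rk_lt h0 ht
      rcases ih a h2 with rfl | h3
      · exact this
      · omega

theorem antisymm {a b : ℕ} (hab : anc a b) (hba : anc b a) : a = b := by
  rcases h.rk_of_anc hab with h1 | h1
  · exact h1
  · rcases h.rk_of_anc hba with h2 | h2
    · exact h2.symm
    · omega

theorem total {a b t : ℕ} (hat : anc a t) (hbt : anc b t) : anc a b ∨ anc b a := by
  refine h.induction (P := fun t => anc a t → anc b t → anc a b ∨ anc b a) ?_ ?_ t (h.anc_lt hat)
    hat hbt
  · intro h1 h2
    rw [h.anc_zero] at h1 h2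
    subst h1 h2
    exact Or.inl (h.refl T.N_pos)
  · intro t h0 ht ih h1 h2
    rcases (h.anc_step h0 ht).1 h1 with rfl | h3
    · exact Or.inr h2
    · rcases (h.anc_step h0 ht).1 h2 with rfl | h4
      · exact Or.inl h1
      · exact ih h3 h4

theorem anc_par {t : ℕ} (h0 : t ≠ 0) (ht : t < T.N) : anc (par t) t :=
  (h.anc_step h0 ht).2 (Or.inr (h.refl (h.par_lt h0 ht)))

theorem not_anc_par {t : ℕ} (h0 : t ≠ 0) (ht : t < T.N) : ¬ anc t (par t) := fun h1 => by
  have := h.rk_lt h0 ht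
  rcases h.rk_of_anc h1 with h2 | h2
  · rw [← h2] at this; omega
  · omega

theorem anc_par_of_ne {a t : ℕ} (hat : anc a t) (hne : a ≠ t) : t ≠ 0 ∧ anc a (par t) := by
  have h0 : t ≠ 0 := by rintro rfl; exact hne (h.anc_zero.1 hat)
  exact ⟨h0, ((h.anc_step h0 (h.anc_lt hat)).1 hat).resolve_left hne⟩

theorem child_unique {c c' t : ℕ} (h0 : c ≠ 0) (hc : c < T.N) (h0' : c' ≠ 0) (hc' : c' < T.N)
    (hp : par c = par c') (ht : anc c t) (ht' : anc c' t) : c = c' := by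
  by_contra hne
  rcases h.total ht ht' with h1 | h1
  · exact h.not_anc_par h0 hc (hp ▸ (h.anc_par_of_ne h1 hne).2)
  · exact h.not_anc_par h0' hc' (hp ▸ (h.anc_par_of_ne h1 (Ne.symm hne)).2)

/-- The child of `a` that is an ancestor of `t`. -/
theorem exists_child {a t : ℕ} (hat : anc a t) (hne : a ≠ t) :
    ∃ c, c ≠ 0 ∧ c < T.N ∧ par c = a ∧ anc c t := by
  refine h.induction (P := fun t => anc a t → a ≠ t → ∃ c, c ≠ 0 ∧ c < T.N ∧ par c = a ∧ anc c t)
    ?_ ?_ t (h.anc_lt hat) hat hne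
  · intro h1 h2; exact absurd (h.anc_zero.1 h1) h2
  · intro t h0 ht ih h1 h2
    by_cases h3 : a = par t
    · exact ⟨t, h0, ht, h3.symm, h.refl ht⟩
    · obtain ⟨c, h4, h5, h6, h7⟩ := ih (h.anc_par_of_ne h1 h2).2 h3
      exact ⟨c, h4, h5, h6, h.trans h7 (h.anc_par h0 ht)⟩

theorem mem_comp {r b t : ℕ} : t ∈ T.comp anc r b ↔ anc r t ∧ ¬ anc b t := by
  simp only [comp, Finset.mem_filter, Finset.mem_range, and_iff_right_iff_imp]
  exact fun h1 => h.anc_lt h1.1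

theorem size_none : T.size anc T.N = 0 := by
  rw [size, Finset.card_eq_zero, Finset.filter_eq_empty_iff]
  exact fun t _ => h.not_anc_left t

theorem size_le {a b : ℕ} (hab : anc a b) : T.size anc b ≤ T.size anc a :=
  Finset.card_le_card fun t ht => by
    simp only [Finset.mem_filter] at ht ⊢
    exact ⟨ht.1, h.trans hab ht.2⟩

theorem size_lt {a b : ℕ} (hab : anc a b) (hne : a ≠ b) : T.size anc b < T.size anc a :=
  Finset.card_lt_card <| Finset.ssubset_iff.2 ⟨a, by
    simp only [Finset.mem_filter, not_and]
    exact fun _ h1 => hne (h.antisymm hab h1), fun t ht => by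
    rcases Finset.mem_insert.1 ht with rfl | ht
    · have := h.anc_lt_left hab
      simpa using ⟨this, h.refl this⟩
    · simp only [Finset.mem_filter] at ht ⊢
      exact ⟨ht.1, h.trans hab ht.2⟩⟩

theorem size_pos {a : ℕ} (ha : a < T.N) : 0 < T.size anc a :=
  Finset.card_pos.2 ⟨a, by simpa using ⟨ha, h.refl ha⟩⟩

theorem size_zero : T.size anc 0 = T.N := by
  rw [size, Finset.filter_true_of_mem fun t ht => h.root (Finset.mem_range.1 ht), Finset.card_range]

variable {r b : ℕ}

theorem size_lt_of_valid (hv : T.Valid anc r b) : T.size anc b < T.size anc r := by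
  rcases hv.2 with rfl | h1
  · rw [h.size_none]; exact h.size_pos hv.1
  · exact h.size_lt h1.1 h1.2.symm

theorem card_comp (hv : T.Valid anc r b) :
    (T.comp anc r b).card = T.size anc r - T.size anc b := by
  have : T.comp anc r b = (Finset.range T.N).filter (fun t => anc r t) \
      (Finset.range T.N).filter (fun t => anc b t) := by
    ext t; simp only [comp, Finset.mem_filter, Finset.mem_sdiff]; tauto
  rw [this, Finset.card_sdiff_of_subset]
  · rfl
  · intro t
    simp only [Finset.mem_filter]
    rintro ⟨h1, h2⟩
    refine ⟨h1, ?_⟩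
    rcases hv.2 with rfl | h3
    · exact absurd h2 (h.not_anc_left t)
    · exact h.trans h3.1 h2

theorem root_mem (hv : T.Valid anc r b) : r ∈ T.comp anc r b := by
  refine h.mem_comp.2 ⟨h.refl hv.1, fun h1 => ?_⟩
  rcases hv.2 with rfl | h3
  · exact h.not_anc_left _ h1
  · exact h3.2 (h.antisymm h1 h3.1)

theorem par_not_mem (hv : T.Valid anc r b) : par r ∉ T.comp anc r b := by
  intro h1
  have h2 := (h.mem_comp.1 h1).1
  by_cases h0 : r = 0
  · subst h0; rw [h.par_zero] at h2; exact h.not_anc_right _ h2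
  · exact h.not_anc_par h0 hv.1 h2

theorem bot_not_mem : b ∉ T.comp anc r b := by
  intro h1
  obtain ⟨h2, h3⟩ := h.mem_comp.1 h1
  exact h3 (h.refl (h.anc_lt h2))

/-- An edge that leaves a component goes to the parent of the root or to the bottom. -/
theorem boundary {t s : ℕ} (ht : t ∈ T.comp anc r b)
    (hs : s ∉ T.comp anc r b) (hst : T.adj t s) :
    (s = par r ∧ par t = par r) ∨ (s = b ∧ par b = t) := by
  rw [h.mem_comp] at ht hs
  have hsN := T.adj_lt (T.adj_symm hst)
  have htN := T.adj_lt hst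
  rcases h.adj_cases hst with ⟨h1, h2⟩ | ⟨h1, h2⟩
  · right
    have h3 : anc r s := h.trans ht.1 (h2 ▸ h.anc_par h1 hsN)
    have h4 : anc b s := by tauto
    have h5 : b = s := by
      by_contra h6
      exact ht.2 (h2 ▸ (h.anc_par_of_ne h4 h6).2)
    exact ⟨h5.symm, h5 ▸ h2⟩
  · left
    by_cases h3 : r = t
    · exact ⟨by rw [h3, h2], by rw [h3]⟩
    · have h4 := (h.anc_par_of_ne ht.1 h3).2
      rw [h2] at h4
      exact absurd ⟨h4, fun h5 => ht.2 (h.trans h5 (h2 ▸ h.anc_par h1 htN))⟩ hs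

/-- Candidates exist: the root of a nonempty component has all of it below itself, and 5 < 8. -/
theorem cand_root (hv : T.Valid anc r b) : T.Cand anc r b r := by
  have := h.size_lt_of_valid hv
  refine ⟨h.refl hv.1, ?_, ?_, by omega⟩
  · rcases hv.2 with h1 | h1
    · exact Or.inl h1
    · exact Or.inr h1.1
  · rcases hv.2 with rfl | h1
    · exact hv.1.ne
    · exact h1.2.symm

variable {u : ℕ}

theorem cand_mem (hu : T.Cand anc r b u) : u ∈ T.comp anc r b := by
  refine h.mem_comp.2 ⟨hu.1, fun h1 => ?_⟩
  rcases hu.2.1 with rfl | h2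
  · exact h.not_anc_left _ h1
  · exact hu.2.2.1 (h.antisymm h2 h1)

variable {r' b' : ℕ}

omit h in
theorem piece_valid (hv : T.Valid anc r b) (hu : T.Cand anc r b u)
    (hp : T.Piece par anc r b u r' b') : T.Valid anc r' b' := by
  rcases hp with ⟨rfl, rfl, h1⟩ | ⟨_, h1, _, h3, h4⟩
  · exact ⟨hv.1, Or.inr ⟨hu.1, h1.symm⟩⟩
  · refine ⟨h1, ?_⟩
    split_ifs at h3 with h5
    · subst h3; exact Or.inr ⟨h5, h4.symm⟩
    · exact Or.inl h3

theorem piece_subset (hu : T.Cand anc r b u) (hp : T.Piece par anc r b u r' b') :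
    T.comp anc r' b' ⊆ (T.comp anc r b).erase u := by
  intro t ht
  rw [Finset.mem_erase]
  rw [h.mem_comp] at ht ⊢
  have huN := h.anc_lt hu.1
  rcases hp with ⟨rfl, rfl, h1⟩ | ⟨h0, h1, h2, h3, h4⟩
  · refine ⟨fun h2 => ht.2 (by rw [h2]; exact h.refl huN), ht.1, fun h2 => ht.2 ?_⟩
    rcases hu.2.1 with h3 | h3
    · exact absurd h2 (h3 ▸ h.not_anc_left t)
    · exact h.trans h3 h2
  · have hur : anc u r' := h2 ▸ h.anc_par h0 h1
    refine ⟨?_, h.trans hu.1 (h.trans hur ht.1), fun h5 => ?_⟩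
    · rintro rfl
      exact h.not_anc_par h0 h1 (h2 ▸ ht.1)
    · split_ifs at h3 with h6
      · exact ht.2 (h3 ▸ h5)
      · rcases h.total ht.1 h5 with h7 | h7
        · exact h6 h7
        · have h8 := (h.anc_par_of_ne h7 h4.symm).2
          rw [h2] at h8
          rcases hu.2.1 with rfl | h9
          · exact h.not_anc_left _ h8
          · exact hu.2.2.1 (h.antisymm h9 h8)

/-- A node below `u` is below a child of `u`; any other node of the component lies in the upper
piece. -/
theorem piece_cover (hu : T.Cand anc r b u) {t : ℕ} (ht : t ∈ T.comp anc r b) (hne : t ≠ u) :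
    ∃ r' b', T.Piece par anc r b u r' b' ∧ t ∈ T.comp anc r' b' := by
  rw [h.mem_comp] at ht
  by_cases h1 : anc u t
  · obtain ⟨c, h2, h3, h4, h5⟩ := h.exists_child h1 (Ne.symm hne)
    refine ⟨c, _, Or.inr ⟨h2, h3, h4, rfl, ?_⟩, ?_⟩
    · rintro rfl; exact ht.2 h5
    · rw [h.mem_comp]
      refine ⟨h5, ?_⟩
      split_ifs
      · exact ht.2
      · exact h.not_anc_left t
  · refine ⟨r, u, Or.inl ⟨rfl, rfl, ?_⟩, h.mem_comp.2 ⟨ht.1, h1⟩⟩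
    rintro rfl; exact h1 ht.1

omit h in
theorem piece_par (hp : T.Piece par anc r b u r' b') : par r' = u ∨ par r' = par r := by
  rcases hp with ⟨rfl, rfl, h1⟩ | ⟨_, _, h2, _⟩
  · exact Or.inr rfl
  · exact Or.inl h2

omit h in
theorem piece_bot (hp : T.Piece par anc r b u r' b') : b' = u ∨ b' = b ∨ b' = T.N := by
  rcases hp with ⟨rfl, rfl, h1⟩ | ⟨_, _, _, h2, _⟩
  · exact Or.inl rfl
  · split_ifs at h2 <;> tauto

/-- At depth 0 the thresholds are 1 and 5/8, below which there is no nonempty component. -/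
theorem small_pos {d : ℕ} (hv : T.Valid anc r b) (hs : T.Small anc d r b) : d ≠ 0 := by
  rintro rfl
  have := h.size_lt_of_valid hv
  rcases hs with ⟨_, hs⟩ | hs <;> omega

/-- With `ρ = 8/5`, the threshold is `ρ ^ d` for a component without bottom and `ρ ^ (d - 1)` for
one with a bottom. The second is stricter because a child of `u` that is not above `b` need not be
smaller than the whole component; such a piece has lost its bottom, and its threshold one level
lower is the old one. The other pieces shrink: those with `b` below them and those of a bottomless
component by the factor 5/8 at least, the upper piece by more than 3/8. -/
theorem small_piece {d : ℕ} (hv : T.Valid anc r b) (hu : T.Split anc r b u)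
    (hp : T.Piece par anc r b u r' b') (hs : T.Small anc (d + 1) r b) : T.Small anc d r' b' := by
  have h1 : (T.size anc r - T.size anc b) * 5 ^ (d + 1) < 8 ^ (d + 1) := by
    rcases hs with ⟨_, hs⟩ | hs <;> omega
  have hpos : 0 < 8 ^ d := by positivity
  have hub : T.size anc u ≤ T.size anc r := h.size_le hu.1.1
  have h2 := hu.1.2.2.2
  have h3 := h.size_lt_of_valid hv
  rw [pow_succ, pow_succ] at h1
  rcases hp with ⟨rfl, rfl, h4⟩ | ⟨h0, h4, h5, h6, h7⟩
  · right
    -- More than 5/8 of the component lies below `u`. The upper piece has a bottom, possibly unlike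
    -- the whole, so it must lose two powers of 8/5: this works since `3/8 * 8/5 = 3/5 < 5/8`.
    have h5 : 8 * (T.size anc r' - T.size anc b') < 3 * (T.size anc r' - T.size anc b) := by omega
    have h6 := Nat.mul_le_mul_right (5 ^ d) h5.le
    nlinarith
  · have hur : anc u r' := h5 ▸ h.anc_par h0 h4
    have hne : u ≠ r' := by rintro rfl; exact h.not_anc_par h0 h4 (by rw [h5]; exact h.refl h4)
    have hlt := h.size_lt hur hne
    -- The child has fewer descendants than `u`, which was the smallest candidate.
    have hnc : ¬ T.Cand anc r b r' := fun h8 => by have := hu.2 r' h8; omega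
    have hle : (b = T.N ∨ anc r' b) →
        8 * (T.size anc r' - T.size anc b) ≤ 5 * (T.size anc r - T.size anc b) := by
      intro h8
      by_contra h9
      exact hnc ⟨h.trans hu.1.1 hur, h8, h7, by omega⟩
    by_cases hb : b = T.N
    · have h8 : b' = b := by rw [h6, hb]; exact ite_self _
      subst h8
      left
      refine ⟨hb, ?_⟩
      have h9 := Nat.mul_le_mul_right (5 ^ d) (hle (Or.inl hb))
      nlinarith
    · have hs' : (T.size anc r - T.size anc b) * 5 ^ (d + 1) * 8 < 8 ^ (d + 1) * 5 := by
        rcases hs with ⟨h8, _⟩ | h8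
        · exact absurd h8 hb
        · exact h8
      rw [pow_succ, pow_succ] at hs'
      split_ifs at h6 with h8
      · subst h6
        right
        have h9 := Nat.mul_le_mul_right (5 ^ d) (hle (Or.inr h8))
        nlinarith
      · left
        refine ⟨h6, ?_⟩
        -- The piece that loses the bottom: that it is contained in the whole is all that is needed.
        have hp' : T.Piece par anc r b u r' b' := Or.inr ⟨h0, h4, h5, by rw [if_neg h8, h6], h7⟩
        have h9 := Finset.card_le_card ((h.piece_subset hu.1 hp').trans (Finset.erase_subset _ _))
        rw [h.card_comp hv, h.card_comp (Rooted.piece_valid hv hu.1 hp')] at h9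
        have h10 := Nat.mul_le_mul_right (5 ^ d) h9
        nlinarith

/-- The bottom of a component inside another component. -/
theorem bot_of_subset (hv' : T.Valid anc r' b') (hsub : T.comp anc r' b' ⊆ T.comp anc r b) :
    b' ∈ T.comp anc r b ∨ b' = b ∨ b' = T.N := by
  rcases hv'.2 with h1 | ⟨h1, h2⟩
  · exact Or.inr (Or.inr h1)
  · have hr := h.mem_comp.1 (hsub (h.root_mem hv'))
    by_cases h3 : anc b b'
    · right; left
      by_contra h4
      rcases h.total h3 h1 with h5 | h5
      · exact hr.2 h5
      · have h6 : b ∈ T.comp anc r' b' :=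
          h.mem_comp.2 ⟨h5, fun h7 => h4 (h.antisymm h7 h3)⟩
        exact h.bot_not_mem (hsub h6)
    · exact Or.inl (h.mem_comp.2 ⟨h.trans hr.1 h1, h3⟩)

theorem par_of_subset (hv' : T.Valid anc r' b') (hsub : T.comp anc r' b' ⊆ T.comp anc r b) :
    par r' ∈ T.comp anc r b ∨ par r' = par r := by
  have hr := h.mem_comp.1 (hsub (h.root_mem hv'))
  by_cases h1 : r = r'
  · right; rw [h1]
  · left
    obtain ⟨h2, h3⟩ := h.anc_par_of_ne hr.1 h1
    exact h.mem_comp.2 ⟨h3, fun h4 => hr.2 (h.trans h4 (h.anc_par h2 hv'.1))⟩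

end Rooted
end Inst

/-! ## Consecutive intervals -/

/-- The intervals `[lo p, p]`, listed from the last one, fill `[l, h)`. -/
inductive Chain (lo : ℕ → ℕ) (l : ℕ) : ℕ → Prop
  | nil : Chain lo l l
  | cons {p : ℕ} : lo p ≤ p → Chain lo l (lo p) → Chain lo l (p + 1)

/-- `e` is the right end of one of the intervals that fill `[l, h)`. -/
inductive Top (lo : ℕ → ℕ) (l : ℕ) : ℕ → ℕ → Prop
  | head {p : ℕ} : l ≤ p → Top lo l (p + 1) p
  | tail {p e : ℕ} : l ≤ p → Top lo l (lo p) e → Top lo l (p + 1) e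

section
variable {lo lo' : ℕ → ℕ} {l k h e e' : ℕ}

theorem Chain.le (hc : Chain lo l h) : l ≤ h := by
  induction hc with
  | nil => exact le_rfl
  | cons h1 _ ih => omega

theorem Chain.cons_inv {p : ℕ} (hc : Chain lo l (p + 1)) (hl : l ≤ p) :
    lo p ≤ p ∧ Chain lo l (lo p) := by
  cases hc with
  | nil => omega
  | cons h1 h2 => exact ⟨h1, h2⟩

theorem Chain.trans (h1 : Chain lo l k) (h2 : Chain lo k h) : Chain lo l h := by
  induction h2 with
  | nil => exact h1
  | cons h3 _ ih => exact .cons h3 ih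

theorem Top.not_self : ¬ Top lo l l e := by
  rintro (h | ⟨h, _⟩) <;> omega

theorem Top.succ_iff {p : ℕ} (hl : l ≤ p) :
    Top lo l (p + 1) e ↔ e = p ∨ Top lo l (lo p) e := by
  constructor
  · rintro (h1 | ⟨h1, h2⟩)
    · exact Or.inl rfl
    · exact Or.inr h2
  · rintro (rfl | h1)
    · exact .head hl
    · exact .tail hl h1

theorem Top.bounds (ht : Top lo l h e) (hc : Chain lo l h) : l ≤ lo e ∧ lo e ≤ e ∧ e < h := by
  induction ht with
  | head hl => obtain ⟨h1, h2⟩ := hc.cons_inv hl; exact ⟨h2.le, h1, by omega⟩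
  | tail hl _ ih =>
    obtain ⟨h1, h2⟩ := hc.cons_inv hl
    obtain ⟨h3, h4, h5⟩ := ih h2
    exact ⟨h3, h4, by omega⟩

theorem Chain.exists_top (hc : Chain lo l h) (h1 : l ≤ e) (h2 : e < h) :
    ∃ p, Top lo l h p ∧ lo p ≤ e ∧ e ≤ p := by
  induction hc with
  | nil => omega
  | @cons p h3 h4 ih =>
    have h5 := h4.le
    by_cases h6 : e < lo p
    · obtain ⟨q, h7, h8⟩ := ih h6
      exact ⟨q, .tail (by omega) h7, h8⟩
    · exact ⟨p, .head (by omega), by omega, by omega⟩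

theorem Chain.top_disjoint (hc : Chain lo l h) (h1 : Top lo l h e) (h2 : Top lo l h e')
    (hne : e ≠ e') : e < lo e' ∨ e' < lo e := by
  induction hc with
  | nil => exact absurd h1 Top.not_self
  | @cons p h3 h4 ih =>
    have h5 := h4.le
    rw [Top.succ_iff (by omega)] at h1 h2
    rcases h1 with rfl | h1
    · rcases h2 with rfl | h2
      · exact absurd rfl hne
      · right; exact (h2.bounds h4).2.2
    · rcases h2 with rfl | h2
      · left; exact (h1.bounds h4).2.2
      · exact ih h1 h2

theorem Chain.congr (hc : Chain lo l h) (hlo : ∀ e, Top lo l h e → lo' e = lo e) :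
    Chain lo' l h := by
  induction hc with
  | nil => exact .nil
  | @cons p h3 h4 ih =>
    have h5 := h4.le
    have h6 := hlo p (.head (by omega))
    refine .cons (by rwa [h6]) ?_
    rw [h6]
    exact ih fun e he => hlo e (.tail (by omega) he)

theorem Chain.top_congr (hc : Chain lo l h) (hlo : ∀ e, Top lo l h e → lo' e = lo e) :
    Top lo' l h e ↔ Top lo l h e := by
  induction hc with
  | nil => simp only [Top.not_self]
  | @cons p h3 h4 ih =>
    have h5 := h4.le
    have h6 := hlo p (.head (by omega))
    rw [Top.succ_iff (by omega), Top.succ_iff (by omega), h6,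
      ih fun e he => hlo e (.tail (by omega) he)]

theorem Chain.top_trans (h1 : Chain lo l k) (h2 : Chain lo k h) :
    Top lo l h e ↔ Top lo k h e ∨ Top lo l k e := by
  have h0 := h1.le
  induction h2 with
  | nil => simp [Top.not_self]
  | @cons p h3 h4 ih =>
    have h5 := h4.le
    rw [Top.succ_iff (by omega), Top.succ_iff (by omega)]
    tauto

end

namespace Inst
open Classical

/-! ## Layouts: the decomposition of a rooted tree, written in postorder -/

section
variable (T : Inst) (anc : ℕ → ℕ → Prop) (Rt Bt : ℕ → ℕ)

/-- The first position of the interval of the component at the position `p`. -/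
noncomputable def lo (p : ℕ) : ℕ := p + 1 - (T.size anc (Rt p) - T.size anc (Bt p))

/-- The component at the position `p` is `(Rt p, Bt p)`; its node `U p` is split off, and the
remaining components are at the ends of consecutive intervals that fill `[lo p, p)`. -/
structure Layout (par U : ℕ → ℕ) : Prop where
  top_root : Rt (T.N - 1) = 0
  top_bot : Bt (T.N - 1) = T.N
  valid : ∀ p < T.N, T.Valid anc (Rt p) (Bt p)
  split : ∀ p < T.N, T.Split anc (Rt p) (Bt p) (U p)
  chain : ∀ p < T.N, Chain (T.lo anc Rt Bt) (T.lo anc Rt Bt p) p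
  piece : ∀ p < T.N, ∀ e, Top (T.lo anc Rt Bt) (T.lo anc Rt Bt p) p e →
    T.Piece par anc (Rt p) (Bt p) (U p) (Rt e) (Bt e)
  cover : ∀ p < T.N, ∀ r b, T.Piece par anc (Rt p) (Bt p) (U p) r b →
    ∃ e, Top (T.lo anc Rt Bt) (T.lo anc Rt Bt p) p e ∧ Rt e = r ∧ Bt e = b

/-- The contribution of the position `e`. -/
noncomputable def localWeight (R : Type*) [CommRing R] (par U : ℕ → ℕ) (e : ℕ) (x : ℕ → ℕ) : R :=
  T.nodeWeight R (U e) (x (U e)) *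
    if (par (U e) = par (Rt e) → T.Agree (U e) (par (Rt e)) (x (U e)) (x (par (Rt e)))) ∧
      (par (Bt e) = U e → T.Agree (U e) (Bt e) (x (U e)) (x (Bt e))) then 1 else 0

end

variable {T : Inst} {par : ℕ → ℕ} {anc : ℕ → ℕ → Prop} {rk : ℕ → ℕ} {Rt Bt U : ℕ → ℕ}
  {R : Type*} [CommRing R]

/-- `T.N` stands for a missing parent or bottom; it has no bag, so agreement with it is vacuous and
needs no case distinctions in the program. -/
theorem not_agree_imp {t x y : ℕ} : T.Agree t T.N x y := fun _ _ h =>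
  absurd (T.inB_lt h).1 (lt_irrefl _)

theorem dependsOn_localWeight (e : ℕ) : DependsOn (T.localWeight Rt Bt R par U e)
    ({U e, par (Rt e), Bt e} \ {T.N} ∪ {U e}) := by
  intro x y hxy
  have h1 : x (U e) = y (U e) := hxy _ (by simp)
  have h2 : ∀ z, z = par (Rt e) ∨ z = Bt e →
      (T.Agree (U e) z (x (U e)) (x z) ↔ T.Agree (U e) z (y (U e)) (y z)) := by
    intro z hz
    by_cases h3 : z = T.N
    · rw [h3]; exact iff_of_true not_agree_imp not_agree_imp
    · rw [h1, hxy z]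
      left
      refine ⟨?_, h3⟩
      rcases hz with rfl | rfl <;> simp
  unfold localWeight
  rw [h1] at *
  simp only [h2 _ (Or.inl rfl), h2 _ (Or.inr rfl)]

namespace Layout

variable (hl : T.Layout anc Rt Bt par U) (h : T.Rooted par anc rk)
include hl h

local notation "lo'" => T.lo anc Rt Bt

omit h in
theorem lo_le {p : ℕ} (hp : p < T.N) : lo' p ≤ p := (hl.chain p hp).le

/-- By induction: the interval of `p` consists of `p` and of the intervals of the pieces, just as
the component consists of the split node and the pieces. -/
theorem image_eq {p : ℕ} (hp : p < T.N) :
    (Finset.Icc (lo' p) p).image U = T.comp anc (Rt p) (Bt p) := by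
  induction p using Nat.strong_induction_on with
  | _ p ih =>
    have hc := hl.chain p hp
    have hs := hl.split p hp
    ext t
    simp only [Finset.mem_image, Finset.mem_Icc]
    constructor
    · rintro ⟨e, ⟨h1, h2⟩, rfl⟩
      rcases h2.eq_or_lt with rfl | h2
      · exact h.cand_mem hs.1
      · obtain ⟨q, h3, h4, h5⟩ := hc.exists_top h1 h2
        have hqp := (h3.bounds hc).2.2
        refine Finset.mem_of_mem_erase (h.piece_subset hs.1 (hl.piece p hp q h3) ?_)
        rw [← ih q hqp (by omega)]
        exact Finset.mem_image_of_mem U (Finset.mem_Icc.2 ⟨h4, h5⟩)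
    · intro ht
      by_cases h1 : t = U p
      · exact ⟨p, ⟨hc.le, le_rfl⟩, h1.symm⟩
      · obtain ⟨r, b, h2, h3⟩ := h.piece_cover hs.1 ht h1
        obtain ⟨q, h4, rfl, rfl⟩ := hl.cover p hp r b h2
        obtain ⟨h5, h6, h7⟩ := h4.bounds hc
        rw [← ih q h7 (by omega)] at h3
        obtain ⟨e, h8, rfl⟩ := Finset.mem_image.1 h3
        rw [Finset.mem_Icc] at h8
        exact ⟨e, by omega, rfl⟩

theorem U_mem {p e : ℕ} (hp : p < T.N) (h1 : lo' p ≤ e) (h2 : e ≤ p) :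
    U e ∈ T.comp anc (Rt p) (Bt p) := by
  rw [← hl.image_eq h hp]
  exact Finset.mem_image_of_mem U (Finset.mem_Icc.2 ⟨h1, h2⟩)

theorem lo_top : lo' (T.N - 1) = 0 := by
  have := T.N_pos
  rw [lo, hl.top_root, hl.top_bot, h.size_zero, h.size_none]
  omega

/-- The interval of the last position contains all `N` positions and its component all `N` nodes; a
map between sets of equal finite size that is onto is injective. -/
theorem U_inj : ∀ e < T.N, ∀ e' < T.N, U e = U e' → e = e' := by
  have := T.N_pos
  have h1 := hl.image_eq h (p := T.N - 1) (by omega)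
  have h2 : (Finset.Icc (lo' (T.N - 1)) (T.N - 1)) = Finset.range T.N := by
    rw [hl.lo_top h]; ext; simp; omega
  have h3 : T.comp anc (Rt (T.N - 1)) (Bt (T.N - 1)) = Finset.range T.N := by
    rw [hl.top_root, hl.top_bot, comp, Finset.filter_true_of_mem]
    exact fun t ht => ⟨h.root (Finset.mem_range.1 ht), h.not_anc_left t⟩
  rw [h2, h3] at h1
  have h4 := Finset.injOn_of_card_image_eq (s := Finset.range T.N) (f := U) (by rw [h1])
  intro e he e' he' h5
  exact h4 (by simpa using he) (by simpa using he') h5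

theorem U_lt {e : ℕ} (he : e < T.N) : U e < T.N := h.anc_lt (hl.split e he).1.1

theorem U_surj {t : ℕ} (ht : t < T.N) : ∃ e < T.N, U e = t := by
  have := T.N_pos
  have h1 : t ∈ T.comp anc (Rt (T.N - 1)) (Bt (T.N - 1)) := by
    rw [hl.top_root, hl.top_bot, h.mem_comp]
    exact ⟨h.root ht, h.not_anc_left t⟩
  rw [← hl.image_eq h (by omega), Finset.mem_image] at h1
  obtain ⟨e, he, rfl⟩ := h1
  rw [Finset.mem_Icc] at he
  exact ⟨e, by omega, rfl⟩

/-- Membership of `U e` in a component in terms of the position. -/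
theorem U_mem_iff {p e : ℕ} (hp : p < T.N) (he : e < T.N) :
    U e ∈ T.comp anc (Rt p) (Bt p) ↔ lo' p ≤ e ∧ e ≤ p := by
  refine ⟨fun h1 => ?_, fun h1 => hl.U_mem h hp h1.1 h1.2⟩
  rw [← hl.image_eq h hp, Finset.mem_image] at h1
  obtain ⟨e', h2, h3⟩ := h1
  rw [Finset.mem_Icc] at h2
  rwa [← hl.U_inj h e' (by omega) e he h3]

/-- Components at nested positions are nested. -/
theorem comp_subset {p e : ℕ} (hp : p < T.N) (h1 : lo' p ≤ e) (h2 : e ≤ p) :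
    T.comp anc (Rt e) (Bt e) ⊆ T.comp anc (Rt p) (Bt p) := by
  induction p using Nat.strong_induction_on with
  | _ p ih =>
    rcases h2.eq_or_lt with rfl | h2
    · exact subset_rfl
    · have hc := hl.chain p hp
      obtain ⟨q, h3, h4, h5⟩ := hc.exists_top h1 h2
      have hqp := (h3.bounds hc).2.2
      exact (ih q hqp (by omega) h4 h5).trans ((h.piece_subset (hl.split p hp).1
        (hl.piece p hp q h3)).trans (Finset.erase_subset _ _))

/-- The nodes on which the contributions in the interval of `p` depend. -/
theorem support_subset {p e : ℕ} (hp : p < T.N) (h1 : lo' p ≤ e) (h2 : e ≤ p) {t : ℕ}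
    (ht : t ∈ ({U e, par (Rt e), Bt e} \ {T.N} ∪ {U e} : Set ℕ)) :
    t ∈ T.comp anc (Rt p) (Bt p) ∨ (t = par (Rt p) ∨ t = Bt p) ∧ t ≠ T.N := by
  have hsub := hl.comp_subset h hp h1 h2
  have hv := hl.valid e (by omega)
  rcases ht with ⟨rfl | rfl | rfl, h3⟩ | rfl
  · exact Or.inl (hl.U_mem h hp h1 h2)
  · rcases h.par_of_subset hv hsub with h4 | h4
    · exact Or.inl h4
    · exact Or.inr ⟨Or.inl h4, h3⟩
  · rcases h.bot_of_subset hv hsub with h4 | h4 | h4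
    · exact Or.inl h4
    · exact Or.inr ⟨Or.inr h4, h3⟩
    · exact absurd h4 h3
  · exact Or.inl (hl.U_mem h hp h1 h2)

local notation "g'" => T.localWeight Rt Bt R par U

/-- Outside itself, a piece depends only on the split node of the whole component and on the
boundary of the latter. None of these nodes is summed over in another piece. -/
theorem sibling {q p p' e e' : ℕ} (hq : q < T.N) (hp : Top lo' (lo' q) q p)
    (hp' : Top lo' (lo' q) q p') (hne : p ≠ p') (h1 : lo' p ≤ e) (h2 : e ≤ p) (h1' : lo' p' ≤ e')
    (h2' : e' ≤ p') : U e' ∉ ({U e, par (Rt e), Bt e} \ {T.N} ∪ {U e} : Set ℕ) := by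
  have hc := hl.chain q hq
  obtain ⟨b1, b2, b3⟩ := hp.bounds hc
  obtain ⟨b1', b2', b3'⟩ := hp'.bounds hc
  intro h3
  have hq' := hl.U_mem h hq (e := e') (by omega) (by omega)
  have hP := hl.piece q hq p hp
  have hne' : U e' ≠ U q := fun h6 => by
    have := hl.U_inj h e' (by omega) q hq h6; omega
  rcases hl.support_subset h (by omega) h1 h2 h3 with h4 | ⟨h4, h5⟩
  · rw [hl.U_mem_iff h (by omega) (by omega)] at h4
    rcases hc.top_disjoint hp hp' hne with h5 | h5 <;> omega
  · rcases h4 with h4 | h4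
    · rcases Rooted.piece_par hP with h6 | h6
      · exact hne' (h4.trans h6)
      · rw [h4, h6] at hq'
        exact h.par_not_mem (hl.valid q hq) hq'
    · rcases Rooted.piece_bot hP with h6 | h6 | h6
      · exact hne' (h4.trans h6)
      · rw [h4, h6] at hq'
        exact h.bot_not_mem hq'
      · exact h5 (h4.trans h6)

/-- The component at `p` is independent of the components to its left. -/
theorem partSum_chain {X q p : ℕ} (hq : q < T.N) (hc : Chain lo' (lo' q) (p + 1))
    (htop : ∀ e, Top lo' (lo' q) (p + 1) e → Top lo' (lo' q) q e) (hp : lo' q ≤ p) :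
    partSum X U g' (lo' q) (p + 1) =
      partSum X U g' (lo' q) (lo' p) * partSum X U g' (lo' p) (p + 1) := by
  obtain ⟨h1, h2⟩ := hc.cons_inv hp
  have hpt := htop p (.head hp)
  refine partSum_trans dependsOn_localWeight h2.le (by omega) ?_ ?_
  · intro e h3 h4 e' h5 h6
    obtain ⟨p', h7, h8, h9⟩ := h2.exists_top h5 h6
    have h10 := (h7.bounds h2).2.2
    exact hl.sibling h hq hpt (htop p' (.tail hp h7)) (by omega) h3 (by omega) h8 h9
  · intro e h3 h4 e' h5 h6
    obtain ⟨p', h7, h8, h9⟩ := h2.exists_top h5 h6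
    have h10 := (h7.bounds h2).2.2
    exact hl.sibling h hq (htop p' (.tail hp h7)) hpt (by omega) h8 h9 h3 (by omega)

/-- The recursion of the algorithm: the factor of the position `p` involves the split node and the
boundary only, hence no node that is summed over in the pieces. -/
theorem partSum_split {X p : ℕ} (hp : p < T.N) :
    partSum X U g' (lo' p) (p + 1) = sumAt X (U p) (g' p * partSum X U g' (lo' p) p) := by
  have h0 := hl.lo_le hp
  refine partSum_succ dependsOn_localWeight h0 fun e h1 h2 h3 => ?_
  have h4 : U e ≠ U p := fun h5 => by
    have := hl.U_inj h e (by omega) p hp h5; omega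
  have h5 := hl.U_mem h hp h1 h2.le
  rcases h3 with ⟨h6 | h6 | h6, -⟩ | h6
  · exact h4 h6
  · rw [h6] at h5; exact h.par_not_mem (hl.valid p hp) h5
  · rw [h6] at h5; exact h.bot_not_mem h5
  · exact h4 h6

/-- The contributions multiply to the weight. -/
theorem prod_localWeight (x : ℕ → ℕ) :
    ∏ e ∈ Finset.range T.N, g' e x = T.weight R x := by
  have hinj := hl.U_inj h
  simp only [localWeight, Finset.prod_mul_distrib, weight]
  congr 1
  · refine Finset.prod_nbij (fun e => U e) (fun e he => ?_) (fun e he e' he' h1 => ?_)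
      (fun t ht => ?_) (fun _ _ => rfl)
    · simpa using hl.U_lt h (by simpa using he)
    · exact hinj e (by simpa using he) e' (by simpa using he') h1
    · obtain ⟨e, he, rfl⟩ := hl.U_surj h (t := t) (by simpa using ht)
      exact ⟨e, by simpa using he, rfl⟩
  · rw [Finset.prod_ite_zero, Finset.prod_const_one]
    refine if_congr ⟨fun h1 => ?_, fun h1 => ?_⟩ rfl rfl
    -- Every edge is tested at the earlier of the two positions of its ends: the other end lies
    -- outside the component there, so it is one of its two boundary nodes.
    · have key : ∀ e < T.N, ∀ e' < T.N, e < e' → T.adj (U e) (U e') →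
          T.Agree (U e) (U e') (x (U e)) (x (U e')) := by
        intro e he e' he' hlt hadj
        obtain ⟨h2, h3⟩ := h1 e (Finset.mem_range.2 he)
        rcases h.boundary (hl.U_mem h he (hl.lo_le he) le_rfl)
          (fun h4 => by rw [hl.U_mem_iff h he he'] at h4; omega) hadj with ⟨h4, h5⟩ | ⟨h4, h5⟩
        · rw [h4]; exact h2 h5
        · rw [h4]; exact h3 h5
      intro s t hst
      obtain ⟨e, he, rfl⟩ := hl.U_surj h (T.adj_lt hst)
      obtain ⟨e', he', rfl⟩ := hl.U_surj h (T.adj_lt (T.adj_symm hst))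
      rcases lt_trichotomy e e' with h2 | rfl | h2
      · exact key e he e' he' h2 hst
      · exact absurd rfl (T.adj_ne hst)
      · exact (key e' he' e he h2 (T.adj_symm hst)).symm
    · intro e he
      rw [Finset.mem_range] at he
      have hU := hl.U_lt h he
      have hv := hl.valid e he
      refine ⟨fun h2 => ?_, fun h2 => ?_⟩
      · by_cases h3 : U e = 0
        · rw [← h2, h3, h.par_zero]; exact not_agree_imp
        · exact h1 _ _ (T.adj_symm (h2 ▸ h.adj_par h3 hU))
      · rcases hv.2 with h3 | h3
        · rw [h3]; exact not_agree_imp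
        · have h0 : Bt e ≠ 0 := by
            intro h4
            rw [h4] at h3
            exact h3.2 (h.anc_zero.1 h3.1).symm
          exact h1 _ _ (h2 ▸ h.adj_par h0 (h.anc_lt h3.1))

/-- The whole sum counts the satisfying assignments. -/
theorem partSum_top {X : ℕ} (hX : ∀ t < T.N, T.full t ≤ X) (x : ℕ → ℕ) :
    partSum X U g' (lo' (T.N - 1)) (T.N - 1 + 1) x = (T.models.card : R) := by
  have := T.N_pos
  rw [hl.lo_top h, show T.N - 1 + 1 = T.N by omega, partSum,
    ← sum_weight (hl.U_inj h) (fun e he => hl.U_lt h he) hX x]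
  congr 1
  funext x
  rw [Finset.prod_apply, ← Finset.range_eq_Ico, hl.prod_localWeight h]

end Layout
end Inst
namespace Inst
open Classical

/-! ## The main loop -/

/-- `T` is given as the input `I`. -/
structure Reads (T : Inst) (I : List ℕ) : Prop where
  n : I.getD 0 0 = T.n
  m : I.getD 1 0 = T.m
  N : I.getD 2 0 = T.N
  pos : ∀ j < T.m, ∀ u < T.n, I.getD (3 + (j * T.n + u)) 0 = if T.pos j u then 1 else 0
  neg : ∀ j < T.m, ∀ u < T.n,
    I.getD (3 + T.m * T.n + (j * T.n + u)) 0 = if T.neg j u then 1 else 0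
  adj : ∀ s < T.N, ∀ t < T.N,
    I.getD (3 + 2 * (T.m * T.n) + (s * T.N + t)) 0 = if T.adj s t then 1 else 0
  bagVar : ∀ t < T.N, ∀ u < T.n,
    I.getD (3 + 2 * (T.m * T.n) + T.N * T.N + (t * T.n + u)) 0 = if T.inB t u then 1 else 0
  bagClause : ∀ t < T.N, ∀ j < T.m,
    I.getD (3 + 2 * (T.m * T.n) + T.N * T.N + T.N * T.n + (t * T.m + j)) 0 =
      if T.inB t (T.n + j) then 1 else 0

end Inst

namespace Code
open AExpr

def nE : AExpr := inp 0
def mE : AExpr := inp 1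
def NE : AExpr := inp 2
def rd (a : Arr) : AExpr := arr a 0
def p : AExpr := rd .ptr
def u : AExpr := arr .U p
def b : AExpr := arr .B p
def top : AExpr := arr .par (arr .R p)
def pwE (t v : AExpr) : AExpr := arr .pw (t * (nE + mE) + v)
def digitE (x y : AExpr) : AExpr := mod (x / y) 2
def neq (x y : AExpr) : AExpr := (x - y) + (y - x)
def loE (p : AExpr) : AExpr := (p + 1) - (arr .sz (arr .R p) - arr .sz (arr .B p))
-- A state is composed of its high part, kept in `br` for every node, and of a low part below `Q`:
-- `j` for the split node, and the two digits of `i` to the base `Q` for the boundary nodes in `y₁`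
-- and `y₂`.
def x : AExpr := arr .br u * rd .Q + rd .j
def y₁ : AExpr := arr .br top * rd .Q + rd .i / rd .Q
def y₂ : AExpr := arr .br b * rd .Q + mod (rd .i) (rd .Q)

/-- The number of disagreements with the boundary. -/
def disagree : Cmd := .sum .v .f (nE + mE) (nz (pwE u (rd .v)) *
  (eq (arr .par u) top * nz (pwE top (rd .v)) *
      neq (digitE x (pwE u (rd .v))) (digitE y₁ (pwE top (rd .v))) +
    eq (arr .par b) u * nz (pwE b (rd .v)) *
      neq (digitE x (pwE u (rd .v))) (digitE y₂ (pwE b (rd .v)))))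

/-- The number of clashes between selected clauses and true literals. -/
def clashes : Cmd := .sum .v .t (mE * nE) (digitE x (pwE u (nE + rd .v / nE)) *
  (inp (3 + rd .v) * digitE x (pwE u (mod (rd .v) nE)) +
    inp (3 + mE * nE + rd .v) *
      (nz (pwE u (mod (rd .v) nE)) * (1 - digitE x (pwE u (mod (rd .v) nE))))))

/-- The number of selected clauses that are counted at this node. -/
def signs : Cmd := .sum .v .sg mE
  (arr .first (u * (nE + mE) + (nE + rd .v)) * digitE x (pwE u (nE + rd .v)))

/-- The entry of the piece that ends at the position `e - 1`. Each of its boundary nodes is `u`,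
with low part `j`, or else is inherited from the current component, with the corresponding digit of
`i`. -/
def childE : AExpr := arr .Tab ((rd .e - 1) * (rd .Q * rd .Q) +
  ((eq (arr .par (arr .R (rd .e - 1))) u * rd .j +
      (1 - eq (arr .par (arr .R (rd .e - 1))) u) * (rd .i / rd .Q)) * rd .Q +
    (eq (arr .B (rd .e - 1)) u * rd .j +
      (1 - eq (arr .B (rd .e - 1)) u) * mod (rd .i) (rd .Q))))

/-- The product of the values of the children. -/
def children : Cmd := .seq (.set .pr 0 1) (.seq (.set .e 0 p)
  (.loop (rd .e - loE p) (.seq (.set .pr 0 (mod (rd .pr * childE) (rd .M)))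
    (.set .e 0 (loE (rd .e - 1))))))

def inner : Cmd := .seq disagree (.seq clashes (.seq signs (.seq children
  (.set .acc 0 (mod (rd .acc + (1 - (rd .f + rd .t + (x + 1 - arr .full u))) *
    (1 + mod (rd .sg) 2 * (rd .M - 2)) * rd .pr) (rd .M))))))

def tabE : AExpr := p * (rd .Q * rd .Q) + rd .i

/-- The factor `nz (br u)` discards the old entry when the first high part is treated, so tables
left over from earlier rounds need not be cleared. -/
def combine : Cmd := .for .i (rd .Q * rd .Q) (.seq (.set .acc 0 0) (.seq (.for .j (rd .Q) inner)
  (.set .Tab tabE (mod (nz (arr .br u) * arr .Tab tabE + rd .acc) (rd .M)))))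

/-- Recursion without a stack. After the last high part the table is complete: the high part is
reset and the pointer moves on. Otherwise the pointer returns to the start of the interval, so that
all pieces are recomputed under the next high part. -/
def advance : Cmd := .ite (eq (arr .br u + 1) (rd .Y))
  (.seq (.set .br u 0) (.set .ptr 0 (p + 1)))
  (.seq (.set .br u (arr .br u + 1)) (.set .ptr 0 (loE p)))

def mainLoop : Cmd := .loop (NE - p) (.seq combine advance)

theorem writes_inner {a : Arr} : inner.writes a ↔ a = .f ∨ a = .v ∨ a = .t ∨ a = .sg ∨ a = .pr ∨
    a = .e ∨ a = .acc := by
  simp [inner, disagree, clashes, signs, children]; tauto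

theorem writes_combine {a : Arr} : combine.writes a ↔ a = .f ∨ a = .v ∨ a = .t ∨ a = .sg ∨
    a = .pr ∨ a = .e ∨ a = .acc ∨ a = .i ∨ a = .j ∨ a = .Tab := by
  simp [combine, writes_inner]; tauto

section
variable (I : List ℕ) (σ : St)

@[simp] theorem eval_rd (a : Arr) : (rd a).eval I σ = σ a 0 := rfl
@[simp] theorem eval_p : p.eval I σ = σ .ptr 0 := rfl
@[simp] theorem eval_u : u.eval I σ = σ .U (σ .ptr 0) := rfl
@[simp] theorem eval_b : b.eval I σ = σ .B (σ .ptr 0) := rfl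
@[simp] theorem eval_top : top.eval I σ = σ .par (σ .R (σ .ptr 0)) := rfl
@[simp] theorem eval_nE : nE.eval I σ = I.getD 0 0 := rfl
@[simp] theorem eval_mE : mE.eval I σ = I.getD 1 0 := rfl
@[simp] theorem eval_NE : NE.eval I σ = I.getD 2 0 := rfl
@[simp] theorem eval_pwE (t v : AExpr) : (pwE t v).eval I σ =
    σ .pw (t.eval I σ * (I.getD 0 0 + I.getD 1 0) + v.eval I σ) := rfl
@[simp] theorem eval_digitE (e f : AExpr) :
    (digitE e f).eval I σ = digit (e.eval I σ) (f.eval I σ) := by simp [digitE, digit]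
@[simp] theorem eval_neq (e f : AExpr) : (neq e f).eval I σ =
    (e.eval I σ - f.eval I σ) + (f.eval I σ - e.eval I σ) := rfl
@[simp] theorem eval_loE (e : AExpr) : (loE e).eval I σ =
    e.eval I σ + 1 - (σ .sz (σ .R (e.eval I σ)) - σ .sz (σ .B (e.eval I σ))) := rfl
@[simp] theorem eval_x : x.eval I σ = σ .br (σ .U (σ .ptr 0)) * σ .Q 0 + σ .j 0 := rfl
@[simp] theorem eval_y₁ : y₁.eval I σ =
    σ .br (σ .par (σ .R (σ .ptr 0))) * σ .Q 0 + σ .i 0 / σ .Q 0 := rfl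
@[simp] theorem eval_y₂ : y₂.eval I σ =
    σ .br (σ .B (σ .ptr 0)) * σ .Q 0 + σ .i 0 % σ .Q 0 := by simp [y₂]
@[simp] theorem eval_tabE : tabE.eval I σ = σ .ptr 0 * (σ .Q 0 * σ .Q 0) + σ .i 0 := rfl

end

end Code

namespace Inst
open Classical

/-- The results of the preparations. -/
structure Tables where
  (par U R B sz pw first full : ℕ → ℕ)
  (M Q Y : ℕ)

structure Tables.Ready (D : Tables) (σ : St) : Prop where
  par : σ .par = D.par
  U : σ .U = D.U
  R : σ .R = D.R
  B : σ .B = D.B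
  sz : σ .sz = D.sz
  pw : σ .pw = D.pw
  first : σ .first = D.first
  full : σ .full = D.full
  M : σ .M 0 = D.M
  Q : σ .Q 0 = D.Q
  Y : σ .Y 0 = D.Y

theorem Tables.Ready.mono {D : Tables} {σ τ : St} (h : D.Ready σ)
    (hτ : ∀ b : Arr, b ≠ .f → b ≠ .v → b ≠ .t → b ≠ .sg → b ≠ .pr → b ≠ .e → b ≠ .acc → b ≠ .i →
      b ≠ .j → b ≠ .Tab → b ≠ .br → b ≠ .ptr → τ b = σ b) : D.Ready τ := by
  constructor
  · rw [hτ .par (by decide) (by decide) (by decide) (by decide) (by decide) (by decide) (by decide)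
      (by decide) (by decide) (by decide) (by decide) (by decide), h.par]
  · rw [hτ .U (by decide) (by decide) (by decide) (by decide) (by decide) (by decide) (by decide)
      (by decide) (by decide) (by decide) (by decide) (by decide), h.U]
  · rw [hτ .R (by decide) (by decide) (by decide) (by decide) (by decide) (by decide) (by decide)
      (by decide) (by decide) (by decide) (by decide) (by decide), h.R]
  · rw [hτ .B (by decide) (by decide) (by decide) (by decide) (by decide) (by decide) (by decide)
      (by decide) (by decide) (by decide) (by decide) (by decide), h.B]
  · rw [hτ .sz (by decide) (by decide) (by decide) (by decide) (by decide) (by decide) (by decide)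
      (by decide) (by decide) (by decide) (by decide) (by decide), h.sz]
  · rw [hτ .pw (by decide) (by decide) (by decide) (by decide) (by decide) (by decide) (by decide)
      (by decide) (by decide) (by decide) (by decide) (by decide), h.pw]
  · rw [hτ .first (by decide) (by decide) (by decide) (by decide) (by decide) (by decide) (by decide)
      (by decide) (by decide) (by decide) (by decide) (by decide), h.first]
  · rw [hτ .full (by decide) (by decide) (by decide) (by decide) (by decide) (by decide) (by decide)
      (by decide) (by decide) (by decide) (by decide) (by decide), h.full]
  · rw [hτ .M (by decide) (by decide) (by decide) (by decide) (by decide) (by decide) (by decide)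
      (by decide) (by decide) (by decide) (by decide) (by decide), h.M]
  · rw [hτ .Q (by decide) (by decide) (by decide) (by decide) (by decide) (by decide) (by decide)
      (by decide) (by decide) (by decide) (by decide) (by decide), h.Q]
  · rw [hτ .Y (by decide) (by decide) (by decide) (by decide) (by decide) (by decide) (by decide)
      (by decide) (by decide) (by decide) (by decide) (by decide), h.Y]

/-- The tables describe `T` correctly. -/
structure Good (T : Inst) (I : List ℕ) (D : Tables) (anc : ℕ → ℕ → Prop) (rk : ℕ → ℕ) : Prop where
  reads : T.Reads I
  rooted : T.Rooted D.par anc rk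
  layout : T.Layout anc D.R D.B D.par D.U
  sz : ∀ a ≤ T.N, D.sz a = T.size anc a
  pw : ∀ t ≤ T.N, ∀ v < T.n + T.m, D.pw (t * (T.n + T.m) + v) = T.pw t v
  first : ∀ t < T.N, ∀ v < T.n + T.m,
    D.first (t * (T.n + T.m) + v) = if T.first t v then 1 else 0
  full : ∀ t < T.N, D.full t = T.full t
  M : D.M = 2 ^ T.n + 1
  Q_pos : 0 < D.Q
  Y_pos : 0 < D.Y
  le : ∀ t < T.N, T.full t ≤ D.Y * D.Q

/-- The bounds on indices and values. -/
structure Bounds (T : Inst) (D : Tables) (A V : ℕ) : Prop where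
  A_tab : T.N * (D.Q * D.Q) ≤ A
  N_A : T.N < A
  M_V : D.M ≤ V
  QQ_V : D.Q * D.Q < V
  Y_V : D.Y < V
  N_V : T.N < V
  nm_V : 2 * (T.n + T.m) < V
  mn_V : 2 * (T.m * T.n) < V

end Inst
-- Correctness of the tests and signs for one state
namespace Inst
open Classical

variable {T : Inst} {I : List ℕ} {D : Tables} {anc : ℕ → ℕ → Prop} {rk : ℕ → ℕ} {A V : ℕ}

theorem pw_eq_zero {t v : ℕ} : T.pw t v = 0 ↔ ¬ T.inB t v := by
  unfold pw; split_ifs with h <;> simp [h]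

theorem Rooted.par_le {par : ℕ → ℕ} (h : T.Rooted par anc rk) {t : ℕ} (ht : t < T.N) :
    par t ≤ T.N := by
  by_cases h0 : t = 0
  · rw [h0, h.par_zero]
  · exact (h.par_lt h0 ht).le

theorem sum_eq_zero_iff_range {n : ℕ} {F : ℕ → ℕ} :
    ∑ v ∈ Finset.range n, F v = 0 ↔ ∀ v < n, F v = 0 := by
  simp

theorem sum_range_le {n c : ℕ} {F : ℕ → ℕ} (h : ∀ v < n, F v ≤ c) :
    ∑ v ∈ Finset.range n, F v ≤ c * n := by
  refine (Finset.sum_le_card_nsmul _ _ c fun v hv => h v (Finset.mem_range.1 hv)).trans ?_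
  simp [mul_comm]

namespace Good
variable (G : T.Good I D anc rk) (Bd : T.Bounds D A V)
include G

theorem R_lt {p : ℕ} (hp : p < T.N) : D.R p < T.N := (G.layout.valid p hp).1

theorem B_le {p : ℕ} (hp : p < T.N) : D.B p ≤ T.N := by
  rcases (G.layout.valid p hp).2 with h | h
  · exact h.le
  · exact (G.rooted.anc_lt h.1).le

theorem pw_agree {s t x y : ℕ} (hs : s ≤ T.N) (ht : t ≤ T.N) : T.Agree s t x y ↔
    ∀ v < T.n + T.m, D.pw (s * (T.n + T.m) + v) ≠ 0 → D.pw (t * (T.n + T.m) + v) ≠ 0 →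
      digit x (D.pw (s * (T.n + T.m) + v)) = digit y (D.pw (t * (T.n + T.m) + v)) := by
  constructor
  · intro h v hv h1 h2
    rw [G.pw s hs v hv] at *
    rw [G.pw t ht v hv] at *
    rw [ne_eq, pw_eq_zero, not_not] at h1 h2
    exact h v h1 h2
  · intro h v h1 h2
    have hv := (T.inB_lt h1).2
    have := h v hv
    rw [G.pw s hs v hv, G.pw t ht v hv, ne_eq, ne_eq, pw_eq_zero, pw_eq_zero, not_not, not_not]
      at this
    exact this h1 h2

include Bd

theorem wp_disagree {σ : St} (hσ : D.Ready σ) {p : ℕ} (hp : p < T.N) (hptr : σ .ptr 0 = p) :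
    WP I A V Code.disagree σ (3 * (T.n + T.m) + 3) fun τ => (τ .f 0 = 0 ↔
      (D.par (D.U p) = D.par (D.R p) → T.Agree (D.U p) (D.par (D.R p))
        (σ .br (D.U p) * D.Q + σ .j 0) (σ .br (D.par (D.R p)) * D.Q + σ .i 0 / D.Q)) ∧
      (D.par (D.B p) = D.U p → T.Agree (D.U p) (D.B p)
        (σ .br (D.U p) * D.Q + σ .j 0) (σ .br (D.B p) * D.Q + σ .i 0 % D.Q))) := by
  have hU := G.layout.U_lt G.rooted hp
  let F : ℕ → ℕ := fun v => (if D.pw (D.U p * (T.n + T.m) + v) = 0 then 0 else 1) *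
    ((if D.par (D.U p) = D.par (D.R p) then 1 else 0) *
      (if D.pw (D.par (D.R p) * (T.n + T.m) + v) = 0 then 0 else 1) *
      ((digit (σ .br (D.U p) * D.Q + σ .j 0) (D.pw (D.U p * (T.n + T.m) + v)) -
        digit (σ .br (D.par (D.R p)) * D.Q + σ .i 0 / D.Q)
          (D.pw (D.par (D.R p) * (T.n + T.m) + v))) +
       (digit (σ .br (D.par (D.R p)) * D.Q + σ .i 0 / D.Q)
          (D.pw (D.par (D.R p) * (T.n + T.m) + v)) -
        digit (σ .br (D.U p) * D.Q + σ .j 0) (D.pw (D.U p * (T.n + T.m) + v)))) +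
     (if D.par (D.B p) = D.U p then 1 else 0) *
      (if D.pw (D.B p * (T.n + T.m) + v) = 0 then 0 else 1) *
      ((digit (σ .br (D.U p) * D.Q + σ .j 0) (D.pw (D.U p * (T.n + T.m) + v)) -
        digit (σ .br (D.B p) * D.Q + σ .i 0 % D.Q) (D.pw (D.B p * (T.n + T.m) + v))) +
       (digit (σ .br (D.B p) * D.Q + σ .i 0 % D.Q) (D.pw (D.B p * (T.n + T.m) + v)) -
        digit (σ .br (D.U p) * D.Q + σ .j 0) (D.pw (D.U p * (T.n + T.m) + v)))))
  -- Two edges are tested per vertex, so the sum stays below `V` by `Bounds.nm_V`.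
  have hF : ∀ v, F v ≤ 2 := by
    intro v
    have key : ∀ a b c d : ℕ, (if a = 0 then 0 else 1) * (c + d) ≤ c + d := by
      intro a b c d; split_ifs <;> simp
    have key2 : ∀ (P : Prop) [Decidable P] (a x y p q : ℕ), (if P then 1 else 0) *
        (if a = 0 then 0 else 1) * ((digit x p - digit y q) + (digit y q - digit x p)) ≤ 1 := by
      intro P _ a x y p q
      have := digit_lt x p
      have := digit_lt y q
      split_ifs <;> simp <;> omega
    exact (key _ 0 _ _).trans (add_le_add (key2 _ _ _ _ _ _) (key2 _ _ _ _ _ _))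
  refine (WP.sum F (by decide) (by have := Bd.N_A; omega) (n := T.n + T.m)
    (by have := Bd.nm_V; omega)
    (lt_of_le_of_lt (sum_range_le fun v _ => hF v) Bd.nm_V) ?_ ?_).mono le_rfl ?_
  · intro τ _
    simp [-List.getD_eq_getElem?_getD, G.reads.n, G.reads.m]
  · intro v hv τ hτ hv'
    have hR : D.Ready τ := hσ.mono fun b hf hv ht hs _ _ _ _ _ _ _ _ =>
      hτ b hf hv
    simp [-List.getD_eq_getElem?_getD, hR.par, hR.U, hR.R, hR.B, hR.pw, hR.Q, hτ .ptr, hτ .br, hτ .i, hτ .j, hptr, hv',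
      G.reads.n, G.reads.m, F]
  · rintro τ ⟨h1, -⟩
    rw [h1, sum_eq_zero_iff_range, G.pw_agree hU.le (G.rooted.par_le (G.R_lt hp)),
      G.pw_agree hU.le (G.B_le hp)]
    constructor
    · intro h2
      refine ⟨fun h3 v hv h4 h5 => ?_, fun h3 v hv h4 h5 => ?_⟩
      · have := h2 v hv
        simp only [F, if_neg h4, if_neg h5, if_pos h3] at this
        omega
      · have := h2 v hv
        simp only [F, if_neg h4, if_neg h5, if_pos h3] at this
        omega
    · rintro ⟨h2, h3⟩ v hv
      by_cases h4 : D.pw (D.U p * (T.n + T.m) + v) = 0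
      · simp [F, h4]
      · simp only [F, if_neg h4, one_mul, Nat.add_eq_zero_iff]
        constructor
        · by_cases h5 : D.par (D.U p) = D.par (D.R p)
          · by_cases h6 : D.pw (D.par (D.R p) * (T.n + T.m) + v) = 0
            · simp [h6]
            · simp [h2 h5 v hv h4 h6]
          · simp [h5]
        · by_cases h5 : D.par (D.B p) = D.U p
          · by_cases h6 : D.pw (D.B p * (T.n + T.m) + v) = 0
            · simp [h6]
            · simp [h3 h5 v hv h4 h6]
          · simp [h5]

theorem wp_clashes {σ : St} (hσ : D.Ready σ) {p : ℕ} (hp : p < T.N) (hptr : σ .ptr 0 = p) :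
    WP I A V Code.clashes σ (3 * (T.m * T.n) + 3) fun τ => (τ .t 0 = 0 ↔
      ∀ j < T.m, ∀ u < T.n, ¬ T.Clash (D.U p) (σ .br (D.U p) * D.Q + σ .j 0) j u) := by
  have hU := G.layout.U_lt G.rooted hp
  set x := σ .br (D.U p) * D.Q + σ .j 0 with hx
  -- The pairs of a clause `j` and a variable `u` are numbered by `v = j * n + u`, as in the
  -- matrices of the input.
  let F : ℕ → ℕ := fun v => digit x (T.pw (D.U p) (T.n + v / T.n)) *
    ((if T.pos (v / T.n) (v % T.n) then 1 else 0) * digit x (T.pw (D.U p) (v % T.n)) +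
      (if T.neg (v / T.n) (v % T.n) then 1 else 0) *
        ((if T.inB (D.U p) (v % T.n) then 1 else 0) * (1 - digit x (T.pw (D.U p) (v % T.n)))))
  have hF : ∀ v, F v ≤ 2 := by
    intro v
    have h1 := digit_lt x (T.pw (D.U p) (T.n + v / T.n))
    have h2 := digit_lt x (T.pw (D.U p) (v % T.n))
    calc F v ≤ 1 * (1 * 1 + 1 * (1 * 1)) := by
          simp only [F]
          gcongr
          · omega
          · split_ifs <;> omega
          · omega
          · split_ifs <;> omega
          · split_ifs <;> omega
          · omega
      _ = 2 := by norm_num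
  refine (WP.sum F (by decide) (by have := Bd.N_A; omega) (n := T.m * T.n)
    (by have := Bd.mn_V; omega)
    (lt_of_le_of_lt (sum_range_le fun v _ => hF v) Bd.mn_V) ?_ ?_).mono le_rfl ?_
  · intro τ _
    simp [-List.getD_eq_getElem?_getD, G.reads.n, G.reads.m]
  · intro v hv τ hτ hv'
    have hR : D.Ready τ := hσ.mono fun b hf hv ht hs _ _ _ _ _ _ _ _ =>
      hτ b ht hv
    have hn : 0 < T.n := Nat.pos_of_ne_zero fun h => by simp [h] at hv
    have h1 : v / T.n < T.m := Nat.div_lt_of_lt_mul (by rwa [mul_comm])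
    have h2 : v % T.n < T.n := Nat.mod_lt _ hn
    have h3 : v / T.n * T.n + v % T.n = v := by rw [mul_comm]; exact Nat.div_add_mod v T.n
    have h4 := G.reads.pos _ h1 _ h2
    have h5 := G.reads.neg _ h1 _ h2
    rw [h3] at h4 h5
    have h6 := G.pw _ hU.le (T.n + v / T.n) (by omega)
    have h7 := G.pw _ hU.le (v % T.n) (by omega)
    simp only [AExpr.eval_mul, Code.eval_digitE, Code.eval_x, Code.eval_pwE, Code.eval_u,
      AExpr.eval_add, Code.eval_nE, AExpr.eval_div, Code.eval_rd, AExpr.eval_inp, AExpr.eval_ofNat,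
      AExpr.eval_mod, Code.eval_mE, AExpr.eval_nz, AExpr.eval_sub]
    have e1 : τ .ptr 0 = p := by rw [hτ .ptr (by decide) (by decide), hptr]
    rw [hR.pw, hR.U, hR.Q, e1, hτ .br (by decide) (by decide), hτ .j (by decide) (by decide), hv',
      G.reads.n, G.reads.m, h4, h5, ← hx, h6, h7]
    simp only [F, pw_eq_zero, ite_not]
  · rintro τ ⟨h1, -⟩
    rw [h1, sum_eq_zero_iff_range]
    have key : ∀ v, F v = 0 ↔ ¬ T.Clash (D.U p) x (v / T.n) (v % T.n) := by
      intro v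
      have h1 := digit_lt x (T.pw (D.U p) (T.n + v / T.n))
      have h2 := digit_lt x (T.pw (D.U p) (v % T.n))
      simp only [F, Clash]
      generalize digit x (T.pw (D.U p) (T.n + v / T.n)) = a at *
      generalize digit x (T.pw (D.U p) (v % T.n)) = b at *
      interval_cases a <;> interval_cases b <;> simp <;> tauto
    constructor
    · intro h2 j hj u hu
      have hv : j * T.n + u < T.m * T.n := by nlinarith
      have := (key _).1 (h2 _ hv)
      have hn : 0 < T.n := by omega
      rw [show (j * T.n + u) / T.n = j by
          rw [mul_comm, Nat.mul_add_div hn, Nat.div_eq_of_lt hu, add_zero],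
        show (j * T.n + u) % T.n = u by
          rw [mul_comm, Nat.mul_add_mod, Nat.mod_eq_of_lt hu]] at this
      exact this
    · intro h2 v hv
      have hn : 0 < T.n := Nat.pos_of_ne_zero fun h => by simp [h] at hv
      exact (key v).2 (h2 _ (Nat.div_lt_of_lt_mul (by rwa [mul_comm])) _ (Nat.mod_lt _ hn))

theorem wp_signs {σ : St} (hσ : D.Ready σ) {p : ℕ} (hp : p < T.N) (hptr : σ .ptr 0 = p)
    (R : Type*) [CommRing R] :
    WP I A V Code.signs σ (3 * T.m + 3) fun τ => (-1 : R) ^ τ .sg 0 =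
      ∏ j ∈ Finset.range T.m, if T.first (D.U p) (T.n + j) ∧
        digit (σ .br (D.U p) * D.Q + σ .j 0) (T.pw (D.U p) (T.n + j)) = 1 then -1 else 1 := by
  have hU := G.layout.U_lt G.rooted hp
  set x := σ .br (D.U p) * D.Q + σ .j 0 with hx
  let F : ℕ → ℕ := fun j => (if T.first (D.U p) (T.n + j) then 1 else 0) *
    digit x (T.pw (D.U p) (T.n + j))
  have hF : ∀ v, F v ≤ 1 := by
    intro v
    have h1 := digit_lt x (T.pw (D.U p) (T.n + v))
    simp only [F]
    split_ifs <;> omega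
  refine (WP.sum F (by decide) (by have := Bd.N_A; omega) (n := T.m)
    (by have := Bd.nm_V; omega)
    (lt_of_le_of_lt (sum_range_le fun v _ => hF v) (by have := Bd.nm_V; omega)) ?_ ?_).mono
    le_rfl ?_
  · intro τ _
    simp [-List.getD_eq_getElem?_getD, G.reads.m]
  · intro v hv τ hτ hv'
    have hR : D.Ready τ := hσ.mono fun b hf hv ht hs _ _ _ _ _ _ _ _ =>
      hτ b hs hv
    have h6 := G.pw _ hU.le (T.n + v) (by omega)
    have h7 := G.first _ hU (T.n + v) (by omega)
    simp only [AExpr.eval_mul, Code.eval_digitE, Code.eval_x, Code.eval_pwE, Code.eval_u,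
      AExpr.eval_add, Code.eval_nE, Code.eval_rd, AExpr.eval_arr, Code.eval_mE]
    have e1 : τ .ptr 0 = p := by rw [hτ .ptr (by decide) (by decide), hptr]
    rw [hR.pw, hR.U, hR.Q, hR.first, e1, hτ .br (by decide) (by decide),
      hτ .j (by decide) (by decide), hv', G.reads.n, G.reads.m, ← hx, h6, h7]
  · rintro τ ⟨h1, -⟩
    rw [h1, ← Finset.prod_pow_eq_pow_sum]
    refine Finset.prod_congr rfl fun j _ => ?_
    have h1 := digit_lt x (T.pw (D.U p) (T.n + j))
    simp only [F]
    generalize digit x (T.pw (D.U p) (T.n + j)) = a at *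
    interval_cases a <;> by_cases h2 : T.first (D.U p) (T.n + j) <;> simp [h2]

end Good
end Inst
-- Tables of components and the contribution of one state
namespace Inst
open Classical

variable {T : Inst} {I : List ℕ} {D : Tables} {anc : ℕ → ℕ → Prop} {rk : ℕ → ℕ} {A V : ℕ}

/-- The weight of the interval `[l, h)`, modulo `M`. -/
noncomputable def psum (T : Inst) (D : Tables) (l h : ℕ) : (ℕ → ℕ) → ZMod D.M :=
  partSum (D.Y * D.Q) D.U (T.localWeight D.R D.B (ZMod D.M) D.par D.U) l h

/-- The states of the two boundary nodes of the component at `e` are `a` and `b` in `x`, up to the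
digits given by `br`. -/
def Fits (T : Inst) (D : Tables) (br : ℕ → ℕ) (e a b : ℕ) (x : ℕ → ℕ) : Prop :=
  (D.par (D.R e) ≠ T.N → x (D.par (D.R e)) = br (D.par (D.R e)) * D.Q + a) ∧
  (D.B e ≠ T.N → x (D.B e) = br (D.B e) * D.Q + b)

/-- The table of the component at `e` is complete. -/
def Correct (T : Inst) (D : Tables) (anc : ℕ → ℕ → Prop) (br tab : ℕ → ℕ) (e : ℕ) : Prop :=
  ∀ a < D.Q, ∀ b < D.Q, ∀ x, T.Fits D br e a b x →
    (tab (e * (D.Q * D.Q) + (a * D.Q + b)) : ZMod D.M) =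
      T.psum D (T.lo anc D.R D.B e) (e + 1) x

/-- The cost of one summand. -/
def innerCost (T : Inst) : ℕ :=
  (3 * (T.n + T.m) + 3) + ((3 * (T.m * T.n) + 3) + ((3 * T.m + 3) + ((3 * T.N + 3) + 1)))

namespace Good
variable (G : T.Good I D anc rk) (Bd : T.Bounds D A V)
include G

local notation "lo'" => T.lo anc D.R D.B

theorem M_pos : 0 < D.M := by rw [G.M]; positivity

theorem two_le_M : 2 ≤ D.M := by
  rw [G.M]; have := Nat.one_le_two_pow (n := T.n); omega

theorem lo_eval {p : ℕ} (hp : p < T.N) : p + 1 - (D.sz (D.R p) - D.sz (D.B p)) = lo' p := by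
  rw [G.sz _ (G.R_lt hp).le, G.sz _ (G.B_le hp), lo]

theorem top_ne {p : ℕ} (hp : p < T.N) : D.par (D.R p) ≠ D.U p := fun h1 =>
  G.rooted.par_not_mem (G.layout.valid p hp) (h1 ▸ G.rooted.cand_mem (G.layout.split p hp).1)

theorem bot_ne {p : ℕ} (hp : p < T.N) : D.B p ≠ D.U p := fun h1 => by
  have h2 := G.rooted.cand_mem (G.layout.split p hp).1
  rw [← h1] at h2
  exact G.rooted.bot_not_mem h2

/-- The truncated difference from 1 is the indicator of no disagreement, no clash and a number that
is a state, since `x + 1 - full` vanishes exactly for `x < full`. The sign is 1 or `M - 1`, which is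
-1 modulo `M`. -/
theorem localWeight_cast {p : ℕ} {x : ℕ → ℕ} {f t sg : ℕ}
    (hf : f = 0 ↔ (D.par (D.U p) = D.par (D.R p) →
        T.Agree (D.U p) (D.par (D.R p)) (x (D.U p)) (x (D.par (D.R p)))) ∧
      (D.par (D.B p) = D.U p → T.Agree (D.U p) (D.B p) (x (D.U p)) (x (D.B p))))
    (ht : t = 0 ↔ ∀ j < T.m, ∀ u < T.n, ¬ T.Clash (D.U p) (x (D.U p)) j u)
    (hs : (-1 : ZMod D.M) ^ sg = ∏ j ∈ Finset.range T.m, if T.first (D.U p) (T.n + j) ∧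
        digit (x (D.U p)) (T.pw (D.U p) (T.n + j)) = 1 then -1 else 1) :
    (((1 - (f + t + (x (D.U p) + 1 - T.full (D.U p)))) * (1 + sg % 2 * (D.M - 2)) : ℕ) : ZMod D.M) =
      T.localWeight D.R D.B (ZMod D.M) D.par D.U p x := by
  have hM := G.two_le_M
  have h1 : ((1 + sg % 2 * (D.M - 2) : ℕ) : ZMod D.M) = (-1) ^ sg := by
    rcases Nat.mod_two_eq_zero_or_one sg with h2 | h2
    · rw [h2, (Nat.even_iff.2 h2).neg_one_pow]; simp
    · rw [h2, (Nat.odd_iff.2 h2).neg_one_pow, show 1 + 1 * (D.M - 2) = D.M - 1 by omega,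
        Nat.cast_sub (by omega), ZMod.natCast_self]; simp
  rw [Nat.cast_mul, h1, hs, localWeight, nodeWeight]
  simp only [← hf, ← ht]
  by_cases h2 : x (D.U p) < T.full (D.U p)
  · by_cases h3 : f = 0
    · by_cases h4 : t = 0
      · rw [if_pos ⟨h2, h4⟩, if_pos h3, h3, h4, show x (D.U p) + 1 - T.full (D.U p) = 0 by omega]
        simp
      · rw [if_neg (fun h => h4 h.2), show 1 - (f + t + (x (D.U p) + 1 - T.full (D.U p))) = 0 by
          omega]
        simp
    · rw [if_neg h3, show 1 - (f + t + (x (D.U p) + 1 - T.full (D.U p))) = 0 by omega]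
      simp
  · rw [if_neg (fun h => h2 h.1), show 1 - (f + t + (x (D.U p) + 1 - T.full (D.U p))) = 0 by omega]
    simp

include Bd

theorem wp_children {σ : St} (hσ : D.Ready σ) {p : ℕ} (hp : p < T.N) (hptr : σ .ptr 0 = p)
    (hi : σ .i 0 < D.Q * D.Q) (hj : σ .j 0 < D.Q)
    (hcor : ∀ e, Top lo' (lo' p) p e → T.Correct D anc (σ .br) (σ .Tab) e) :
    WP I A V Code.children σ (3 * T.N + 3) fun τ => ∀ x : ℕ → ℕ,
      x (D.U p) = σ .br (D.U p) * D.Q + σ .j 0 →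
      T.Fits D (σ .br) p (σ .i 0 / D.Q) (σ .i 0 % D.Q) x →
      (τ .pr 0 : ZMod D.M) = T.psum D (lo' p) p x := by
  have hA : 0 < A := by have := Bd.N_A; omega
  have hM := G.two_le_M
  have hMV := Bd.M_V
  have hNV := Bd.N_V
  have hlo := G.layout.lo_le hp
  refine (WP.seq (C := 1) (C' := 1 + (T.N * (1 + 1 + 1) + 1)) (WP.set (by simpa using hA)
    (by simp; omega) (WP.seq (WP.set (by simpa using hA) (by simp; rw [St.upd_ne _ (by decide), hptr]; omega) ?_)))).mono
    (by omega) fun _ h => h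
  simp only [AExpr.eval_ofNat, Code.eval_p]
  set σ1 := (σ.upd .pr 0 1).upd .e 0 ((σ.upd .pr 0 1) .ptr 0) with hσ1
  have f1 : ∀ b, b ≠ .pr → b ≠ .e → σ1 b = σ b := fun b h1 h2 => by
    rw [hσ1, St.upd_ne _ h2, St.upd_ne _ h1]
  have e1 : σ1 .e 0 = p := by
    rw [hσ1, St.upd_same, St.upd_ne _ (by decide), hptr]
  have e2 : σ1 .pr 0 = 1 := by
    rw [hσ1, St.upd_ne _ (by decide), St.upd_same]
  -- The pieces are visited from right to left; `e` is the end of the unvisited part `[lo p, e)`.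
  -- Invariant: the product so far times the weight of the unvisited part is the weight of all
  -- pieces. `partSum_chain` splits off one more factor, and the measure is the length of the
  -- unvisited part.
  refine (WP.loop (C := 1 + 1) (fun d τ => (∀ b, b ≠ .pr → b ≠ .e → τ b = σ b) ∧ τ .e 0 = lo' p + d ∧
    τ .e 0 ≤ p ∧ Chain lo' (lo' p) (τ .e 0) ∧
    (∀ e, Top lo' (lo' p) (τ .e 0) e → Top lo' (lo' p) p e) ∧
    ∀ x : ℕ → ℕ, x (D.U p) = σ .br (D.U p) * D.Q + σ .j 0 →
      T.Fits D (σ .br) p (σ .i 0 / D.Q) (σ .i 0 % D.Q) x →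
      (τ .pr 0 : ZMod D.M) * T.psum D (lo' p) (τ .e 0) x = T.psum D (lo' p) p x)
    ?_ ?_ (p - lo' p) ?_).mono ?_ ?_
  · rintro τ ⟨h1, h2, -⟩
    have hR : D.Ready τ := hσ.mono fun b _ _ _ _ hpr he _ _ _ _ _ _ => h1 b hpr he
    simp only [AExpr.eval_sub, Code.eval_rd, Code.eval_loE, Code.eval_p]
    rw [h1 .ptr (by decide) (by decide), hptr, hR.sz, hR.R, hR.B, G.lo_eval hp, h2]
    omega
  · rintro d τ ⟨h1, h2, h3, h4, h5, h6⟩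
    have hR : D.Ready τ := hσ.mono fun b _ _ _ _ hpr he _ _ _ _ _ _ => h1 b hpr he
    obtain ⟨e, he⟩ : ∃ e, τ .e 0 = e + 1 := ⟨lo' p + d, by omega⟩
    rw [he] at h2 h3 h4 h5 h6
    have heN : e < T.N := by omega
    obtain ⟨hle, hch⟩ := h4.cons_inv (by omega)
    have htop := h5 e (.head (by omega))
    have hlo2 := hch.le
    constructor
    · simp only [AExpr.eval_sub, Code.eval_rd, Code.eval_loE, Code.eval_p]
      rw [h1 .ptr (by decide) (by decide), hptr, hR.sz, hR.R, hR.B, G.lo_eval hp, he]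
      omega
    -- `childE` selects the right entry: by `piece_par` and `piece_bot` a boundary node of a piece
    -- is the split node or a boundary node of the current component, or is missing.
    have hchild : ∃ a < D.Q, ∃ b < D.Q, (∀ x : ℕ → ℕ,
        x (D.U p) = σ .br (D.U p) * D.Q + σ .j 0 →
        T.Fits D (σ .br) p (σ .i 0 / D.Q) (σ .i 0 % D.Q) x → T.Fits D (σ .br) e a b x) ∧
        Code.childE.eval I τ = τ .Tab (e * (D.Q * D.Q) + (a * D.Q + b)) := by
      have hi1 : σ .i 0 / D.Q < D.Q := Nat.div_lt_of_lt_mul hi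
      have hi2 : σ .i 0 % D.Q < D.Q := Nat.mod_lt _ G.Q_pos
      refine ⟨if D.par (D.R e) = D.U p then σ .j 0 else σ .i 0 / D.Q, by split_ifs <;> assumption,
        if D.B e = D.U p then σ .j 0 else σ .i 0 % D.Q, by split_ifs <;> assumption,
        fun x hx hfit => ⟨?_, ?_⟩, ?_⟩
      · intro h7
        split_ifs with h8
        · rw [h8, hx]
        · rcases Rooted.piece_par (G.layout.piece p hp e htop) with h9 | h9
          · exact absurd h9 h8
          · rw [h9] at h7 ⊢; exact hfit.1 h7
      · intro h7
        split_ifs with h8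
        · rw [h8, hx]
        · rcases Rooted.piece_bot (G.layout.piece p hp e htop) with h9 | h9 | h9
          · exact absurd h9 h8
          · rw [h9] at h7 ⊢; exact hfit.2 h7
          · exact absurd h9 h7
      · simp only [Code.childE, AExpr.eval_arr, AExpr.eval_add, AExpr.eval_mul, AExpr.eval_sub,
          Code.eval_rd, AExpr.eval_eq, AExpr.eval_ofNat, AExpr.eval_div, AExpr.eval_mod, Code.eval_u,
          he, Nat.add_sub_cancel, hR.par, hR.U, hR.R, hR.B, hR.Q,
          h1 .ptr (by decide) (by decide), hptr, h1 .i (by decide) (by decide),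
          h1 .j (by decide) (by decide)]
        split_ifs <;> simp
    obtain ⟨a, ha, b, hb, hfe, hval⟩ := hchild
    refine WP.seq (WP.set (by simpa using hA) ?_ ?_)
    · simp only [AExpr.eval_mod, Code.eval_rd]
      rw [hR.M]
      exact (Nat.mod_lt _ G.M_pos).trans_le Bd.M_V
    refine WP.set (by simpa using hA) ?_ ?_
    · simp only [Code.eval_loE, AExpr.eval_sub, Code.eval_rd, AExpr.eval_ofNat]
      simp only [St.upd_ne _ (show Arr.e ≠ Arr.pr by decide),
        St.upd_ne _ (show Arr.sz ≠ Arr.pr by decide), St.upd_ne _ (show Arr.R ≠ Arr.pr by decide),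
        St.upd_ne _ (show Arr.B ≠ Arr.pr by decide)]
      rw [he, Nat.add_sub_cancel, hR.sz, hR.R, hR.B, G.lo_eval heN]
      omega
    · set τ' := τ.upd .pr (AExpr.eval I τ 0)
        ((AExpr.mod (Code.rd .pr * Code.childE) (Code.rd .M)).eval I τ) with hτ'
      have g1 : ∀ b, b ≠ .pr → τ' b = τ b := fun b hb => St.upd_ne _ hb _ _
      have v1 : (Code.loE (Code.rd .e - 1)).eval I τ' = lo' e := by
        simp only [Code.eval_loE, AExpr.eval_sub, Code.eval_rd, AExpr.eval_ofNat]
        rw [g1 .e (by decide), g1 .sz (by decide), g1 .R (by decide), g1 .B (by decide), he,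
          Nat.add_sub_cancel, hR.sz, hR.R, hR.B, G.lo_eval heN]
      rw [v1, AExpr.eval_ofNat]
      refine ⟨lo' e - lo' p, by omega, ?_, ?_, ?_, ?_, ?_, ?_⟩
      · intro b hb1 hb2
        rw [St.upd_ne _ hb2, g1 b hb1, h1 b hb1 hb2]
      · rw [St.upd_same]; omega
      · rw [St.upd_same]; omega
      · rw [St.upd_same]; exact hch
      · rw [St.upd_same]; exact fun e' he' => h5 e' (.tail (by omega) he')
      · intro x hx hfit
        rw [St.upd_same, St.upd_ne _ (by decide), hτ', AExpr.eval_ofNat, St.upd_same,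
          ← h6 x hx hfit]
        simp only [AExpr.eval_mod, AExpr.eval_mul, Code.eval_rd]
        rw [hR.M, ZMod.natCast_mod, Nat.cast_mul, hval, h1 .Tab (by decide) (by decide),
          hcor e htop a ha b hb x (hfe x hx hfit)]
        simp only [psum]
        rw [G.layout.partSum_chain G.rooted hp h4 h5 (by omega), Pi.mul_apply]
        ring
  · refine ⟨f1, by omega, by omega, ?_, ?_, ?_⟩
    · rw [e1]; exact G.layout.chain p hp
    · rw [e1]; exact fun e he => he
    · rw [e1, e2]; simp
  · have : p - lo' p ≤ T.N := by omega
    gcongr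
  · rintro τ ⟨-, h2, -, -, -, h6⟩ x hx hfit
    rw [h2, add_zero] at h6
    rw [← h6 x hx hfit]
    simp only [psum, partSum_self, Pi.one_apply, mul_one]

theorem wp_inner {σ : St} (hσ : D.Ready σ) {p : ℕ} (hp : p < T.N) (hptr : σ .ptr 0 = p)
    (hi : σ .i 0 < D.Q * D.Q) (hj : σ .j 0 < D.Q)
    (hcor : ∀ e, Top lo' (lo' p) p e → T.Correct D anc (σ .br) (σ .Tab) e) :
    WP I A V Code.inner σ T.innerCost fun τ => ∀ x : ℕ → ℕ,
      x (D.U p) = σ .br (D.U p) * D.Q + σ .j 0 →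
      T.Fits D (σ .br) p (σ .i 0 / D.Q) (σ .i 0 % D.Q) x →
      (τ .acc 0 : ZMod D.M) = σ .acc 0 +
        T.localWeight D.R D.B (ZMod D.M) D.par D.U p x * T.psum D (lo' p) p x := by
  have hA : 0 < A := by have := Bd.N_A; omega
  have hU := G.layout.U_lt G.rooted hp
  refine WP.seq ((G.wp_disagree Bd hσ hp hptr).frame.mono le_rfl fun τ1 ⟨q1, f1⟩ => ?_)
  have f1 : ∀ b, b ≠ .f → b ≠ .v → τ1 b = σ b := fun b h1 h2 => f1 b (by simp [Code.disagree, h1, h2])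
  have r1 : D.Ready τ1 := hσ.mono fun b hf hv ht hs hpr he _ _ _ _ _ _ => f1 b hf hv
  refine WP.seq ((G.wp_clashes Bd r1 hp (by rw [f1 .ptr (by decide) (by decide), hptr])).frame.mono
    le_rfl fun τ2 ⟨q2, f2⟩ => ?_)
  have f2 : ∀ b, b ≠ .t → b ≠ .v → τ2 b = τ1 b := fun b h1 h2 => f2 b (by simp [Code.clashes, h1, h2])
  have f2' : ∀ b, b ≠ .f → b ≠ .v → b ≠ .t → τ2 b = σ b := fun b h1 h2 h3 => by
    rw [f2 b h3 h2, f1 b h1 h2]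
  have r2 : D.Ready τ2 := hσ.mono fun b hf hv ht hs hpr he _ _ _ _ _ _ => f2' b hf hv ht
  refine WP.seq ((G.wp_signs Bd r2 hp (by rw [f2' .ptr (by decide) (by decide) (by decide), hptr])
    (ZMod D.M)).frame.mono le_rfl fun τ3 ⟨q3, f3⟩ => ?_)
  have f3 : ∀ b, b ≠ .sg → b ≠ .v → τ3 b = τ2 b := fun b h1 h2 => f3 b (by simp [Code.signs, h1, h2])
  have f3' : ∀ b, b ≠ .f → b ≠ .v → b ≠ .t → b ≠ .sg → τ3 b = σ b := fun b h1 h2 h3 h4 => by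
    rw [f3 b h4 h2, f2' b h1 h2 h3]
  have r3 : D.Ready τ3 := hσ.mono fun b hf hv ht hs hpr he _ _ _ _ _ _ => f3' b hf hv ht hs
  have br3 := f3' .br (by decide) (by decide) (by decide) (by decide)
  have i3 := f3' .i (by decide) (by decide) (by decide) (by decide)
  have j3 := f3' .j (by decide) (by decide) (by decide) (by decide)
  have p3 := f3' .ptr (by decide) (by decide) (by decide) (by decide)
  have t3 := f3' .Tab (by decide) (by decide) (by decide) (by decide)
  refine WP.seq ((G.wp_children Bd r3 hp (by rw [p3, hptr]) (by rw [i3]; exact hi)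
    (by rw [j3]; exact hj) (by rw [br3, t3]; exact hcor)).frame.mono le_rfl fun τ4 ⟨q4, f4⟩ => ?_)
  have f4 : ∀ b, b ≠ .pr → b ≠ .e → τ4 b = τ3 b := fun b h1 h2 => f4 b (by
    simp [Code.children, h1, h2])
  have f4' : ∀ b, b ≠ .f → b ≠ .v → b ≠ .t → b ≠ .sg → b ≠ .pr → b ≠ .e → τ4 b = σ b :=
    fun b h1 h2 h3 h4 h5 h6 => by rw [f4 b h5 h6, f3' b h1 h2 h3 h4]
  have r4 : D.Ready τ4 := hσ.mono fun b hf hv ht hs hpr he _ _ _ _ _ _ => f4' b hf hv ht hs hpr he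
  refine WP.set (by simpa using hA) ?_ ?_
  · simp only [AExpr.eval_mod, Code.eval_rd]
    rw [r4.M]
    exact (Nat.mod_lt _ G.M_pos).trans_le Bd.M_V
  intro x hx hfit
  simp only [AExpr.eval_ofNat, St.upd_same, AExpr.eval_mod, Code.eval_rd, AExpr.eval_add,
    AExpr.eval_mul, AExpr.eval_sub, Code.eval_x, AExpr.eval_arr, Code.eval_u]
  have br4 := f4' .br (by decide) (by decide) (by decide) (by decide) (by decide) (by decide)
  have j4 := f4' .j (by decide) (by decide) (by decide) (by decide) (by decide) (by decide)
  have p4 := f4' .ptr (by decide) (by decide) (by decide) (by decide) (by decide) (by decide)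
  have a4 := f4' .acc (by decide) (by decide) (by decide) (by decide) (by decide) (by decide)
  have g4 : τ4 .f = τ1 .f := by
    rw [f4 .f (by decide) (by decide), f3 .f (by decide) (by decide), f2 .f (by decide) (by decide)]
  have h4 : τ4 .t = τ2 .t := by rw [f4 .t (by decide) (by decide), f3 .t (by decide) (by decide)]
  have s4 : τ4 .sg = τ3 .sg := by rw [f4 .sg (by decide) (by decide)]
  rw [r4.M, r4.U, r4.full, r4.Q, br4, j4, p4, a4, hptr, g4, h4, s4, G.full _ hU, ZMod.natCast_mod]
  rw [f1 .br (by decide) (by decide), f1 .j (by decide) (by decide)] at q2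
  rw [f2' .br (by decide) (by decide) (by decide), f2' .j (by decide) (by decide) (by decide)] at q3
  rw [← hx] at q1 q2 q3 ⊢
  have q4 := q4 x (by rw [br3, j3]; exact hx) (by rw [br3, i3]; exact hfit)
  rw [Nat.cast_add, Nat.cast_mul, q4]
  congr 2
  refine G.localWeight_cast ?_ q2 q3
  rw [q1]
  -- `Fits` prescribes nothing at a missing boundary node, but there the tests are vacuous on both
  -- sides.
  refine and_congr (imp_congr_right fun _ => ?_) (imp_congr_right fun _ => ?_)
  · by_cases h5 : D.par (D.R p) = T.N
    · rw [h5]; exact iff_of_true not_agree_imp not_agree_imp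
    · rw [hfit.1 h5]
  · by_cases h5 : D.B p = T.N
    · rw [h5]; exact iff_of_true not_agree_imp not_agree_imp
    · rw [hfit.2 h5]

end Good
end Inst
-- One pass over a table and the recursion of the main loop
namespace Inst
open Classical

variable {T : Inst} {I : List ℕ} {D : Tables} {anc : ℕ → ℕ → Prop} {rk : ℕ → ℕ} {A V : ℕ}

/-- The table of the component at `e` contains the contribution of the first `k` states of the node
that is split off. -/
def Partial (T : Inst) (D : Tables) (anc : ℕ → ℕ → Prop) (br tab : ℕ → ℕ) (e k : ℕ) : Prop :=
  ∀ i < D.Q * D.Q, ∀ x, T.Fits D br e (i / D.Q) (i % D.Q) x →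
    (tab (e * (D.Q * D.Q) + i) : ZMod D.M) = sumAt k (D.U e)
      (T.localWeight D.R D.B (ZMod D.M) D.par D.U e * T.psum D (T.lo anc D.R D.B e) e) x

/-- The cost of one pass over a table. -/
def combineCost (T : Inst) (D : Tables) : ℕ :=
  D.Q * D.Q * (1 + (D.Q * (T.innerCost + 2) + 2 + 1) + 2) + 2

theorem Correct.congr {br br' tab tab' : ℕ → ℕ} {e : ℕ} (h : T.Correct D anc br tab e)
    (hbr : br' = br) (htab : ∀ x, e * (D.Q * D.Q) ≤ x → x < (e + 1) * (D.Q * D.Q) → tab' x = tab x) :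
    T.Correct D anc br' tab' e := by
  subst hbr
  intro a ha b hb x hx
  rw [htab _ (by omega) ?_]
  · exact h a ha b hb x hx
  · have : a * D.Q + b < D.Q * D.Q := by nlinarith
    rw [add_mul]; omega

namespace Good
variable (G : T.Good I D anc rk) (Bd : T.Bounds D A V)
include G

local notation "lo'" => T.lo anc D.R D.B

/-- The split node lies in the component and is not one of its boundary nodes, so summing over its
state does not disturb them. -/
theorem fits_update {p : ℕ} (hp : p < T.N) {br : ℕ → ℕ} {a b y : ℕ} {x : ℕ → ℕ}
    (h : T.Fits D br p a b x) : T.Fits D br p a b (Function.update x (D.U p) y) := by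
  refine ⟨fun h1 => ?_, fun h1 => ?_⟩
  · rw [Function.update_of_ne (G.top_ne hp), h.1 h1]
  · rw [Function.update_of_ne (G.bot_ne hp), h.2 h1]

theorem partial_congr {p k : ℕ} (hp : p < T.N) {br br' tab : ℕ → ℕ}
    (h : T.Partial D anc br tab p k) (hbr : ∀ t, t ≠ D.U p → br' t = br t) :
    T.Partial D anc br' tab p k := fun i hi x hx =>
  h i hi x ⟨fun h1 => by rw [← hbr _ (G.top_ne hp), hx.1 h1],
    fun h1 => by rw [← hbr _ (G.bot_ne hp), hx.2 h1]⟩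

/-- `Y` blocks of `Q` states exhaust the range of the sum over the split node in `partSum_split`. -/
theorem partial_correct {p : ℕ} (hp : p < T.N) {br tab : ℕ → ℕ}
    (h : T.Partial D anc br tab p (D.Y * D.Q)) : T.Correct D anc br tab p := by
  intro a ha b hb x hx
  have h1 : (a * D.Q + b) / D.Q = a := by
    rw [mul_comm, Nat.mul_add_div G.Q_pos, Nat.div_eq_of_lt hb, add_zero]
  have h2 : (a * D.Q + b) % D.Q = b := by
    rw [mul_comm, Nat.mul_add_mod, Nat.mod_eq_of_lt hb]
  rw [h (a * D.Q + b) (by nlinarith) x (by rw [h1, h2]; exact hx)]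
  simp only [psum]
  rw [G.layout.partSum_split G.rooted hp]

include Bd

theorem wp_combine {σ : St} (hσ : D.Ready σ) {p : ℕ} (hp : p < T.N) (hptr : σ .ptr 0 = p)
    (hcor : ∀ e, Top lo' (lo' p) p e → T.Correct D anc (σ .br) (σ .Tab) e)
    (hpart : σ .br (D.U p) ≠ 0 → T.Partial D anc (σ .br) (σ .Tab) p (σ .br (D.U p) * D.Q)) :
    WP I A V Code.combine σ (T.combineCost D) fun τ =>
      T.Partial D anc (σ .br) (τ .Tab) p ((σ .br (D.U p) + 1) * D.Q) ∧
      ∀ x, x < p * (D.Q * D.Q) ∨ (p + 1) * (D.Q * D.Q) ≤ x → τ .Tab x = σ .Tab x := by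
  have hA : 0 < A := by have := Bd.N_A; omega
  have hQ := G.Q_pos
  have hQV : D.Q < V := lt_of_le_of_lt (Nat.le_mul_self _) Bd.QQ_V
  have hpQ : (p + 1) * (D.Q * D.Q) ≤ A := (Nat.mul_le_mul_right _ hp).trans Bd.A_tab
  set F := T.localWeight D.R D.B (ZMod D.M) D.par D.U p * T.psum D (lo' p) p with hF
  -- The states below `(br + 1) * Q` are those of the earlier rounds and the block of the current
  -- high part.
  have hsplit : ∀ k x, sumAt ((σ .br (D.U p)) * D.Q + k) (D.U p) F x =
      sumAt (σ .br (D.U p) * D.Q) (D.U p) F x + ∑ j ∈ Finset.range k,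
        F (Function.update x (D.U p) (σ .br (D.U p) * D.Q + j)) := fun k x =>
    Finset.sum_range_add _ _ _
  refine (WP.for (n := D.Q * D.Q) (C := 1 + (D.Q * (T.innerCost + 2) + 2 + 1)) (fun k τ =>
    (∀ x, x < p * (D.Q * D.Q) ∨ p * (D.Q * D.Q) + k ≤ x → τ .Tab x = σ .Tab x) ∧
    ∀ i < k, ∀ x, T.Fits D (σ .br) p (i / D.Q) (i % D.Q) x →
      (τ .Tab (p * (D.Q * D.Q) + i) : ZMod D.M) =
        sumAt ((σ .br (D.U p) + 1) * D.Q) (D.U p) F x)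
    hA Bd.QQ_V (by simp [Code.writes_inner]) ?_ ?_ ?_).mono le_rfl ?_
  · intro τ h1
    simp only [AExpr.eval_mul, Code.eval_rd]
    rw [h1 .Q (by simp [Code.writes_inner]) (by decide), hσ.Q]
  · exact ⟨fun x _ => by rw [St.upd_ne _ (by decide)], fun i hi => absurd hi (by omega)⟩
  · rintro i hi τ h1 h2 ⟨h3, h4⟩
    have h1' : ∀ b : Arr, b ≠ .f → b ≠ .v → b ≠ .t → b ≠ .sg → b ≠ .pr → b ≠ .e → b ≠ .acc →
        b ≠ .i → b ≠ .j → b ≠ .Tab → τ b = σ b := fun b k1 k2 k3 k4 k5 k6 k7 k8 k9 k10 =>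
      h1 b (by simp [Code.writes_inner, *]) k8
    have hτ : D.Ready τ := hσ.mono fun b k1 k2 k3 k4 k5 k6 k7 k8 k9 k10 _ _ =>
      h1' b k1 k2 k3 k4 k5 k6 k7 k8 k9 k10
    have bτ : τ .br = σ .br := h1' _ (by decide) (by decide) (by decide) (by decide) (by decide)
      (by decide) (by decide) (by decide) (by decide) (by decide)
    have pτ : τ .ptr = σ .ptr := h1' _ (by decide) (by decide) (by decide) (by decide) (by decide)
      (by decide) (by decide) (by decide) (by decide) (by decide)
    have cτ : ∀ e, Top lo' (lo' p) p e → T.Correct D anc (σ .br) (τ .Tab) e := fun e he => by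
      refine (hcor e he).congr rfl fun x _ hx => h3 x (Or.inl ?_)
      have := (he.bounds (G.layout.chain p hp)).2.2
      exact hx.trans_le (Nat.mul_le_mul_right _ this)
    refine WP.seq (WP.set (by simpa using hA) (by simp; omega) ?_)
    set τ0 := τ.upd .acc (AExpr.eval I τ 0) (AExpr.eval I τ 0) with hτ0
    have f0 : ∀ b, b ≠ .acc → τ0 b = τ b := fun b hb => St.upd_ne _ hb _ _
    refine WP.seq ((WP.for (n := D.Q) (C := T.innerCost) (fun k υ =>
      ∀ x, T.Fits D (σ .br) p (i / D.Q) (i % D.Q) x → (υ .acc 0 : ZMod D.M) =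
        ∑ j ∈ Finset.range k, F (Function.update x (D.U p) (σ .br (D.U p) * D.Q + j)))
      hA hQV (by simp [Code.writes_inner]) ?_ ?_ ?_).mono le_rfl ?_)
    · intro υ k1
      simp only [Code.eval_rd]
      rw [k1 .Q (by simp [Code.writes_inner]) (by decide), f0 .Q (by decide), hτ.Q]
    · intro x _
      rw [St.upd_ne _ (by decide), hτ0]
      simp
    · intro k hk υ k1 k2 k3
      have k1' : ∀ b : Arr, b ≠ .f → b ≠ .v → b ≠ .t → b ≠ .sg → b ≠ .pr → b ≠ .e → b ≠ .acc →
          b ≠ .j → υ b = τ b := fun b q1 q2 q3 q4 q5 q6 q7 q8 => by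
        rw [k1 b (by simp [Code.writes_inner, *]) q8, f0 b q7]
      have hυ : D.Ready υ := hτ.mono fun b q1 q2 q3 q4 q5 q6 q7 _ q9 _ _ _ =>
        k1' b q1 q2 q3 q4 q5 q6 q7 q9
      have bυ : υ .br = σ .br := by
        rw [k1' _ (by decide) (by decide) (by decide) (by decide) (by decide) (by decide)
          (by decide) (by decide), bτ]
      have pυ : υ .ptr = σ .ptr := by
        rw [k1' _ (by decide) (by decide) (by decide) (by decide) (by decide) (by decide)
          (by decide) (by decide), pτ]
      have tυ : υ .Tab = τ .Tab := k1' _ (by decide) (by decide) (by decide) (by decide)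
        (by decide) (by decide) (by decide) (by decide)
      have iυ : υ .i = τ .i := k1' _ (by decide) (by decide) (by decide) (by decide)
        (by decide) (by decide) (by decide) (by decide)
      refine (G.wp_inner Bd hυ hp (by rw [pυ, hptr]) (by rw [iυ, h2]; exact hi) (by rw [k2]; exact hk)
        (by rw [bυ, tυ]; exact cτ)).mono le_rfl fun ω hω x hx => ?_
      rw [bυ, iυ, h2, k2] at hω
      rw [St.upd_ne _ (by decide), hω (Function.update x (D.U p) (σ .br (D.U p) * D.Q + k))
        (by rw [Function.update_self]) (G.fits_update hp hx), k3 x hx, Finset.sum_range_succ, hF]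
      rfl
    · rintro υ ⟨k1, k2, -⟩
      have k2' : ∀ b : Arr, b ≠ .f → b ≠ .v → b ≠ .t → b ≠ .sg → b ≠ .pr → b ≠ .e → b ≠ .acc →
          b ≠ .j → υ b = τ b := fun b q1 q2 q3 q4 q5 q6 q7 q8 => by
        rw [k2 b (by simp [Code.writes_inner, *]) q8, f0 b q7]
      have hυ : D.Ready υ := hτ.mono fun b q1 q2 q3 q4 q5 q6 q7 _ q9 _ _ _ =>
        k2' b q1 q2 q3 q4 q5 q6 q7 q9
      have bυ : υ .br = σ .br := by
        rw [k2' _ (by decide) (by decide) (by decide) (by decide) (by decide) (by decide)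
          (by decide) (by decide), bτ]
      have pυ : υ .ptr = σ .ptr := by
        rw [k2' _ (by decide) (by decide) (by decide) (by decide) (by decide) (by decide)
          (by decide) (by decide), pτ]
      have tυ : υ .Tab = τ .Tab := k2' _ (by decide) (by decide) (by decide) (by decide)
        (by decide) (by decide) (by decide) (by decide)
      have iυ : υ .i = τ .i := k2' _ (by decide) (by decide) (by decide) (by decide)
        (by decide) (by decide) (by decide) (by decide)
      have hidx : Code.tabE.eval I υ = p * (D.Q * D.Q) + i := by
        rw [Code.eval_tabE, hυ.Q, pυ, hptr, iυ, h2]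
      have hval : (AExpr.mod (AExpr.nz (.arr .br Code.u) * .arr .Tab Code.tabE + Code.rd .acc)
          (Code.rd .M)).eval I υ = ((if σ .br (D.U p) = 0 then 0 else 1) *
            σ .Tab (p * (D.Q * D.Q) + i) + υ .acc 0) % D.M := by
        simp only [AExpr.eval_mod, AExpr.eval_add, AExpr.eval_mul, AExpr.eval_nz, AExpr.eval_arr,
          Code.eval_rd, Code.eval_u, hidx, hυ.M, hυ.U, bυ, pυ, hptr, tυ, h3 _ (Or.inr le_rfl)]
      refine WP.set ?_ ?_ ?_
      · rw [hidx]; rw [add_mul] at hpQ; omega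
      · rw [hval]; exact (Nat.mod_lt _ G.M_pos).trans_le Bd.M_V
      rw [hidx, hval]
      have hupd : ∀ (s : St) (v y : ℕ), y ≠ p * (D.Q * D.Q) + i →
          (s.upd .Tab (p * (D.Q * D.Q) + i) v) .Tab y = s .Tab y := fun s v y hy => by
        simp [St.upd, hy]
      refine ⟨fun y hy => ?_, fun i' hi' x hx => ?_⟩
      · rw [St.upd_ne _ (by decide), hupd _ _ _ (by omega), tυ, h3 y (by omega)]
      · rw [St.upd_ne _ (by decide)]
        rcases Nat.lt_succ_iff_lt_or_eq.1 hi' with h5 | rfl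
        · rw [hupd _ _ _ (by omega), tυ, h4 i' h5 x hx]
        · rw [St.upd_same, ZMod.natCast_mod, Nat.cast_add, Nat.cast_mul, k1 x hx, add_mul, one_mul,
            hsplit]
          congr 1
          -- In the first round nothing is known about the old entry, which is multiplied by 0;
          -- later it is the partial sum of the earlier blocks.
          by_cases h6 : σ .br (D.U p) = 0
          · rw [if_pos h6, h6]; simp [sumAt]
          · rw [if_neg h6, hpart h6 i' hi x hx]; simp [hF]
  · rintro τ ⟨⟨h1, h2⟩, -⟩
    exact ⟨fun i hi x hx => h2 i hi x hx, fun x hx => h1 x (by rw [add_mul] at hx; omega)⟩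

/-- The program is in the main loop at the position `p`, and everything outside `[l, h)` is as in
`σ`. -/
structure _root_.WidthSat.Inst.Step (D : Tables) (σ τ : St) (l p h : ℕ) : Prop where
  ready : D.Ready τ
  ptr : τ .ptr 0 = p
  br : τ .br = σ .br
  tab : ∀ x, x < l * (D.Q * D.Q) ∨ h * (D.Q * D.Q) ≤ x → τ .Tab x = σ .Tab x

/-- One round of the main loop. -/
theorem wp_round {σ : St} (hσ : D.Ready σ) {p : ℕ} (hp : p < T.N) (hptr : σ .ptr 0 = p)
    (hcor : ∀ e, Top lo' (lo' p) p e → T.Correct D anc (σ .br) (σ .Tab) e)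
    (hpart : σ .br (D.U p) ≠ 0 → T.Partial D anc (σ .br) (σ .Tab) p (σ .br (D.U p) * D.Q))
    (hY : σ .br (D.U p) < D.Y) {C : ℕ} {post : St → Prop}
    (hcont : ∀ τ, D.Ready τ → (∀ x, x < p * (D.Q * D.Q) ∨ (p + 1) * (D.Q * D.Q) ≤ x →
        τ .Tab x = σ .Tab x) →
      T.Partial D anc (σ .br) (τ .Tab) p ((σ .br (D.U p) + 1) * D.Q) →
      τ .ptr 0 = (if σ .br (D.U p) + 1 = D.Y then p + 1 else lo' p) →
      τ .br = Function.update (σ .br) (D.U p)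
        (if σ .br (D.U p) + 1 = D.Y then 0 else σ .br (D.U p) + 1) →
      WP I A V Code.mainLoop τ C post) :
    WP I A V Code.mainLoop σ (T.combineCost D + 4 + C) post := by
  have hA : 0 < A := by have := Bd.N_A; omega
  have hU := G.layout.U_lt G.rooted hp
  have hNA := Bd.N_A
  have hNV := Bd.N_V
  have hYV := Bd.Y_V
  have hlo := G.layout.lo_le hp
  have hupd : ∀ (τ : St) (v : ℕ), (τ.upd .br (D.U p) v) .br = Function.update (τ .br) (D.U p) v := by
    intro τ v; funext y; by_cases hy : y = D.U p <;> simp [St.upd, hy]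
  refine (WP.loop_step (C := T.combineCost D + (1 + 1 + 1)) (C' := C) ?_ (WP.seq
    ((G.wp_combine Bd hσ hp hptr hcor hpart).frame.mono le_rfl fun τ ⟨⟨h1, h2⟩, h3⟩ => ?_))).mono
    (by omega) fun _ h => h
  · simp only [AExpr.eval_sub, Code.eval_NE, Code.eval_p]
    rw [G.reads.N, hptr]; omega
  have hτ : D.Ready τ := hσ.mono fun b k1 k2 k3 k4 k5 k6 k7 k8 k9 k10 _ _ =>
    h3 b (by simp [Code.writes_combine, *])
  have bτ : τ .br = σ .br := h3 _ (by simp [Code.writes_combine])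
  have pτ : τ .ptr = σ .ptr := h3 _ (by simp [Code.writes_combine])
  have hc : (AExpr.eq (.arr .br Code.u + 1) (Code.rd .Y)).eval I τ =
      if σ .br (D.U p) + 1 = D.Y then 1 else 0 := by
    simp only [AExpr.eval_eq, AExpr.eval_add, AExpr.eval_arr, Code.eval_u, Code.eval_rd,
      AExpr.eval_ofNat, hτ.Y, hτ.U, bτ, pτ, hptr]
  refine WP.ite (fun h4 => ?_) (fun h4 => ?_)
  · have h5 : σ .br (D.U p) + 1 = D.Y := by
      by_contra h5; exact h4 (hc.trans (if_neg h5))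
    simp only [if_pos h5] at hcont
    refine WP.seq (WP.set ?_ (by simp; omega) (WP.set (by simpa using hA) ?_ ?_))
    · simp only [Code.eval_u]; rw [hτ.U, pτ, hptr]; omega
    · simp only [AExpr.eval_add, Code.eval_p, AExpr.eval_ofNat]
      rw [St.upd_ne _ (by decide), pτ, hptr]; omega
    · simp only [AExpr.eval_add, Code.eval_p, AExpr.eval_ofNat, Code.eval_u]
      rw [St.upd_ne _ (show Arr.ptr ≠ Arr.br by decide), hτ.U, pτ, hptr]
      refine hcont _ (hτ.mono ?_) ?_ ?_ ?_ ?_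
      · intro b _ _ _ _ _ _ _ _ _ _ k1 k2
        rw [St.upd_ne _ k2, St.upd_ne _ k1]
      · rw [St.upd_ne _ (by decide), St.upd_ne _ (by decide)]; exact h2
      · rw [St.upd_ne _ (by decide), St.upd_ne _ (by decide)]; exact h1
      · rw [St.upd_same]
      · rw [St.upd_ne _ (by decide), hupd, bτ]
  · have h5 : ¬ σ .br (D.U p) + 1 = D.Y := by
      intro h5; rw [hc, if_pos h5] at h4; omega
    simp only [if_neg h5] at hcont
    refine WP.seq (WP.set ?_ ?_ (WP.set (by simpa using hA) ?_ ?_))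
    · simp only [Code.eval_u]; rw [hτ.U, pτ, hptr]; omega
    · simp only [AExpr.eval_add, AExpr.eval_arr, AExpr.eval_ofNat, Code.eval_u]
      rw [hτ.U, pτ, hptr, bτ]; omega
    · simp only [Code.eval_loE, Code.eval_p]
      rw [St.upd_ne _ (show Arr.ptr ≠ Arr.br by decide), St.upd_ne _ (show Arr.sz ≠ Arr.br by decide),
        St.upd_ne _ (show Arr.R ≠ Arr.br by decide), St.upd_ne _ (show Arr.B ≠ Arr.br by decide),
        hτ.sz, hτ.R, hτ.B, pτ, hptr, G.lo_eval hp]; omega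
    · simp only [Code.eval_loE, Code.eval_p, AExpr.eval_add, AExpr.eval_arr, AExpr.eval_ofNat,
        Code.eval_u]
      rw [St.upd_ne _ (show Arr.ptr ≠ Arr.br by decide), St.upd_ne _ (show Arr.sz ≠ Arr.br by decide),
        St.upd_ne _ (show Arr.R ≠ Arr.br by decide), St.upd_ne _ (show Arr.B ≠ Arr.br by decide),
        hτ.sz, hτ.R, hτ.B, hτ.U, pτ, hptr, bτ, G.lo_eval hp]
      refine hcont _ (hτ.mono ?_) ?_ ?_ ?_ ?_
      · intro b _ _ _ _ _ _ _ _ _ _ k1 k2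
        rw [St.upd_ne _ k2, St.upd_ne _ k1]
      · rw [St.upd_ne _ (by decide), St.upd_ne _ (by decide)]; exact h2
      · rw [St.upd_ne _ (by decide), St.upd_ne _ (by decide)]; exact h1
      · rw [St.upd_same]
      · rw [St.upd_ne _ (by decide), hupd, bτ]

/-- The cost of one round of the main loop. -/
def _root_.WidthSat.Inst.roundCost (T : Inst) (D : Tables) : ℕ := T.combineCost D + 4

/-- From a state in which the component at `p` has to be treated, the main loop completes its
table. -/
theorem wp_component {p : ℕ} (hp : p < T.N) : ∀ {d : ℕ}, T.Small anc d (D.R p) (D.B p) →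
    ∀ {σ : St}, D.Ready σ → σ .ptr 0 = lo' p → (∀ e, lo' p ≤ e → e ≤ p → σ .br (D.U e) = 0) →
    ∀ {C : ℕ} {post : St → Prop},
    (∀ τ, Step D σ τ (lo' p) (p + 1) (p + 1) → T.Correct D anc (τ .br) (τ .Tab) p →
      WP I A V Code.mainLoop τ C post) →
    WP I A V Code.mainLoop σ ((p + 1 - lo' p) * D.Y ^ d * T.roundCost D + C) post := by
  -- The whole recursion is one while-loop, so a call is not a separate run. Hence the continuation
  -- form: if the loop needs at most `C` steps once the table of `p` is complete, this bounds what
  -- it needs from now on. Calls are then chained by choosing `C`.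
  induction p using Nat.strong_induction_on with
  | _ p ih =>
  intro d hd σ hσ hptr hbr C post hcont
  have hv := G.layout.valid p hp
  have hs := G.layout.split p hp
  have hlo := G.layout.lo_le hp
  have hYpos := G.Y_pos
  obtain ⟨d, rfl⟩ := Nat.exists_eq_succ_of_ne_zero (G.rooted.small_pos hv hd)
  set κ := T.roundCost D with hκ
  -- the children
  have list : ∀ h, Chain lo' (lo' p) h → h ≤ p → (∀ e, Top lo' (lo' p) h e → Top lo' (lo' p) p e) →
      ∀ {σ : St}, D.Ready σ → σ .ptr 0 = lo' p →
      (∀ e, lo' p ≤ e → e < p → σ .br (D.U e) = 0) → ∀ {C : ℕ} {post : St → Prop},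
      (∀ τ, Step D σ τ (lo' p) h h →
        (∀ e, Top lo' (lo' p) h e → T.Correct D anc (τ .br) (τ .Tab) e) →
        WP I A V Code.mainLoop τ C post) →
      WP I A V Code.mainLoop σ ((h - lo' p) * D.Y ^ d * κ + C) post := by
    intro h hc
    induction hc with
    | nil =>
      intro _ _ σ hσ hptr _ C post hcont
      refine (hcont σ ⟨hσ, hptr, rfl, fun _ _ => rfl⟩ fun e he => absurd he Top.not_self).mono
        (by simp) fun _ h => h
    | @cons e he hc ihc =>
      intro hep htop σ hσ hptr hbr C post hcont
      have hle := hc.le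
      have hte := htop e (.head (by omega))
      have htop' : ∀ e', Top lo' (lo' p) (lo' e) e' → Top lo' (lo' p) p e' := fun e' h' =>
        htop e' (.tail (by omega) h')
      -- The continuation of the earlier pieces is the last piece followed by the given
      -- continuation. Costs are proportional to lengths of intervals, so they add up.
      refine (ihc (by omega) htop' hσ hptr hbr
        (C := (e + 1 - lo' e) * D.Y ^ d * κ + C) fun τ h1 h2 => ?_).mono ?_ fun _ h => h
      · refine ih e (by omega) (by omega)
          (G.rooted.small_piece hv hs (G.layout.piece p hp e hte) hd) h1.ready h1.ptr
          (fun e' h3 h4 => by rw [h1.br]; exact hbr e' (by omega) (by omega)) fun υ h3 h4 => ?_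
        refine hcont υ ⟨h3.ready, h3.ptr, h3.br.trans h1.br, fun x hx => ?_⟩ fun e' he' => ?_
        · have k1 : lo' p * (D.Q * D.Q) ≤ lo' e * (D.Q * D.Q) := by gcongr
          have k2 : lo' e * (D.Q * D.Q) ≤ (e + 1) * (D.Q * D.Q) :=
            Nat.mul_le_mul_right _ (by omega)
          rw [h3.tab x (by omega), h1.tab x (by omega)]
        · rcases (Top.succ_iff (by omega)).1 he' with rfl | he'
          · exact h4
          -- The tables of the earlier pieces survive: the run on the last piece writes only in its
          -- own interval and leaves `br` as it was.
          · refine (h2 e' he').congr h3.br fun x _ hx => h3.tab x (Or.inl (hx.trans_le ?_))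
            exact Nat.mul_le_mul_right _ (he'.bounds hc).2.2
      · rw [← add_assoc, ← add_mul, ← add_mul]
        gcongr
        omega
  -- the rounds
  have rounds : ∀ k σ', D.Ready σ' → σ' .ptr 0 = lo' p →
      (∀ t, t ≠ D.U p → σ' .br t = σ .br t) →
      (∀ x, x < lo' p * (D.Q * D.Q) ∨ (p + 1) * (D.Q * D.Q) ≤ x → σ' .Tab x = σ .Tab x) →
      (σ' .br (D.U p) ≠ 0 → T.Partial D anc (σ' .br) (σ' .Tab) p (σ' .br (D.U p) * D.Q)) →
      σ' .br (D.U p) < D.Y → D.Y - σ' .br (D.U p) = k →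
      WP I A V Code.mainLoop σ' (k * ((p - lo' p) * D.Y ^ d * κ + κ) + C) post := by
    intro k
    induction k with
    | zero => intro σ' _ _ _ _ _ h1 h2; omega
    | succ k ihk =>
      intro σ' hσ' hptr' hbr' htab' hpart' hlt hk
      have hbrU : ∀ e, lo' p ≤ e → e < p → σ' .br (D.U e) = 0 := fun e h1 h2 => by
        rw [hbr' _ (fun h3 => by
          have := G.layout.U_inj G.rooted e (by omega) p hp h3; omega)]
        exact hbr e h1 h2.le
      refine (list p (G.layout.chain p hp) le_rfl (fun _ h => h) hσ' hptr' hbrU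
        (C := κ + (k * ((p - lo' p) * D.Y ^ d * κ + κ) + C)) fun τ h1 h2 => ?_).mono
        (by rw [Nat.succ_mul]; omega) fun _ h => h
      have hlp : lo' p * (D.Q * D.Q) ≤ p * (D.Q * D.Q) := by gcongr
      have hp1 : p * (D.Q * D.Q) ≤ (p + 1) * (D.Q * D.Q) := Nat.mul_le_mul_right _ (by omega)
      refine G.wp_round Bd h1.ready hp h1.ptr h2 ?_ (by rw [h1.br]; exact hlt) ?_
      · rw [h1.br]
        intro h3 i hi x hx
        rw [h1.tab _ (by omega)]
        exact hpart' h3 i hi x hx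
      · intro υ hυ h3 h4 h5 h6
        rw [h1.br] at h4 h5 h6
        have htabυ : ∀ x, x < lo' p * (D.Q * D.Q) ∨ (p + 1) * (D.Q * D.Q) ≤ x →
            υ .Tab x = σ .Tab x := fun x hx => by
          rw [h3 x (by omega), h1.tab x (by omega), htab' x hx]
        have h4' : T.Partial D anc (υ .br) (υ .Tab) p ((σ' .br (D.U p) + 1) * D.Q) :=
          G.partial_congr hp h4 fun t ht => by rw [h6, Function.update_of_ne ht]
        by_cases h7 : σ' .br (D.U p) + 1 = D.Y
        · rw [if_pos h7] at h5 h6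
          refine (hcont υ ⟨hυ, h5, ?_, htabυ⟩ (G.partial_correct hp (by rw [← h7]; exact h4'))).mono
            (by omega) fun _ h => h
          -- The last round resets the high part of the split node to 0, so `br` is again as at the
          -- start; a later recomputation may thus begin in the same way.
          funext t
          rw [h6]
          by_cases ht : t = D.U p
          · rw [ht, Function.update_self, hbr p hlo le_rfl]
          · rw [Function.update_of_ne ht, hbr' t ht]
        · rw [if_neg h7] at h5 h6
          have h8 : υ .br (D.U p) = σ' .br (D.U p) + 1 := by rw [h6, Function.update_self]
          refine ihk υ hυ h5 (fun t ht => ?_) htabυ (fun _ => ?_) (by omega) (by omega)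
          · rw [h6, Function.update_of_ne ht, hbr' t ht]
          · rw [h8]; exact h4'
  have h0 := hbr p hlo le_rfl
  refine (rounds D.Y σ hσ hptr (fun _ _ => rfl) (fun _ _ => rfl) (fun h => absurd h0 h)
    (by omega) (by omega)).mono ?_ fun _ h => h
  have h1 : 1 ≤ D.Y ^ d := Nat.one_le_pow _ _ hYpos
  -- `Y` rounds, each with the pieces at depth `d` and one pass over the own table.
  have h2 : D.Y * ((p - lo' p) * D.Y ^ d * κ + κ) ≤ (p + 1 - lo' p) * D.Y ^ (d + 1) * κ := by
    calc D.Y * ((p - lo' p) * D.Y ^ d * κ + κ) = D.Y * κ * ((p - lo' p) * D.Y ^ d + 1) := by ring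
      _ ≤ D.Y * κ * ((p - lo' p) * D.Y ^ d + D.Y ^ d) := by gcongr
      _ = (p - lo' p + 1) * D.Y ^ (d + 1) * κ := by ring
      _ = (p + 1 - lo' p) * D.Y ^ (d + 1) * κ := by rw [Nat.sub_add_comm hlo]
  exact Nat.add_le_add_right h2 C

/-- The main loop computes the number of satisfying assignments modulo `M`. -/
theorem wp_mainLoop {d : ℕ} (hd : T.Small anc d 0 T.N) {σ : St} (hσ : D.Ready σ)
    (hptr : σ .ptr 0 = 0) (hbr : ∀ t < T.N, σ .br t = 0) :
    WP I A V Code.mainLoop σ (T.N * D.Y ^ d * T.roundCost D + 1) fun τ =>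
      D.Ready τ ∧ (τ .Tab ((T.N - 1) * (D.Q * D.Q)) : ZMod D.M) = T.models.card := by
  have hN := T.N_pos
  have hlo := G.layout.lo_top G.rooted
  refine (G.wp_component Bd (p := T.N - 1) (by omega) (d := d)
    (by rw [G.layout.top_root, G.layout.top_bot]; exact hd)
    hσ (by rw [hlo, hptr]) (fun e _ he => hbr _ (G.layout.U_lt G.rooted (by omega))) (C := 1)
    fun τ h1 h2 => WP.loop_exit ?_ ⟨h1.ready, ?_⟩).mono
    (by rw [hlo]; gcongr; omega) fun _ h => h
  · simp only [AExpr.eval_sub, Code.eval_NE, Code.eval_p]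
    rw [G.reads.N, h1.ptr]; omega
  -- The whole tree has no boundary nodes, so any point fits and the entry for `a = b = 0` holds the
  -- result.
  · have h3 := h2 0 G.Q_pos 0 G.Q_pos (fun t => τ .br t * D.Q) ⟨fun _ => rfl, fun _ => rfl⟩
    rw [zero_mul, zero_add, add_zero] at h3
    rw [h3]
    exact G.layout.partSum_top G.rooted G.le _

end Good
end Inst

theorem mul_add_inj {k a b x y : ℕ} (hx : x < k) (hy : y < k) (h : a * k + x = b * k + y) :
    a = b ∧ x = y := by
  have h1 : (a * k + x) / k = (b * k + y) / k := by rw [h]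
  have h2 : (a * k + x) % k = (b * k + y) % k := by rw [h]
  have hk : 0 < k := by omega
  rw [mul_comm a, mul_comm b, Nat.mul_add_div hk, Nat.mul_add_div hk, Nat.div_eq_of_lt hx,
    Nat.div_eq_of_lt hy] at h1
  rw [mul_comm a, mul_comm b, Nat.mul_add_mod, Nat.mul_add_mod, Nat.mod_eq_of_lt hx,
    Nat.mod_eq_of_lt hy] at h2
  exact ⟨by omega, h2⟩

theorem mul_add_lt {k l a x : ℕ} (ha : a < l) (hx : x < k) : a * k + x < l * k := by
  have : (a + 1) * k ≤ l * k := Nat.mul_le_mul_right k ha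
  rw [add_mul] at this
  omega

theorem St.upd_of_ne (σ : St) (a : Arr) {x y : ℕ} (h : y ≠ x) (v : ℕ) : σ.upd a x v a y = σ a y := by
  simp [St.upd, h]

namespace Inst
open Classical

/-! ## Rooting the tree -/

/-- The part of the tree that consists of the nodes `t` with `anc t t` is rooted. -/
structure Partly (T : Inst) (par : ℕ → ℕ) (anc : ℕ → ℕ → Prop) (rk : ℕ → ℕ) : Prop where
  par_zero : par 0 = T.N
  adj_par : ∀ {t}, t ≠ 0 → anc t t → T.adj (par t) t
  anc_par : ∀ {t}, t ≠ 0 → anc t t → anc (par t) (par t)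
  anc_zero : ∀ {a}, anc a 0 ↔ a = 0
  anc_step : ∀ {a t}, t ≠ 0 → anc t t → (anc a t ↔ a = t ∨ anc a (par t))
  anc_right : ∀ {a t}, anc a t → anc t t
  anc_lt : ∀ {a t}, anc a t → t < T.N
  rk_lt : ∀ {t}, t ≠ 0 → anc t t → rk (par t) < rk t

variable {T : Inst} {par : ℕ → ℕ} {anc : ℕ → ℕ → Prop} {rk : ℕ → ℕ}

theorem partly_root (h : par 0 = T.N) : T.Partly par (fun a t => a = 0 ∧ t = 0) fun _ => 0 where
  par_zero := h
  adj_par h0 h1 := absurd h1.1 h0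
  anc_par h0 h1 := absurd h1.1 h0
  anc_zero := by simp
  anc_step h0 h1 := absurd h1.1 h0
  anc_right h1 := ⟨h1.2, h1.2⟩
  anc_lt h1 := h1.2 ▸ T.N_pos
  rk_lt h0 h1 := absurd h1.1 h0

/-- The ancestors after `t` has been added as a child of `s`. -/
def addChild (anc : ℕ → ℕ → Prop) (s t : ℕ) : ℕ → ℕ → Prop := fun a x =>
  if x = t then a = t ∨ anc a s else anc a x

theorem Partly.extend (h : T.Partly par anc rk) {s t : ℕ} (hs : anc s s) (ht : ¬ anc t t)
    (hst : T.adj s t) :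
    T.Partly (Function.update par t s) (addChild anc s t) (Function.update rk t (rk s + 1)) := by
  have ht0 : t ≠ 0 := fun h0 => ht (h0 ▸ h.anc_zero.2 rfl)
  have hne : s ≠ t := fun h0 => ht (h0 ▸ hs)
  have old : ∀ {x}, x ≠ t → (addChild anc s t x x ↔ anc x x) := fun hx => by
    rw [addChild, if_neg hx]
  have hpar : ∀ {x}, x ≠ 0 → x ≠ t → anc x x → par x ≠ t := fun h0 h1 h2 h3 =>
    ht (h3 ▸ h.anc_par h0 h2)
  constructor
  · rw [Function.update_of_ne ht0.symm, h.par_zero]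
  · intro x h0 h1
    by_cases hx : x = t
    · subst hx; rwa [Function.update_self]
    · rw [Function.update_of_ne hx]; exact h.adj_par h0 ((old hx).1 h1)
  · intro x h0 h1
    by_cases hx : x = t
    · subst hx; rw [Function.update_self]; exact (old hne).2 hs
    · rw [Function.update_of_ne hx]
      have h2 := (old hx).1 h1
      exact (old (hpar h0 hx h2)).2 (h.anc_par h0 h2)
  · intro a
    rw [addChild, if_neg ht0.symm, h.anc_zero]
  · intro a x h0 h1
    by_cases hx : x = t
    · subst hx
      rw [Function.update_self, addChild, if_pos rfl, addChild, if_neg hne]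
    · rw [Function.update_of_ne hx]
      have h2 := (old hx).1 h1
      rw [addChild, if_neg hx, addChild, if_neg (hpar h0 hx h2)]
      exact h.anc_step h0 h2
  · intro a x h1
    by_cases hx : x = t
    · subst hx; rw [addChild, if_pos rfl]; exact Or.inl rfl
    · rw [addChild, if_neg hx] at h1
      exact (old hx).2 (h.anc_right h1)
  · intro a x h1
    by_cases hx : x = t
    · subst hx; exact T.adj_lt (T.adj_symm hst)
    · rw [addChild, if_neg hx] at h1
      exact h.anc_lt h1
  · intro x h0 h1
    by_cases hx : x = t
    · subst hx; rw [Function.update_self, Function.update_self, Function.update_of_ne hne]; omega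
    · have h2 := (old hx).1 h1
      rw [Function.update_of_ne hx, Function.update_of_ne hx,
        Function.update_of_ne (hpar h0 hx h2)]
      exact h.rk_lt h0 h2

/-- That all edges join a child to its parent follows by counting: the `N - 1` parent edges, taken
in both directions, give `2 * (N - 1)` ordered pairs, which is the number of all ordered adjacent
pairs. -/
theorem Partly.rooted (h : T.Partly par anc rk) (hall : ∀ t < T.N, anc t t) :
    T.Rooted par anc rk where
  par_zero := h.par_zero
  adj_par h0 h1 := h.adj_par h0 (hall _ h1)
  anc_zero := h.anc_zero
  anc_step h0 h1 := h.anc_step h0 (hall _ h1)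
  anc_lt := h.anc_lt
  rk_lt h0 h1 := h.rk_lt h0 (hall _ h1)
  adj_cases := by
    set S := Finset.Ico 1 T.N with hS
    have memS : ∀ {t}, t ∈ S ↔ t ≠ 0 ∧ t < T.N := fun {t} => by simp [hS]; omega
    set E := S.image (fun t => (par t, t)) ∪ S.image (fun t => (t, par t)) with hE
    have hfin : {p : ℕ × ℕ | T.adj p.1 p.2}.Finite :=
      ((Finset.range T.N ×ˢ Finset.range T.N).finite_toSet).subset fun p hp => by
        simpa using ⟨T.adj_lt hp, T.adj_lt (T.adj_symm hp)⟩
    have hsub : (E : Set (ℕ × ℕ)) ⊆ {p | T.adj p.1 p.2} := by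
      intro p hp
      simp only [hE, Finset.coe_union, Finset.coe_image, Set.mem_union, Set.mem_image,
        Finset.mem_coe] at hp
      rcases hp with ⟨t, ht, rfl⟩ | ⟨t, ht, rfl⟩
      · exact h.adj_par (memS.1 ht).1 (hall _ (memS.1 ht).2)
      · exact T.adj_symm (h.adj_par (memS.1 ht).1 (hall _ (memS.1 ht).2))
    have hcard : E.card = 2 * (T.N - 1) := by
      rw [hE, Finset.card_union_of_disjoint, Finset.card_image_of_injOn, Finset.card_image_of_injOn,
        hS, Nat.card_Ico]
      · ring
      · intro a _ b _ hab; exact (Prod.mk.inj hab).1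
      · intro a _ b _ hab; exact (Prod.mk.inj hab).2
      -- A pair that occurs in both directions would make the rank increase both ways.
      · rw [Finset.disjoint_left]
        intro p hp hp'
        obtain ⟨t, ht, rfl⟩ := Finset.mem_image.1 hp
        obtain ⟨t', ht', h1⟩ := Finset.mem_image.1 hp'
        obtain ⟨h2, h3⟩ := Prod.mk.inj h1
        have h4 := h.rk_lt (memS.1 ht).1 (hall _ (memS.1 ht).2)
        have h5 := h.rk_lt (memS.1 ht').1 (hall _ (memS.1 ht').2)
        rw [h2, h3] at *
        omega
    have heq := Set.eq_of_subset_of_ncard_le hsub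
      (by rw [T.card_adj, Set.ncard_coe_finset, hcard]) hfin
    intro s t hst
    have h1 : (s, t) ∈ (E : Set (ℕ × ℕ)) := by rw [heq]; exact hst
    simp only [hE, Finset.coe_union, Finset.coe_image, Set.mem_union, Set.mem_image,
        Finset.mem_coe, Prod.mk.injEq] at h1
    rcases h1 with ⟨x, hx, h2, h3⟩ | ⟨x, hx, h2, h3⟩
    · left; rw [← h3]; exact ⟨(memS.1 hx).1, h2⟩
    · right; rw [← h2]; exact ⟨(memS.1 hx).1, h3⟩

/-- If not all nodes have been reached, then an edge leaves the set of nodes that have been. -/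
theorem exists_adj {P : ℕ → Prop} (h0 : P 0) {t : ℕ} (ht : t < T.N) (hP : ¬ P t) :
    ∃ s t, P s ∧ ¬ P t ∧ T.adj s t := by
  by_contra! hcon
  have : ∀ x, Relation.ReflTransGen T.adj 0 x → P x := fun x hx => by
    induction hx with
    | refl => exact h0
    | tail _ h2 ih => by_contra h3; exact hcon _ _ ih h3 h2
  exact hP (this t (T.connected t ht))

end Inst

namespace Code
open AExpr

def ancE (a t : AExpr) : AExpr := arr .anc (a * NE + t)
def sE : AExpr := rd .k / NE
def tE : AExpr := mod (rd .k) NE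

/-- The diagonal entry `anc t t` marks that `t` has been reached. A new child `t` of `s` inherits
the column of `s` in the table of ancestors and becomes an ancestor of itself. -/
def rootStep : Cmd := .ite (ancE sE sE * inp (3 + 2 * (mE * nE) + rd .k) * (1 - ancE tE tE))
  (.seq (.set .par tE sE) (.seq (.for .t NE (.set .anc (rd .t * NE + tE) (ancE (rd .t) sE)))
    (.set .anc (tE * NE + tE) 1)))
  (.set .f 0 0)

def rooting : Cmd := .seq (.set .par 0 NE) (.seq (.set .anc 0 1)
  (.for .i NE (.for .k (NE * NE) rootStep)))

theorem writes_rooting {a : Arr} : rooting.writes a ↔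
    a = .par ∨ a = .anc ∨ a = .i ∨ a = .k ∨ a = .t ∨ a = .f := by
  simp [rooting, rootStep]; tauto

@[simp] theorem eval_ancE (I : List ℕ) (σ : St) (a t : AExpr) :
    (ancE a t).eval I σ = σ .anc (a.eval I σ * I.getD 2 0 + t.eval I σ) := rfl

end Code

namespace Inst
open Classical

/-- The bounds for the preparations. -/
structure Room (T : Inst) (A V : ℕ) : Prop where
  NN_A : (T.N + 1) * (T.N + 1) ≤ A
  Nv_A : (T.N + 1) * (T.n + T.m) ≤ A
  NN_V : 8 * ((T.N + 1) * (T.N + 1)) < V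
  Nv_V : (T.N + 1) * (T.n + T.m + 1) < V
  pow_V : 2 ^ (T.n + T.m) < V

variable {T : Inst} {I : List ℕ} {A V : ℕ}

theorem Room.nn_A (h : T.Room A V) : T.N * T.N ≤ A := le_trans (by gcongr <;> omega) h.NN_A
theorem Room.nn_V (h : T.Room A V) : T.N * T.N < V := by
  have := h.NN_V; nlinarith
theorem Room.N_V (h : T.Room A V) : 8 * (T.N + 1) < V := by
  have := h.NN_V; nlinarith
theorem Room.N_A (h : T.Room A V) : T.N < A := by
  have := h.NN_A; nlinarith

/-- The array `tab` is the table of `anc`. -/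
def AncTable (T : Inst) (anc : ℕ → ℕ → Prop) (tab : ℕ → ℕ) : Prop :=
  ∀ a < T.N, ∀ t < T.N, tab (a * T.N + t) = if anc a t then 1 else 0

theorem wp_rootStep (hI : T.Reads I) (hR : T.Room A V) {σ : St} {anc : ℕ → ℕ → Prop} {rk : ℕ → ℕ}
    (h : T.Partly (σ .par) anc rk) (ha : T.AncTable anc (σ .anc)) {s t : ℕ} (hs : s < T.N)
    (ht : t < T.N) (hk : σ .k 0 = s * T.N + t) :
    WP I A V Code.rootStep σ (3 * T.N + 5) fun τ => ∃ anc' rk', T.Partly (τ .par) anc' rk' ∧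
      T.AncTable anc' (τ .anc) ∧ (∀ x, anc x x → anc' x x) ∧ (anc s s → T.adj s t → anc' t t) := by
  have hNA := hR.N_A
  have hNNA := hR.nn_A
  have hNV := hR.N_V
  have hA : 0 < A := by omega
  have es : ∀ τ : St, τ .k = σ .k → Code.sE.eval I τ = s := fun τ hτ => by
    simp only [Code.sE, AExpr.eval_div, Code.eval_rd, Code.eval_NE, hτ, hk, hI.N]
    rw [mul_comm, Nat.mul_add_div (by omega), Nat.div_eq_of_lt ht, add_zero]
  have et : ∀ τ : St, τ .k = σ .k → Code.tE.eval I τ = t := fun τ hτ => by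
    simp only [Code.tE, AExpr.eval_mod, Code.eval_rd, Code.eval_NE, hτ, hk, hI.N]
    rw [mul_comm, Nat.mul_add_mod, Nat.mod_eq_of_lt ht]
  have hcond : (Code.ancE Code.sE Code.sE * .inp (3 + 2 * (Code.mE * Code.nE) + Code.rd .k) *
      (1 - Code.ancE Code.tE Code.tE)).eval I σ ≠ 0 ↔ anc s s ∧ T.adj s t ∧ ¬ anc t t := by
    simp only [AExpr.eval_mul, AExpr.eval_sub, AExpr.eval_ofNat, AExpr.eval_inp, AExpr.eval_add,
      Code.eval_ancE, es σ rfl, et σ rfl, Code.eval_mE, Code.eval_nE, Code.eval_rd, hI.N, hI.n, hI.m,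
      hk, ha s hs s hs, ha t ht t ht, hI.adj s hs t ht]
    by_cases h1 : anc s s <;> by_cases h2 : T.adj s t <;> by_cases h3 : anc t t <;> simp [h1, h2, h3]
  refine (WP.ite (C := 1 + (T.N * (1 + 2) + 2 + 1)) (fun h1 => ?_) (fun h1 => ?_)).mono (by omega)
    fun _ h => h
  · obtain ⟨hss, hst, htt⟩ := hcond.1 h1
    have hne : s ≠ t := fun h0 => htt (h0 ▸ hss)
    refine WP.seq (WP.set (by rw [et σ rfl]; omega) (by rw [es σ rfl]; omega) ?_)
    rw [et σ rfl, es σ rfl]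
    set σ1 := σ.upd .par t s with hσ1
    have p1 : σ1 .par = Function.update (σ .par) t s := by
      funext y; by_cases hy : y = t <;> simp [hσ1, St.upd, hy]
    have k1 : σ1 .k = σ .k := St.upd_ne _ (by decide) _ _
    have a1 : σ1 .anc = σ .anc := St.upd_ne _ (by decide) _ _
    -- Only the column of `t` is overwritten; the column of `s`, from which it is copied, stays
    -- intact as `s ≠ t`.
    refine WP.seq ((WP.for (n := T.N) (C := 1) (fun j τ =>
      ∀ a < T.N, ∀ x < T.N, τ .anc (a * T.N + x) =
        if x = t ∧ a < j then (if anc a s then 1 else 0) else if anc a x then 1 else 0)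
      hA (by omega) (by simp) ?_ ?_ ?_).mono le_rfl ?_)
    · intro τ _; simp only [Code.eval_NE]; exact hI.N
    · intro a ha' x hx
      rw [St.upd_ne _ (by decide), a1, if_neg (by omega)]
      exact ha a ha' x hx
    · intro j hj τ h2 h3 h4
      have hkτ : τ .k = σ .k := by rw [h2 _ (by simp) (by decide), k1]
      have hi1 : (Code.rd .t * Code.NE + Code.tE).eval I τ = j * T.N + t := by
        simp only [AExpr.eval_add, AExpr.eval_mul, Code.eval_rd, h3, Code.eval_NE, hI.N, et τ hkτ]
      have hv1 : (Code.ancE (Code.rd .t) Code.sE).eval I τ = if anc j s then 1 else 0 := by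
        simp only [Code.eval_ancE, Code.eval_rd, h3, hI.N, es τ hkτ]
        rw [h4 j hj s hs, if_neg (by omega)]
      refine WP.set ?_ ?_ ?_
      · rw [hi1]; exact (mul_add_lt hj ht).trans_le hNNA
      · rw [hv1]; split_ifs <;> omega
      · rw [hi1, hv1]
        intro a ha' x hx
        rw [St.upd_ne _ (by decide)]
        by_cases h5 : a = j ∧ x = t
        · obtain ⟨rfl, rfl⟩ := h5
          rw [St.upd_same, if_pos (show x = x ∧ a < a + 1 from ⟨rfl, by omega⟩)]
        · rw [St.upd_of_ne _ _ (fun h6 => h5 (mul_add_inj hx ht h6)), h4 a ha' x hx]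
          have : (x = t ∧ a < j) ↔ (x = t ∧ a < j + 1) := by omega
          simp only [this]
    · rintro τ ⟨h2, h3, -⟩
      have hkτ : τ .k = σ .k := by rw [h3 _ (by simp) (by decide), k1]
      have pτ : τ .par = Function.update (σ .par) t s := by rw [h3 _ (by simp) (by decide), p1]
      have hi1 : (Code.tE * Code.NE + Code.tE).eval I τ = t * T.N + t := by
        simp only [AExpr.eval_add, AExpr.eval_mul, Code.eval_NE, hI.N, et τ hkτ]
      refine WP.set ?_ (by simp; omega) ?_
      · rw [hi1]; exact (mul_add_lt ht ht).trans_le hNNA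
      · rw [hi1, AExpr.eval_ofNat]
        refine ⟨addChild anc s t, Function.update rk t (rk s + 1), ?_, ?_, fun x hx => ?_, fun _ _ => ?_⟩
        · rw [St.upd_ne _ (by decide), pτ]
          exact h.extend hss htt hst
        · intro a ha' x hx
          by_cases h5 : a = t ∧ x = t
          · obtain ⟨rfl, rfl⟩ := h5
            rw [St.upd_same, addChild, if_pos rfl, if_pos (Or.inl rfl)]
          · rw [St.upd_of_ne _ _ (fun h6 => h5 (mul_add_inj hx ht h6)), h2 a ha' x hx, addChild]
            by_cases h6 : x = t
            · rw [if_pos ⟨h6, ha'⟩]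
              have : a ≠ t := fun h7 => h5 ⟨h7, h6⟩
              simp [h6, this]
            · simp [h6]
        · rw [addChild]; split_ifs with h6
          · exact Or.inl h6
          · exact hx
        · rw [addChild, if_pos rfl]; exact Or.inl rfl
  · refine (WP.set (by simpa using hA) (by simp; omega) ?_).mono (show 1 ≤ _ by omega) fun _ h => h
    refine ⟨anc, rk, by rwa [St.upd_ne _ (by decide)], by rwa [St.upd_ne _ (by decide)],
      fun x h => h, fun h2 h3 => ?_⟩
    by_contra h4
    exact hcond.2 ⟨h2, h3, h4⟩ h1

theorem one_le_card_filter {P : ℕ → Prop} (h : P 0) :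
    0 + 1 ≤ ((Finset.range T.N).filter P).card :=
  Finset.card_pos.2 ⟨0, Finset.mem_filter.2 ⟨Finset.mem_range.2 T.N_pos, h⟩⟩

theorem wp_rooting (hI : T.Reads I) (hR : T.Room A V) {σ : St} (hσ : σ .anc = 0) :
    WP I A V Code.rooting σ (T.N * (T.N * T.N * (3 * T.N + 7) + 4) + 4) fun τ => ∃ anc rk,
      T.Rooted (τ .par) anc rk ∧ T.AncTable anc (τ .anc) := by
  have hNA := hR.N_A
  have hNV := hR.N_V
  have hN := T.N_pos
  have hA : 0 < A := by omega
  refine (WP.seq (C := 1) (WP.set (by simpa using hA) (by simp only [Code.eval_NE, hI.N]; omega)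
    (WP.seq (C := 1) (WP.set (by simpa using hA) (by simp; omega)
    -- Every round over all pairs reaches at least one new node, unless all have been reached. After
    -- `N` rounds the second alternative of the invariant would give `N + 1` nodes.
    ((WP.for (n := T.N) (C := T.N * T.N * (3 * T.N + 5 + 2) + 2) (fun i τ => ∃ anc rk,
      T.Partly (τ .par) anc rk ∧ T.AncTable anc (τ .anc) ∧ ((∀ t < T.N, anc t t) ∨
        i + 1 ≤ ((Finset.range T.N).filter fun t => anc t t).card))
      hA (by omega) (by simp [Code.rootStep]) ?_ ?_ ?_).mono le_rfl ?_))))).mono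
      (by ring_nf; omega) fun _ h => h
  · intro τ _; simp only [Code.eval_NE]; exact hI.N
  · refine ⟨fun a t => a = 0 ∧ t = 0, fun _ => 0, partly_root ?_, ?_, Or.inr ?_⟩
    · rw [St.upd_ne _ (by decide), St.upd_ne _ (by decide), AExpr.eval_ofNat, St.upd_same]
      simp only [Code.eval_NE]; exact hI.N
    · intro a ha t ht
      rw [St.upd_ne _ (by decide)]
      simp only [AExpr.eval_ofNat]
      by_cases h1 : a = 0 ∧ t = 0
      · obtain ⟨rfl, rfl⟩ := h1
        simp
      · rw [St.upd_of_ne _ _ (by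
          intro h2; rw [show (0 : ℕ) = 0 * T.N + 0 by simp] at h2
          exact h1 (mul_add_inj ht hN h2)), if_neg h1, St.upd_ne _ (by decide), hσ]
        rfl
    · exact one_le_card_filter (P := fun t => t = 0 ∧ t = 0) ⟨rfl, rfl⟩
  · rintro i hi τ h1 h2 ⟨anc0, rk0, h4, h5, h6⟩
    -- Within a round it suffices to follow the edges that leave the set `anc0` of nodes reached
    -- before the round.
    refine (WP.for (n := T.N * T.N) (C := 3 * T.N + 5) (fun k υ => ∃ anc rk,
      T.Partly (υ .par) anc rk ∧ T.AncTable anc (υ .anc) ∧ (∀ x, anc0 x x → anc x x) ∧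
      ∀ s < T.N, ∀ t < T.N, s * T.N + t < k → anc0 s s → T.adj s t → anc t t)
      hA hR.nn_V (by simp [Code.rootStep]) ?_ ?_ ?_).mono le_rfl ?_
    · intro υ _; simp only [AExpr.eval_mul, Code.eval_NE]; rw [hI.N]
    · exact ⟨anc0, rk0, by rwa [St.upd_ne _ (by decide)], by rwa [St.upd_ne _ (by decide)],
        fun _ h => h, by omega⟩
    · rintro k hk υ - k2 ⟨anc, rk, k3, k4, k5, k6⟩
      have hs : k / T.N < T.N := Nat.div_lt_of_lt_mul hk
      have ht : k % T.N < T.N := Nat.mod_lt _ hN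
      refine (wp_rootStep hI hR k3 k4 hs ht (by rw [k2, Nat.div_add_mod'])).mono le_rfl ?_
      rintro ω ⟨anc', rk', q1, q2, q3, q4⟩
      refine ⟨anc', rk', by rwa [St.upd_ne _ (by decide)], by rwa [St.upd_ne _ (by decide)],
        fun x hx => q3 x (k5 x hx), fun s hs' t ht' hlt hss hst => ?_⟩
      rcases Nat.lt_succ_iff_lt_or_eq.1 hlt with h8 | h8
      · exact q3 t (k6 s hs' t ht' h8 hss hst)
      · rw [← Nat.div_add_mod' k T.N] at h8
        obtain ⟨rfl, rfl⟩ := mul_add_inj ht' ht h8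
        exact q4 (k5 _ hss) hst
    · rintro υ ⟨⟨anc, rk, k3, k4, k5, k6⟩, -, -⟩
      have key : ∀ s t, anc0 s s → T.adj s t → anc t t := fun s t hs hst =>
        k6 s (T.adj_lt hst) t (T.adj_lt (T.adj_symm hst))
          (mul_add_lt (T.adj_lt hst) (T.adj_lt (T.adj_symm hst))) hs hst
      refine ⟨anc, rk, by rwa [St.upd_ne _ (by decide)], by rwa [St.upd_ne _ (by decide)], ?_⟩
      refine or_iff_not_imp_left.2 fun hall => ?_
      rcases h6 with h6 | h6
      · exact absurd (fun t ht => k5 t (h6 t ht)) hall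
      refine Nat.succ_le_of_lt (lt_of_le_of_lt h6 (Finset.card_lt_card ?_))
      have : ∃ t < T.N, ¬ anc0 t t := by
        by_contra! hcon
        exact hall fun t ht => k5 t (hcon t ht)
      obtain ⟨t, ht, htt⟩ := this
      obtain ⟨s, t, q1, q2, q3⟩ := exists_adj (P := fun x => anc0 x x) (h4.anc_zero.2 rfl) ht htt
      refine Finset.ssubset_iff.2 ⟨t, by simp [q2], fun x hx => ?_⟩
      rcases Finset.mem_insert.1 hx with rfl | hx
      · simpa using ⟨T.adj_lt (T.adj_symm q3), key s x q1 q3⟩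
      · simp only [Finset.mem_filter] at hx ⊢
        exact ⟨hx.1, k5 x hx.2⟩
  · rintro τ ⟨⟨anc, rk, h1, h2, h3⟩, -, -⟩
    refine ⟨anc, rk, h1.rooted (h3.resolve_right fun h4 => ?_), h2⟩
    have := (Finset.card_filter_le (Finset.range T.N) fun t => anc t t)
    rw [Finset.card_range] at this
    omega

end Inst
namespace Inst
open Classical

/-! ## The hierarchy of components -/

variable {T : Inst} {par : ℕ → ℕ} {anc : ℕ → ℕ → Prop} {rk : ℕ → ℕ} {R B R' B' U : ℕ → ℕ}

/-- The components in `S` have been put at the ends of consecutive intervals that fill `[e, p)`;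
outside, `R'` and `B'` are as `R` and `B`. -/
structure Alloc (T : Inst) (anc : ℕ → ℕ → Prop) (R B : ℕ → ℕ) (p : ℕ) (R' B' : ℕ → ℕ) (e : ℕ)
    (S : ℕ → ℕ → Prop) : Prop where
  same : ∀ x, x < e ∨ p ≤ x → R' x = R x ∧ B' x = B x
  le : e ≤ p
  chain : Chain (T.lo anc R' B') e p
  top : ∀ x, Top (T.lo anc R' B') e p x → S (R' x) (B' x) ∧
    T.size anc (R' x) - T.size anc (B' x) ≤ x + 1
  all : ∀ r b, S r b → ∃ x, Top (T.lo anc R' B') e p x ∧ R' x = r ∧ B' x = b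

theorem alloc_nil {p : ℕ} : T.Alloc anc R B p R B p fun _ _ => False where
  same _ _ := ⟨rfl, rfl⟩
  le := le_rfl
  chain := .nil
  top _ h := absurd h Top.not_self
  all _ _ h := h.elim

theorem lo_congr {x : ℕ} (h : R' x = R x ∧ B' x = B x) : T.lo anc R' B' x = T.lo anc R B x := by
  rw [lo, lo, h.1, h.2]

/-- Intervals are allocated from right to left. All earlier ones lie in `[e, p)`, so an entry at `e
- 1` does not affect them. The size bound `h2` keeps the truncated subtraction exact. -/
theorem Alloc.step {p e r b : ℕ} {S S' : ℕ → ℕ → Prop} (h : T.Alloc anc R B p R' B' e S)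
    (h1 : 0 < T.size anc r - T.size anc b) (h2 : T.size anc r - T.size anc b ≤ e)
    (hS : ∀ r' b', S' r' b' ↔ S r' b' ∨ r' = r ∧ b' = b) :
    T.Alloc anc R B p (Function.update R' (e - 1) r) (Function.update B' (e - 1) b)
      (e - (T.size anc r - T.size anc b)) S' := by
  set s := T.size anc r - T.size anc b with hs
  set R'' := Function.update R' (e - 1) r with hR
  set B'' := Function.update B' (e - 1) b with hB
  have hep := h.le
  have same : ∀ x, x ≠ e - 1 → R'' x = R' x ∧ B'' x = B' x := fun x hx => by
    rw [hR, hB, Function.update_of_ne hx, Function.update_of_ne hx]; exact ⟨rfl, rfl⟩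
  have new : R'' (e - 1) = r ∧ B'' (e - 1) = b := by
    rw [hR, hB, Function.update_self, Function.update_self]; exact ⟨rfl, rfl⟩
  have hlo : T.lo anc R'' B'' (e - 1) = e - s := by
    rw [lo, new.1, new.2, ← hs]; omega
  have old : ∀ x, Top (T.lo anc R' B') e p x → x ≠ e - 1 := fun x hx => by
    have := hx.bounds h.chain; omega
  have hlo' : ∀ x, Top (T.lo anc R' B') e p x → T.lo anc R'' B'' x = T.lo anc R' B' x :=
    fun x hx => lo_congr (same x (old x hx))
  have hc1 : Chain (T.lo anc R'' B'') e p := h.chain.congr hlo'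
  have hc2 : Chain (T.lo anc R'' B'') (e - s) e := by
    have := Chain.cons (lo := T.lo anc R'' B'') (l := e - s) (p := e - 1) (by omega)
      (by rw [hlo]; exact .nil)
    rwa [Nat.sub_add_cancel (by omega)] at this
  have ht2 : ∀ x, Top (T.lo anc R'' B'') (e - s) e x ↔ x = e - 1 := fun x => by
    have := Top.succ_iff (lo := T.lo anc R'' B'') (l := e - s) (p := e - 1) (e := x) (by omega)
    rw [Nat.sub_add_cancel (by omega), hlo] at this
    simpa [Top.not_self] using this
  have ht : ∀ x, Top (T.lo anc R'' B'') (e - s) p x ↔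
      Top (T.lo anc R' B') e p x ∨ x = e - 1 := fun x => by
    rw [hc2.top_trans hc1, ht2, h.chain.top_congr hlo']
  constructor
  · intro x hx
    rw [(same x (by omega)).1, (same x (by omega)).2]
    exact h.same x (by omega)
  · omega
  · exact hc2.trans hc1
  · intro x hx
    rcases (ht x).1 hx with hx | rfl
    · rw [(same x (old x hx)).1, (same x (old x hx)).2, hS]
      exact ⟨Or.inl (h.top x hx).1, (h.top x hx).2⟩
    · rw [new.1, new.2, hS]
      exact ⟨Or.inr ⟨rfl, rfl⟩, by omega⟩
  · intro r' b' hrb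
    rcases (hS _ _).1 hrb with h3 | ⟨rfl, rfl⟩
    · obtain ⟨x, h4, h5, h6⟩ := h.all _ _ h3
      exact ⟨x, (ht x).2 (Or.inl h4), by rw [(same x (old x h4)).1, h5],
        by rw [(same x (old x h4)).2, h6]⟩
    · exact ⟨e - 1, (ht _).2 (Or.inr rfl), new⟩

/-- The positions from `q` on have been treated. -/
structure Hier (T : Inst) (par : ℕ → ℕ) (anc : ℕ → ℕ → Prop) (R B U : ℕ → ℕ) (q : ℕ) : Prop where
  top_root : R (T.N - 1) = 0
  top_bot : B (T.N - 1) = T.N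
  chain : Chain (T.lo anc R B) 0 q
  fit : ∀ e, Top (T.lo anc R B) 0 q e → T.Valid anc (R e) (B e) ∧
    T.size anc (R e) - T.size anc (B e) ≤ e + 1
  done : ∀ p, q ≤ p → p < T.N → T.Valid anc (R p) (B p) ∧ T.Split anc (R p) (B p) (U p) ∧
    Chain (T.lo anc R B) (T.lo anc R B p) p ∧
    (∀ e, Top (T.lo anc R B) (T.lo anc R B p) p e →
      T.Piece par anc (R p) (B p) (U p) (R e) (B e) ∧ (q ≤ e ∨ Top (T.lo anc R B) 0 q e)) ∧
    ∀ r b, T.Piece par anc (R p) (B p) (U p) r b →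
      ∃ e, Top (T.lo anc R B) (T.lo anc R B p) p e ∧ R e = r ∧ B e = b

theorem Hier.layout (h : T.Hier par anc R B U 0) : T.Layout anc R B par U where
  top_root := h.top_root
  top_bot := h.top_bot
  valid p hp := (h.done p (Nat.zero_le p) hp).1
  split p hp := (h.done p (Nat.zero_le p) hp).2.1
  chain p hp := (h.done p (Nat.zero_le p) hp).2.2.1
  piece p hp e he := ((h.done p (Nat.zero_le p) hp).2.2.2.1 e he).1
  cover p hp := (h.done p (Nat.zero_le p) hp).2.2.2.2

variable (hT : T.Rooted par anc rk)
include hT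

theorem hier_start (h1 : R (T.N - 1) = 0) (h2 : B (T.N - 1) = T.N) : T.Hier par anc R B U T.N := by
  have hN := T.N_pos
  have hlo : T.lo anc R B (T.N - 1) = 0 := by
    rw [lo, h1, h2, hT.size_zero, hT.size_none]; omega
  have hc := Chain.cons (lo := T.lo anc R B) (l := 0) (p := T.N - 1) (by omega)
    (by rw [hlo]; exact .nil)
  rw [Nat.sub_add_cancel hN] at hc
  refine ⟨h1, h2, hc, fun e he => ?_, fun p h3 h4 => by omega⟩
  have := Top.succ_iff (lo := T.lo anc R B) (l := 0) (p := T.N - 1) (e := e) (by omega)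
  rw [Nat.sub_add_cancel hN, hlo] at this
  rcases this.1 he with rfl | h5
  · rw [h1, h2, hT.size_zero, hT.size_none]
    exact ⟨⟨hN, Or.inl rfl⟩, by omega⟩
  · exact absurd h5 Top.not_self

-- The last of the pending components, at `p`, is treated and replaced by its pieces. Entries change
-- only inside `[lo p, p)`; neither the treated positions nor the other pending ones lie there, so
-- what is known about them persists.
omit hT in
theorem Hier.step {p u : ℕ} (h : T.Hier par anc R B U (p + 1)) (hp : p < T.N)
    (hu : T.Split anc (R p) (B p) u)
    (ha : T.Alloc anc R B p R' B' (T.lo anc R B p) (T.Piece par anc (R p) (B p) u)) :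
    T.Hier par anc R' B' (Function.update U p u) p := by
  obtain ⟨hle, hc⟩ := h.chain.cons_inv (Nat.zero_le p)
  have hv := (h.fit p (.head (Nat.zero_le p))).1
  have hsame := ha.same
  have hlo : ∀ x, x < T.lo anc R B p ∨ p ≤ x → T.lo anc R' B' x = T.lo anc R B x := fun x hx =>
    lo_congr (hsame x hx)
  have hp' := hsame p (Or.inr le_rfl)
  have hlop := hlo p (Or.inr le_rfl)
  have old : ∀ e, Top (T.lo anc R B) 0 (T.lo anc R B p) e → e < T.lo anc R B p := fun e he =>
    (he.bounds hc).2.2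
  have hc' : Chain (T.lo anc R' B') 0 (T.lo anc R B p) := hc.congr fun e he =>
    hlo e (Or.inl (old e he))
  have htc : ∀ e, Top (T.lo anc R' B') 0 (T.lo anc R B p) e ↔
      Top (T.lo anc R B) 0 (T.lo anc R B p) e := fun e => hc.top_congr fun e he =>
    hlo e (Or.inl (old e he))
  have htop : ∀ e, Top (T.lo anc R' B') 0 p e ↔ Top (T.lo anc R' B') (T.lo anc R B p) p e ∨
      Top (T.lo anc R B) 0 (T.lo anc R B p) e := fun e => by
    rw [hc'.top_trans ha.chain, htc]
  constructor
  · rw [(hsame _ (Or.inr (by omega))).1, h.top_root]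
  · rw [(hsame _ (Or.inr (by omega))).2, h.top_bot]
  · exact hc'.trans ha.chain
  · intro e he
    rcases (htop e).1 he with he | he
    · obtain ⟨h1, h2⟩ := ha.top e he
      exact ⟨Rooted.piece_valid hv hu.1 h1, h2⟩
    · rw [(hsame e (Or.inl (old e he))).1, (hsame e (Or.inl (old e he))).2]
      exact h.fit e (.tail (Nat.zero_le p) he)
  · intro q hq hqN
    rcases hq.eq_or_lt with rfl | hq
    · rw [hlop, hp'.1, hp'.2, Function.update_self]
      exact ⟨hv, hu, ha.chain, fun e he => ⟨(ha.top e he).1, Or.inr ((htop e).2 (Or.inl he))⟩,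
        ha.all⟩
    · obtain ⟨d1, d2, d3, d4, d5⟩ := h.done q hq hqN
      have hq' := hsame q (Or.inr hq.le)
      -- This is why `Hier` records that a piece of a treated position ends at a treated or at a
      -- pending position: in both cases its entry is not touched.
      have key : ∀ e, Top (T.lo anc R B) (T.lo anc R B q) q e →
          (e < T.lo anc R B p ∨ p ≤ e) ∧ (p ≤ e ∨ Top (T.lo anc R' B') 0 p e) := fun e he => by
        rcases (d4 e he).2 with h1 | h1
        · exact ⟨Or.inr (by omega), Or.inl (by omega)⟩
        · rcases (Top.succ_iff (Nat.zero_le p)).1 h1 with rfl | h1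
          · exact ⟨Or.inr le_rfl, Or.inl le_rfl⟩
          · exact ⟨Or.inl (old e h1), Or.inr ((htop e).2 (Or.inr h1))⟩
      have hqc : ∀ e, Top (T.lo anc R B) (T.lo anc R B q) q e →
          T.lo anc R' B' e = T.lo anc R B e := fun e he => hlo e (key e he).1
      have hqt : ∀ e, Top (T.lo anc R' B') (T.lo anc R B q) q e ↔
          Top (T.lo anc R B) (T.lo anc R B q) q e := fun e => d3.top_congr hqc
      rw [hlo q (Or.inr hq.le), hq'.1, hq'.2, Function.update_of_ne (by omega)]
      refine ⟨d1, d2, d3.congr hqc, fun e he => ?_, fun r b hrb => ?_⟩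
      · have he := (hqt e).1 he
        have h1 := hsame e (key e he).1
        rw [h1.1, h1.2]
        exact ⟨(d4 e he).1, (key e he).2⟩
      · obtain ⟨e, h1, h2, h3⟩ := d5 r b hrb
        have h4 := hsame e (key e h1).1
        exact ⟨e, (hqt e).2 h1, by rw [h4.1, h2], by rw [h4.2, h3]⟩

/-- The nodes of the components that have been put in place before the child `j`. -/
noncomputable def placed (T : Inst) (par : ℕ → ℕ) (anc : ℕ → ℕ → Prop) (r b u j : ℕ) : Finset ℕ :=
  (T.comp anc r b).filter fun x => ¬ anc u x ∨ ∃ c < j, c ≠ 0 ∧ par c = u ∧ anc c x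

/-- The bottom of the component below the child `c`. -/
noncomputable def childBot (T : Inst) (anc : ℕ → ℕ → Prop) (b c : ℕ) : ℕ :=
  if anc c b then b else T.N

/-- The components that have been put in place before the child `j`. -/
def PlacedPiece (T : Inst) (par : ℕ → ℕ) (anc : ℕ → ℕ → Prop) (r b u j r' b' : ℕ) : Prop :=
  (r' = r ∧ b' = u ∧ r ≠ u) ∨
    (r' ≠ 0 ∧ r' < j ∧ par r' = u ∧ b' = T.childBot anc b r' ∧ r' ≠ b)

omit hT in
theorem placedPiece_N (r b u : ℕ) : T.PlacedPiece par anc r b u T.N = T.Piece par anc r b u := rfl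

/-- The cardinalities of `placed` account for the positions used up so far: they show that the
allocated intervals never run below `lo p` and that they reach it in the end, when every node except
`u` has been placed. -/
theorem card_placed_zero {r b u : ℕ} (hv : T.Valid anc r b) (hu : T.Cand anc r b u) :
    (T.placed par anc r b u 0).card = T.size anc r - T.size anc u := by
  by_cases h1 : r = u
  · subst h1
    rw [Nat.sub_self, Finset.card_eq_zero, placed, Finset.filter_eq_empty_iff]
    simp only [not_lt_zero, false_and, exists_false, or_false, not_not]
    exact fun x hx => (hT.mem_comp.1 hx).1
  · rw [← hT.card_comp ⟨hv.1, Or.inr ⟨hu.1, Ne.symm h1⟩⟩]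
    congr 1
    ext x
    simp only [placed, Finset.mem_filter, hT.mem_comp, not_lt_zero, false_and, exists_false,
      or_false]
    refine ⟨fun h => ⟨h.1.1, h.2⟩, fun h => ⟨⟨h.1, fun h2 => h.2 ?_⟩, h.2⟩⟩
    rcases hu.2.1 with rfl | h3
    · exact absurd h2 (hT.not_anc_left _)
    · exact hT.trans h3 h2

theorem card_placed_succ {r b u c : ℕ} (hv : T.Valid anc r b) (hu : T.Cand anc r b u) (hc0 : c ≠ 0)
    (hc : c < T.N) (hcu : par c = u) (hcb : c ≠ b) :
    (T.placed par anc r b u (c + 1)).card = (T.placed par anc r b u c).card +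
      (T.size anc c - T.size anc (T.childBot anc b c)) := by
  have huc : anc u c := hcu ▸ hT.anc_par hc0 hc
  have hpiece : T.Piece par anc r b u c (T.childBot anc b c) := Or.inr ⟨hc0, hc, hcu, rfl, hcb⟩
  have hvc := Rooted.piece_valid hv hu hpiece
  have hsub := hT.piece_subset hu hpiece
  rw [← hT.card_comp hvc, ← Finset.card_union_of_disjoint]
  · congr 1
    ext x
    simp only [Finset.mem_union, placed, Finset.mem_filter]
    constructor
    · rintro ⟨h1, h2 | ⟨c', h3, h4, h5, h6⟩⟩
      · exact Or.inl ⟨h1, Or.inl h2⟩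
      · rcases Nat.lt_succ_iff_lt_or_eq.1 h3 with h7 | rfl
        · exact Or.inl ⟨h1, Or.inr ⟨c', h7, h4, h5, h6⟩⟩
        · refine Or.inr (hT.mem_comp.2 ⟨h6, fun h7 => ?_⟩)
          unfold childBot at h7
          split_ifs at h7 with h8
          · exact (hT.mem_comp.1 h1).2 h7
          · exact hT.not_anc_left _ h7
    · rintro (⟨h1, h2 | ⟨c', h3, h4⟩⟩ | h1)
      · exact ⟨h1, Or.inl h2⟩
      · exact ⟨h1, Or.inr ⟨c', by omega, h4⟩⟩
      · exact ⟨(Finset.mem_erase.1 (hsub h1)).2,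
          Or.inr ⟨c, by omega, hc0, hcu, (hT.mem_comp.1 h1).1⟩⟩
  · rw [Finset.disjoint_left]
    intro x hx hx'
    have h1 := (hT.mem_comp.1 hx').1
    simp only [placed, Finset.mem_filter] at hx
    rcases hx.2 with h2 | ⟨c', h2, h3, h4, h5⟩
    · exact h2 (hT.trans huc h1)
    · have := hT.child_unique h3 (by omega) hc0 hc (h4.trans hcu.symm) h5 h1
      omega

theorem placed_subset {r b u : ℕ} (hu : T.Cand anc r b u) (j : ℕ) (hj : j ≤ T.N) :
    T.placed par anc r b u j ⊆ (T.comp anc r b).erase u := by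
  intro x hx
  simp only [placed, Finset.mem_filter] at hx
  refine Finset.mem_erase.2 ⟨?_, hx.1⟩
  rintro rfl
  rcases hx.2 with h1 | ⟨c, h1, h2, h3, h4⟩
  · exact h1 (hT.refl (hT.anc_lt hu.1))
  · exact hT.not_anc_par h2 (by omega) (h3 ▸ h4)

theorem card_placed_le {r b u : ℕ} (hv : T.Valid anc r b) (hu : T.Cand anc r b u) (j : ℕ)
    (hj : j ≤ T.N) : (T.placed par anc r b u j).card + 1 ≤ T.size anc r - T.size anc b := by
  have h1 := Finset.card_le_card (placed_subset hT hu j hj)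
  rw [Finset.card_erase_of_mem (hT.cand_mem hu), hT.card_comp hv] at h1
  have := hT.size_lt_of_valid hv
  omega

theorem card_placed_N {r b u : ℕ} (hv : T.Valid anc r b) (hu : T.Cand anc r b u) :
    (T.placed par anc r b u T.N).card + 1 = T.size anc r - T.size anc b := by
  have h1 : T.placed par anc r b u T.N = (T.comp anc r b).erase u := by
    refine (placed_subset hT hu T.N le_rfl).antisymm fun x hx => ?_
    obtain ⟨h2, h3⟩ := Finset.mem_erase.1 hx
    simp only [placed, Finset.mem_filter]
    refine ⟨h3, or_iff_not_imp_left.2 fun h4 => ?_⟩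
    obtain ⟨c, h5, h6, h7, h8⟩ := hT.exists_child (not_not.1 h4) h2.symm
    exact ⟨c, h6, h5, h7, h8⟩
  rw [h1, Finset.card_erase_of_mem (hT.cand_mem hu), hT.card_comp hv]
  have := hT.size_lt_of_valid hv
  omega

theorem card_placed_skip {r b u c : ℕ}
    (h1 : ¬ (par c = u ∧ c ≠ b)) :
    (T.placed par anc r b u (c + 1)) = (T.placed par anc r b u c) := by
  ext x
  simp only [placed, Finset.mem_filter]
  refine and_congr_right fun h2 => or_congr_right ⟨?_, ?_⟩
  · rintro ⟨c', h3, h4, h5, h6⟩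
    rcases Nat.lt_succ_iff_lt_or_eq.1 h3 with h7 | rfl
    · exact ⟨c', h7, h4, h5, h6⟩
    -- If the child is the bottom `b` itself, nothing of the component lies below it.
    · have h7 : c' = b := by by_contra h7; exact h1 ⟨h5, h7⟩
      exact absurd (h7 ▸ h6) (hT.mem_comp.1 h2).2
  · rintro ⟨c', h3, h4⟩
    exact ⟨c', by omega, h4⟩

end Inst
namespace Code
open AExpr

def sizes : Cmd := .for .i NE (.seq (.sum .t .z NE (ancE (rd .i) (rd .t)))
  (.set .sz (rd .i) (rd .z)))

theorem writes_sizes {a : Arr} : sizes.writes a ↔ a = .i ∨ a = .z ∨ a = .t ∨ a = .sz := by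
  simp [sizes]; tauto

/-- Put the component with the root `r` and the bottom `b` at the end of the interval that ends
before `e`. -/
def place (r b : Arr) : Cmd := .seq (.set .R (rd .e - 1) (rd r)) (.seq (.set .B (rd .e - 1) (rd b))
  (.set .e 0 (rd .e - (arr .sz (rd r) - arr .sz (rd b)))))

def candE : AExpr := ancE (rd .j) (rd .t) *
  (eq (rd .v) NE + (1 - eq (rd .v) NE) * ancE (rd .t) (rd .v)) * (1 - eq (rd .t) (rd .v)) *
  lt (5 * (arr .sz (rd .j) - arr .sz (rd .v))) (8 * (arr .sz (rd .t) - arr .sz (rd .v))) *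
  lt (arr .sz (rd .t)) (arr .sz (rd .best))

/-- The root `j` of the component is a candidate to start with; `candE` includes the test that the
new candidate has strictly fewer descendants than the best one so far. -/
def select : Cmd := .seq (.set .best 0 (rd .j))
  (.for .t NE (.ite candE (.set .best 0 (rd .t)) (.set .f 0 0)))

def botE : AExpr := (1 - eq (rd .v) NE) * ancE (rd .t) (rd .v)

def placeChildren : Cmd := .for .t NE (.ite (eq (arr .par (rd .t)) (rd .best) * neq (rd .t) (rd .v))
  (.seq (.set .z 0 (botE * rd .v + (1 - botE) * NE)) (place .t .z)) (.set .f 0 0))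

def level : Cmd := .seq (.set .k 0 (NE - 1 - rd .i)) (.seq (.set .j 0 (arr .R (rd .k)))
  (.seq (.set .v 0 (arr .B (rd .k))) (.seq select (.seq (.set .U (rd .k) (rd .best))
  (.seq (.set .e 0 (rd .k)) (.seq (.ite (neq (rd .j) (rd .best)) (place .j .best) (.set .f 0 0))
  placeChildren))))))

def hierarchy : Cmd := .seq (.set .R (NE - 1) 0) (.seq (.set .B (NE - 1) NE) (.for .i NE level))

theorem writes_level {a : Arr} : level.writes a ↔ a = .k ∨ a = .j ∨ a = .v ∨ a = .best ∨ a = .t ∨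
    a = .f ∨ a = .U ∨ a = .e ∨ a = .R ∨ a = .B ∨ a = .z := by
  simp [level, select, placeChildren, place]; tauto

theorem writes_hierarchy {a : Arr} : hierarchy.writes a ↔ a = .k ∨ a = .j ∨ a = .v ∨ a = .best ∨
    a = .t ∨ a = .f ∨ a = .U ∨ a = .e ∨ a = .R ∨ a = .B ∨ a = .z ∨ a = .i := by
  simp [hierarchy, writes_level]; tauto

end Code

/-! ### Correctness of the computation of the hierarchy -/

namespace Inst
open Classical

variable {T : Inst} {I : List ℕ} {A V : ℕ} {par : ℕ → ℕ} {anc : ℕ → ℕ → Prop} {rk : ℕ → ℕ}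

/-- The tree is rooted, and its tables have been computed. -/
structure Tree (T : Inst) (anc : ℕ → ℕ → Prop) (rk : ℕ → ℕ) (σ : St) : Prop where
  rooted : T.Rooted (σ .par) anc rk
  table : T.AncTable anc (σ .anc)
  sz : ∀ a ≤ T.N, σ .sz a = T.size anc a

theorem Tree.congr {σ τ : St} (h : T.Tree anc rk σ) (h1 : τ .par = σ .par) (h2 : τ .anc = σ .anc)
    (h3 : τ .sz = σ .sz) : T.Tree anc rk τ :=
  ⟨by rw [h1]; exact h.rooted, by rw [h2]; exact h.table, by rw [h3]; exact h.sz⟩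

theorem wp_sizes (hI : T.Reads I) (hR : T.Room A V) {σ : St} (h : T.Rooted (σ .par) anc rk)
    (ha : T.AncTable anc (σ .anc)) (hs : σ .sz = 0) :
    WP I A V Code.sizes σ (T.N * (3 * T.N + 6) + 2) fun τ => T.Tree anc rk τ := by
  have hNA := hR.N_A
  have hNV := hR.N_V
  refine (WP.for (n := T.N) (C := 3 * T.N + 3 + 1)
    (fun k τ => ∀ a, τ .sz a = if a < k then T.size anc a else 0) (by omega) (by omega) (by simp)
    ?_ ?_ ?_).mono (by ring_nf; omega) ?_
  · intro τ _; exact hI.N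
  · intro a; rw [St.upd_ne _ (by decide), hs, if_neg (by omega)]; rfl
  · intro k hk τ h1 h2 h3
    have aτ : τ .anc = σ .anc := h1 _ (by simp) (by decide)
    have hsum : ∑ t ∈ Finset.range T.N, (if anc k t then 1 else 0) = T.size anc k := by
      rw [Finset.sum_boole]; rfl
    have hle : T.size anc k ≤ T.N := (Finset.card_filter_le _ _).trans (by simp)
    refine WP.seq ((WP.sum (n := T.N) (fun t => if anc k t then 1 else 0) (by decide) (by omega)
      (by omega) (by rw [hsum]; omega) (fun τ' _ => by rw [Code.eval_NE, hI.N]) ?_).mono le_rfl ?_)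
    · intro t ht τ' h4 h5
      rw [Code.eval_ancE, Code.eval_rd, Code.eval_rd, h5, h4 _ (by decide) (by decide),
        h4 _ (by decide) (by decide), h2, hI.N, aτ]
      exact ha k hk t ht
    · rintro τ' ⟨h4, h5⟩
      have hi : (Code.rd .i).eval I τ' = k := by
        rw [Code.eval_rd, h5 _ (by decide) (by decide), h2]
      rw [hsum] at h4
      refine WP.set (by rw [hi]; omega) (by rw [Code.eval_rd, h4]; omega) ?_
      rw [hi, Code.eval_rd, h4]
      intro a
      rw [St.upd_ne _ (by decide)]
      by_cases hak : a = k
      · rw [hak, St.upd_same, if_pos (by omega)]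
      · rw [St.upd_of_ne _ _ hak, h5 _ (by decide) (by decide), h3 a]
        have : a < k ↔ a < k + 1 := by omega
        simp only [this]
  · rintro τ ⟨h1, h2, -⟩
    have pτ : τ .par = σ .par := h2 _ (by simp) (by decide)
    have aτ : τ .anc = σ .anc := h2 _ (by simp) (by decide)
    refine ⟨by rwa [pτ], by rwa [aτ], fun a ha' => ?_⟩
    rw [h1 a]
    split_ifs with h3
    · rfl
    -- The cell with index `N` keeps its initial value 0, which is the size below a missing bottom.
    · rw [show a = T.N by omega, h.size_none]

theorem wp_place (hA : 0 < A) (hR : T.Room A V) {σ : St} (hσ : T.Tree anc rk σ) {a b : Arr}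
    (ha : a ≠ .R ∧ a ≠ .B) (hb : b ≠ .R ∧ b ≠ .B) (haN : σ a 0 ≤ T.N)
    (hbN : σ b 0 ≤ T.N) (he : σ .e 0 ≤ T.N) :
    WP I A V (Code.place a b) σ 3 fun τ =>
      τ .R = Function.update (σ .R) (σ .e 0 - 1) (σ a 0) ∧
      τ .B = Function.update (σ .B) (σ .e 0 - 1) (σ b 0) ∧
      τ .e 0 = σ .e 0 - (T.size anc (σ a 0) - T.size anc (σ b 0)) ∧
      ∀ c, c ≠ .R → c ≠ .B → c ≠ .e → τ c = σ c := by
  have hNA := hR.N_A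
  have hNV := hR.N_V
  have hupd : ∀ (τ : St) (c : Arr) (x v : ℕ), (τ.upd c x v) c = Function.update (τ c) x v := by
    intro τ c x v; funext y; by_cases hy : y = x <;> simp [St.upd, hy]
  refine WP.seq (C := 1) (C' := 1 + 1) (WP.set (by simp; omega) (by simp; omega) ?_)
  set σ1 := σ.upd .R (AExpr.eval I σ (Code.rd .e - 1)) (AExpr.eval I σ (Code.rd a)) with hσ1
  have f1 : ∀ c, c ≠ .R → σ1 c = σ c := fun c hc => St.upd_ne _ hc _ _
  refine WP.seq (WP.set (by simp [f1 .e (by decide)]; omega) (by simp [f1 b hb.1]; omega) ?_)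
  set σ2 := σ1.upd .B (AExpr.eval I σ1 (Code.rd .e - 1)) (AExpr.eval I σ1 (Code.rd b)) with hσ2
  have f2 : ∀ c, c ≠ .R → c ≠ .B → σ2 c = σ c := fun c h1 h2 => by rw [hσ2, St.upd_ne _ h2, f1 c h1]
  have hval : (Code.rd .e - (AExpr.arr .sz (Code.rd a) - AExpr.arr .sz (Code.rd b))).eval I σ2 =
      σ .e 0 - (T.size anc (σ a 0) - T.size anc (σ b 0)) := by
    simp only [AExpr.eval_sub, AExpr.eval_arr, Code.eval_rd]
    rw [f2 .e (by decide) (by decide), f2 .sz (by decide) (by decide), f2 a ha.1 ha.2,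
      f2 b hb.1 hb.2, hσ.sz _ haN, hσ.sz _ hbN]
  refine WP.set (by simpa using hA) (by rw [hval]; omega) ⟨?_, ?_, ?_, ?_⟩
  · rw [St.upd_ne _ (by decide), hσ2, St.upd_ne _ (by decide), hσ1, hupd]; rfl
  · rw [St.upd_ne _ (by decide), hσ2, hupd, f1 .B (by decide)]
    simp only [AExpr.eval_sub, Code.eval_rd, AExpr.eval_ofNat]
    rw [f1 .e (by decide), f1 b hb.1]
  · rw [AExpr.eval_ofNat, St.upd_same, hval]
  · intro c h1 h2 h3; rw [St.upd_ne _ h3, f2 c h1 h2]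

theorem wp_select (hI : T.Reads I) (hR : T.Room A V) {σ : St} (hσ : T.Tree anc rk σ) {r b : ℕ}
    (hr : σ .j 0 = r) (hb : σ .v 0 = b) (hv : T.Valid anc r b) :
    WP I A V Code.select σ (T.N * 4 + 3) fun τ => T.Split anc r b (τ .best 0) := by
  have hNA := hR.N_A
  have hNV := hR.N_V
  have hrN := hv.1
  have hbN : b ≤ T.N := hv.2.elim (·.le) fun h => (hσ.rooted.anc_lt h.1).le
  refine (WP.seq (C := 1) (WP.set (by simp; omega) (by rw [Code.eval_rd, hr]; omega) ((WP.for
    (n := T.N) (C := 1 + 1) (fun k τ => T.Cand anc r b (τ .best 0) ∧ ∀ t < k, T.Cand anc r b t →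
      T.size anc (τ .best 0) ≤ T.size anc t) (by omega) (by omega) (by simp) ?_ ?_ ?_).mono le_rfl
    ?_))).mono (by omega) fun _ h => h
  · intro τ _; exact hI.N
  · rw [St.upd_ne _ (by decide), AExpr.eval_ofNat, St.upd_same, Code.eval_rd, hr]
    exact ⟨hσ.rooted.cand_root hv, fun t ht => absurd ht (by omega)⟩
  · rintro k hk τ h1 h2 ⟨h3, h4⟩
    have f1 : ∀ c : Arr, c ≠ .best → c ≠ .f → c ≠ .t → τ c = σ c := fun c q1 q2 q3 => by
      rw [h1 c (by simp [q1, q2]) q3, St.upd_ne _ q1]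
    have hbest := hσ.rooted.anc_lt h3.1
    have hcond : Code.candE.eval I τ ≠ 0 ↔ T.Cand anc r b k ∧
        T.size anc k < T.size anc (τ .best 0) := by
      have h5 : (AExpr.eq (Code.rd .v) Code.NE + (1 - AExpr.eq (Code.rd .v) Code.NE) *
          Code.ancE (Code.rd .t) (Code.rd .v)).eval I τ = if b = T.N ∨ anc k b then 1 else 0 := by
        simp only [AExpr.eval_add, AExpr.eval_eq, AExpr.eval_mul, AExpr.eval_sub, AExpr.eval_ofNat,
          Code.eval_rd, Code.eval_NE, Code.eval_ancE, hI.N, h2,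
          f1 .v (by decide) (by decide) (by decide), hb, f1 .anc (by decide) (by decide) (by decide)]
        by_cases h6 : b = T.N
        · simp [h6]
        · rw [hσ.table k hk b (by omega)]
          simp [h6]
      simp only [Code.candE, AExpr.eval_mul, h5]
      simp only [AExpr.eval_sub, AExpr.eval_ofNat, AExpr.eval_eq, AExpr.eval_lt, AExpr.eval_arr,
        Code.eval_ancE, Code.eval_rd, AExpr.eval_mul, h2, hI.N,
        f1 .v (by decide) (by decide) (by decide), hb, f1 .anc (by decide) (by decide) (by decide),
        f1 .j (by decide) (by decide) (by decide), hr, f1 .sz (by decide) (by decide) (by decide),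
        hσ.sz _ hrN.le, hσ.sz _ hbN, hσ.sz _ hk.le, hσ.sz _ hbest.le, hσ.table r hrN k hk, Cand]
      by_cases q1 : anc r k <;> by_cases q2 : b = T.N ∨ anc k b <;> by_cases q3 : k = b <;>
        by_cases q4 : 5 * (T.size anc r - T.size anc b) < 8 * (T.size anc k - T.size anc b) <;>
        by_cases q5 : T.size anc k < T.size anc (τ .best 0) <;> simp [q1, q2, q3, q4, q5]
    refine WP.ite (fun h5 => ?_) (fun h5 => ?_)
    · obtain ⟨h6, h7⟩ := hcond.1 h5
      refine WP.set (by simp; omega) (by rw [Code.eval_rd, h2]; omega) ?_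
      rw [St.upd_ne _ (by decide), AExpr.eval_ofNat, St.upd_same, Code.eval_rd, h2]
      refine ⟨h6, fun t ht hct => ?_⟩
      rcases Nat.lt_succ_iff_lt_or_eq.1 ht with h8 | rfl
      · exact h7.le.trans (h4 t h8 hct)
      · exact le_rfl
    · refine WP.set (by simp; omega) (by simp; omega) ?_
      rw [St.upd_ne _ (by decide), St.upd_ne _ (by decide)]
      refine ⟨h3, fun t ht hct => ?_⟩
      rcases Nat.lt_succ_iff_lt_or_eq.1 ht with h8 | rfl
      · exact h4 t h8 hct
      · by_contra h9
        exact hcond.2 ⟨hct, by omega⟩ h5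
  · rintro τ ⟨⟨h1, h2⟩, -, -⟩
    exact ⟨h1, fun t ht => h2 t (hσ.rooted.anc_lt ht.1) ht⟩

theorem wp_placeChildren (hI : T.Reads I) (hR : T.Room A V) {σ : St} (hσ : T.Tree anc rk σ)
    {p r b u : ℕ} {R B : ℕ → ℕ} (hp : p < T.N) (hb : σ .v 0 = b) (hu : σ .best 0 = u)
    (hv : T.Valid anc r b) (hs : T.Cand anc r b u) (hw : T.size anc r - T.size anc b ≤ p + 1)
    (hal : T.Alloc anc R B p (σ .R) (σ .B) (σ .e 0) (T.PlacedPiece (σ .par) anc r b u 0))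
    (hcard : σ .e 0 + (T.placed (σ .par) anc r b u 0).card = p) :
    WP I A V Code.placeChildren σ (T.N * 7 + 2) fun τ => T.Alloc anc R B p (τ .R) (τ .B)
      (p + 1 - (T.size anc r - T.size anc b)) (T.Piece (σ .par) anc r b u) := by
  have hNA := hR.N_A
  have hNV := hR.N_V
  have hT := hσ.rooted
  have huN := hT.anc_lt hs.1
  have hbN : b ≤ T.N := hv.2.elim (·.le) fun h => (hT.anc_lt h.1).le
  -- The equation in the invariant says that `[e, p)` has exactly as many positions as nodes have
  -- been placed; with `card_placed_le` it shows that there is room for the next piece.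
  refine (WP.for (n := T.N) (C := (1 + 3) + 1) (fun c τ =>
    T.Alloc anc R B p (τ .R) (τ .B) (τ .e 0) (T.PlacedPiece (σ .par) anc r b u c) ∧
    τ .e 0 + (T.placed (σ .par) anc r b u c).card = p)
    (by omega) (by omega) (by simp [Code.place]) ?_ ?_ ?_).mono le_rfl ?_
  · intro τ _; exact hI.N
  · rw [St.upd_ne _ (by decide), St.upd_ne _ (by decide), St.upd_ne _ (by decide)]
    exact ⟨hal, hcard⟩
  · rintro c hc τ h1 h2 ⟨h3, h4⟩
    have f1 : ∀ a : Arr, a ≠ .z → a ≠ .R → a ≠ .B → a ≠ .e → a ≠ .f → a ≠ .t → τ a = σ a :=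
      fun a q1 q2 q3 q4 q5 q6 => h1 a (by simp [Code.place, *]) q6
    have pτ := f1 .par (by decide) (by decide) (by decide) (by decide) (by decide) (by decide)
    have vτ := f1 .v (by decide) (by decide) (by decide) (by decide) (by decide) (by decide)
    have bτ := f1 .best (by decide) (by decide) (by decide) (by decide) (by decide) (by decide)
    have aτ := f1 .anc (by decide) (by decide) (by decide) (by decide) (by decide) (by decide)
    have sτ := f1 .sz (by decide) (by decide) (by decide) (by decide) (by decide) (by decide)
    have hτ := hσ.congr pτ aτ sτ
    have hcond : (AExpr.eq (.arr .par (Code.rd .t)) (Code.rd .best) *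
        Code.neq (Code.rd .t) (Code.rd .v)).eval I τ ≠ 0 ↔ σ .par c = u ∧ c ≠ b := by
      simp only [AExpr.eval_mul, AExpr.eval_eq, AExpr.eval_arr, Code.eval_rd, Code.eval_neq, h2, pτ,
        bτ, vτ, hu, hb]
      by_cases h5 : σ .par c = u <;> simp [h5]
      omega
    refine WP.ite (fun h5 => ?_) (fun h5 => ?_)
    · obtain ⟨h6, h7⟩ := hcond.1 h5
      -- The parent of the root is `N` and hence never equal to the node `u`.
      have hc0 : c ≠ 0 := by
        rintro rfl; rw [hT.par_zero] at h6; omega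
      have hbot : Code.botE.eval I τ = if anc c b then 1 else 0 := by
        simp only [Code.botE, AExpr.eval_mul, AExpr.eval_sub, AExpr.eval_eq, AExpr.eval_ofNat,
          Code.eval_rd, Code.eval_NE, Code.eval_ancE, h2, vτ, hb, hI.N, aτ]
        by_cases h8 : b = T.N
        · simp [h8, hT.not_anc_right]
        · rw [hσ.table c hc b (by omega)]; simp [h8]
      have hz : (Code.botE * Code.rd .v + (1 - Code.botE) * Code.NE).eval I τ =
          T.childBot anc b c := by
        simp only [AExpr.eval_add, AExpr.eval_mul, AExpr.eval_sub, AExpr.eval_ofNat, hbot,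
          Code.eval_rd, Code.eval_NE, hI.N, vτ, hb, childBot]
        split_ifs <;> simp
      have hzN : T.childBot anc b c ≤ T.N := by unfold childBot; split_ifs <;> omega
      have hpiece : T.Piece (σ .par) anc r b u c (T.childBot anc b c) :=
        Or.inr ⟨hc0, hc, h6, rfl, h7⟩
      have hsz := hT.size_lt_of_valid (Rooted.piece_valid hv hs hpiece)
      have hcs := card_placed_succ hT hv hs hc0 hc h6 h7
      have hcl := card_placed_le hT hv hs (c + 1) hc
      refine WP.seq (WP.set (by simp; omega) (by rw [hz]; omega) ?_)
      rw [hz, AExpr.eval_ofNat]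
      have hτ1 : T.Tree anc rk (τ.upd .z 0 (T.childBot anc b c)) :=
        hτ.congr (St.upd_ne _ (by decide) _ _) (St.upd_ne _ (by decide) _ _)
          (St.upd_ne _ (by decide) _ _)
      refine (wp_place (by omega) hR hτ1 (by decide) (by decide)
        (by rw [St.upd_ne _ (by decide), h2]; omega) (by rw [St.upd_same]; omega)
        (by rw [St.upd_ne _ (by decide)]; omega)).mono le_rfl ?_
      rintro υ ⟨q1, q2, q3, q4⟩
      rw [St.upd_ne _ (show Arr.R ≠ Arr.z by decide), St.upd_ne _ (show Arr.e ≠ Arr.z by decide),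
        St.upd_ne _ (show Arr.t ≠ Arr.z by decide), h2] at q1
      rw [St.upd_ne _ (show Arr.B ≠ Arr.z by decide), St.upd_ne _ (show Arr.e ≠ Arr.z by decide),
        St.upd_same] at q2
      rw [St.upd_ne _ (show Arr.e ≠ Arr.z by decide), St.upd_ne _ (show Arr.t ≠ Arr.z by decide),
        St.upd_same, h2] at q3
      rw [St.upd_ne _ (by decide), St.upd_ne _ (by decide), St.upd_ne _ (by decide), q1, q2, q3]
      refine ⟨h3.step (by omega) (by omega) fun r' b' => ?_, by omega⟩
      constructor
      · rintro (k1 | ⟨k1, k2, k3, k4, k5⟩)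
        · exact Or.inl (Or.inl k1)
        · rcases Nat.lt_succ_iff_lt_or_eq.1 k2 with k6 | rfl
          · exact Or.inl (Or.inr ⟨k1, k6, k3, k4, k5⟩)
          · exact Or.inr ⟨rfl, k4⟩
      · rintro ((k1 | ⟨k1, k2, k3, k4, k5⟩) | ⟨rfl, rfl⟩)
        · exact Or.inl k1
        · exact Or.inr ⟨k1, by omega, k3, k4, k5⟩
        · exact Or.inr ⟨hc0, by omega, h6, rfl, h7⟩
    · have h6 : ¬ (σ .par c = u ∧ c ≠ b) := fun h => hcond.2 h h5
      refine (WP.set (by simp; omega) (by simp; omega) ?_).mono (show 1 ≤ 1 + 3 by omega)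
        fun _ h => h
      rw [St.upd_ne _ (by decide), St.upd_ne _ (by decide), St.upd_ne _ (by decide),
        St.upd_ne _ (by decide), St.upd_ne _ (by decide), St.upd_ne _ (by decide),
        card_placed_skip hT h6]
      refine ⟨?_, h4⟩
      have : T.PlacedPiece (σ .par) anc r b u (c + 1) = T.PlacedPiece (σ .par) anc r b u c := by
        funext r' b'
        refine propext (or_congr_right ⟨?_, ?_⟩)
        · rintro ⟨k1, k2, k3, k4, k5⟩
          rcases Nat.lt_succ_iff_lt_or_eq.1 k2 with k6 | rfl
          · exact ⟨k1, k6, k3, k4, k5⟩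
          · exact absurd ⟨k3, k5⟩ h6
        · rintro ⟨k1, k2, k3⟩
          exact ⟨k1, by omega, k3⟩
      rwa [this]
  · rintro τ ⟨⟨h1, h2⟩, -, -⟩
    have h3 := card_placed_N hT hv hs
    rwa [placedPiece_N, show τ .e 0 = p + 1 - (T.size anc r - T.size anc b) by omega] at h1

theorem wp_level (hI : T.Reads I) (hR : T.Room A V) {σ : St} (hσ : T.Tree anc rk σ) {p : ℕ}
    (hp : p < T.N) (hi : σ .i 0 = T.N - 1 - p)
    (hh : T.Hier (σ .par) anc (σ .R) (σ .B) (σ .U) (p + 1)) :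
    WP I A V Code.level σ (11 * T.N + 14) fun τ => T.Hier (τ .par) anc (τ .R) (τ .B) (τ .U) p := by
  have hNA := hR.N_A
  have hNV := hR.N_V
  have hT := hσ.rooted
  obtain ⟨hle, -⟩ := hh.chain.cons_inv (Nat.zero_le p)
  obtain ⟨hv, hw⟩ := hh.fit p (.head (Nat.zero_le p))
  have hbN : σ .B p ≤ T.N := hv.2.elim (·.le) fun h => (hT.anc_lt h.1).le
  have hrN := hv.1
  have hkv : (Code.NE - 1 - Code.rd .i).eval I σ = p := by
    simp only [AExpr.eval_sub, Code.eval_NE, Code.eval_rd, AExpr.eval_ofNat, hI.N, hi]; omega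
  refine (WP.seq (C := 1) (WP.set (by simp; omega) (by rw [hkv]; omega) ?_)).mono
    (show 1 + (1 + (1 + (T.N * 4 + 3 + (1 + (1 + (3 + 1 + (T.N * 7 + 2))))))) ≤ _ by omega) fun _ h => h
  rw [hkv, AExpr.eval_ofNat]
  set σ1 := σ.upd .k 0 p with hσ1
  have f1 : ∀ a, a ≠ .k → σ1 a = σ a := fun a ha => St.upd_ne _ ha _ _
  have k1 : σ1 .k 0 = p := St.upd_same _ _ _ _
  have hr1 : (AExpr.arr .R (Code.rd .k)).eval I σ1 = σ .R p := by
    rw [AExpr.eval_arr, Code.eval_rd, k1, f1 .R (by decide)]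
  refine WP.seq (WP.set (by simp; omega) (by rw [hr1]; omega) ?_)
  rw [hr1, AExpr.eval_ofNat]
  set σ2 := σ1.upd .j 0 (σ .R p) with hσ2
  have f2 : ∀ a, a ≠ .k → a ≠ .j → σ2 a = σ a := fun a h1 h2 => by
    rw [hσ2, St.upd_ne _ h2, f1 a h1]
  have k2 : σ2 .k 0 = p := by rw [hσ2, St.upd_ne _ (by decide), k1]
  have hb2 : (AExpr.arr .B (Code.rd .k)).eval I σ2 = σ .B p := by
    rw [AExpr.eval_arr, Code.eval_rd, k2, f2 .B (by decide) (by decide)]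
  refine WP.seq (WP.set (by simp; omega) (by rw [hb2]; omega) ?_)
  rw [hb2, AExpr.eval_ofNat]
  set σ3 := σ2.upd .v 0 (σ .B p) with hσ3
  have f3 : ∀ a, a ≠ .k → a ≠ .j → a ≠ .v → σ3 a = σ a := fun a h1 h2 h3 => by
    rw [hσ3, St.upd_ne _ h3, f2 a h1 h2]
  have k3 : σ3 .k 0 = p := by rw [hσ3, St.upd_ne _ (by decide), k2]
  have j3 : σ3 .j 0 = σ .R p := by rw [hσ3, St.upd_ne _ (by decide), hσ2, St.upd_same]
  have v3 : σ3 .v 0 = σ .B p := by rw [hσ3, St.upd_same]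
  have t3 : T.Tree anc rk σ3 := hσ.congr (f3 _ (by decide) (by decide) (by decide))
    (f3 _ (by decide) (by decide) (by decide)) (f3 _ (by decide) (by decide) (by decide))
  refine WP.seq ((wp_select hI hR t3 j3 v3 hv).frame.mono le_rfl fun σ4 ⟨hs, g4⟩ => ?_)
  have g4 : ∀ a, a ≠ .best → a ≠ .t → a ≠ .f → σ4 a = σ3 a := fun a h1 h2 h3 =>
    g4 a (by simp [Code.select, h1, h2, h3])
  have f4 : ∀ a, a ≠ .k → a ≠ .j → a ≠ .v → a ≠ .best → a ≠ .t → a ≠ .f → σ4 a = σ a :=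
    fun a h1 h2 h3 h4 h5 h6 => by rw [g4 a h4 h5 h6, f3 a h1 h2 h3]
  set u := σ4 .best 0 with hu
  have huN := hT.anc_lt hs.1.1
  have k4 : σ4 .k 0 = p := by rw [g4 _ (by decide) (by decide) (by decide), k3]
  refine WP.seq (WP.set (by rw [Code.eval_rd, k4]; omega) (by rw [Code.eval_rd, ← hu]; omega) ?_)
  rw [Code.eval_rd, Code.eval_rd, k4, ← hu]
  set σ5 := σ4.upd .U p u with hσ5
  have g5 : ∀ a, a ≠ .U → σ5 a = σ4 a := fun a ha => St.upd_ne _ ha _ _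
  have k5 : σ5 .k 0 = p := by rw [g5 _ (by decide), k4]
  refine WP.seq (WP.set (by simp; omega) (by rw [Code.eval_rd, k5]; omega) ?_)
  rw [Code.eval_rd, k5, AExpr.eval_ofNat]
  set σ6 := σ5.upd .e 0 p with hσ6
  have g6 : ∀ a, a ≠ .U → a ≠ .e → σ6 a = σ4 a := fun a h1 h2 => by
    rw [hσ6, St.upd_ne _ h2, g5 a h1]
  have f6 : ∀ a, a ≠ .k → a ≠ .j → a ≠ .v → a ≠ .best → a ≠ .t → a ≠ .f → a ≠ .U → a ≠ .e →
      σ6 a = σ a := fun a h1 h2 h3 h4 h5 h6 h7 h8 => by rw [g6 a h7 h8, f4 a h1 h2 h3 h4 h5 h6]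
  have e6 : σ6 .e 0 = p := by rw [hσ6, St.upd_same]
  have j6 : σ6 .j 0 = σ .R p := by
    rw [g6 _ (by decide) (by decide), g4 _ (by decide) (by decide) (by decide), j3]
  have v6 : σ6 .v 0 = σ .B p := by
    rw [g6 _ (by decide) (by decide), g4 _ (by decide) (by decide) (by decide), v3]
  have u6 : σ6 .best 0 = u := by rw [g6 _ (by decide) (by decide)]
  have U6 : σ6 .U = Function.update (σ .U) p u := by
    rw [hσ6, St.upd_ne _ (by decide), hσ5, ← f4 .U (by decide) (by decide) (by decide) (by decide)
      (by decide) (by decide)]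
    funext y; by_cases hy : y = p <;> simp [St.upd, hy]
  have R6 := f6 .R (by decide) (by decide) (by decide) (by decide) (by decide) (by decide)
    (by decide) (by decide)
  have B6 := f6 .B (by decide) (by decide) (by decide) (by decide) (by decide) (by decide)
    (by decide) (by decide)
  have p6 := f6 .par (by decide) (by decide) (by decide) (by decide) (by decide) (by decide)
    (by decide) (by decide)
  have t6 : T.Tree anc rk σ6 := hσ.congr p6 (f6 _ (by decide) (by decide) (by decide) (by decide)
    (by decide) (by decide) (by decide) (by decide)) (f6 _ (by decide) (by decide) (by decide)
    (by decide) (by decide) (by decide) (by decide) (by decide))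
  have hwv := hT.size_lt_of_valid hv
  have hc0 := card_placed_zero hT hv hs.1
  have hcl := card_placed_le hT hv hs.1 0 (Nat.zero_le _)
  refine WP.seq (C := 3 + 1) (WP.mono (C := 3 + 1) (post := fun σ7 =>
    T.Alloc anc (σ .R) (σ .B) p (σ7 .R) (σ7 .B) (σ7 .e 0)
      (T.PlacedPiece (σ .par) anc (σ .R p) (σ .B p) u 0) ∧
    σ7 .e 0 + (T.placed (σ .par) anc (σ .R p) (σ .B p) u 0).card = p ∧
    ∀ a, a ≠ .R → a ≠ .B → a ≠ .e → a ≠ .f → σ7 a = σ6 a) ?_ le_rfl ?_)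
  · have hcond : (Code.neq (Code.rd .j) (Code.rd .best)).eval I σ6 ≠ 0 ↔ σ .R p ≠ u := by
      simp only [Code.eval_neq, Code.eval_rd, j6, u6]; omega
    have hPP : ∀ r' b', T.PlacedPiece (σ .par) anc (σ .R p) (σ .B p) u 0 r' b' ↔
        r' = σ .R p ∧ b' = u ∧ σ .R p ≠ u := fun r' b' => by
      simp only [PlacedPiece]
      exact or_iff_left fun h => absurd h.2.1 (by omega)
    refine WP.ite (fun h1 => ?_) (fun h1 => ?_)
    · have hne := hcond.1 h1
      have hsz := hT.size_lt hs.1.1 hne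
      refine (wp_place (by omega) hR t6 (by decide) (by decide) (by rw [j6]; omega)
        (by rw [u6]; omega) (by rw [e6]; omega)).mono le_rfl ?_
      rintro σ7 ⟨q1, q2, q3, q4⟩
      rw [e6, j6, R6] at q1
      rw [e6, u6, B6] at q2
      rw [e6, j6, u6] at q3
      rw [q1, q2, q3]
      refine ⟨alloc_nil.step (by omega) (by omega) fun r' b' => ?_, by omega,
        fun a h1 h2 h3 h4 => q4 a h1 h2 h3⟩
      rw [hPP, false_or]
      exact ⟨fun h => ⟨h.1, h.2.1⟩, fun h => ⟨h.1, h.2, hne⟩⟩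
    -- If the root of the component is split off, there is no upper piece and nothing is placed yet.
    · have heq : σ .R p = u := by
        by_contra h2; exact hcond.2 h2 h1
      refine (WP.set (by simp; omega) (by simp; omega) ?_).mono (show 1 ≤ 3 by omega) fun _ h => h
      rw [St.upd_ne _ (by decide), St.upd_ne _ (by decide), St.upd_ne _ (by decide), R6, B6, e6]
      refine ⟨?_, ?_, fun a h1 h2 h3 h4 => St.upd_ne _ h4 _ _⟩
      · have : T.PlacedPiece (σ .par) anc (σ .R p) (σ .B p) u 0 = fun _ _ => False := by
          funext r' b'
          exact propext ((hPP r' b').trans (iff_of_false (fun h => h.2.2 heq) id))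
        rw [this]; exact alloc_nil
      · rw [hc0, heq]; omega
  · rintro σ7 ⟨h1, h2, h3⟩
    have p7 : σ7 .par = σ .par := by
      rw [h3 _ (by decide) (by decide) (by decide) (by decide), p6]
    have t7 : T.Tree anc rk σ7 := t6.congr (h3 _ (by decide) (by decide) (by decide) (by decide))
      (h3 _ (by decide) (by decide) (by decide) (by decide))
      (h3 _ (by decide) (by decide) (by decide) (by decide))
    refine (wp_placeChildren hI hR t7 hp
      (by rw [h3 _ (by decide) (by decide) (by decide) (by decide), v6])
      (by rw [h3 _ (by decide) (by decide) (by decide) (by decide), u6]) hv hs.1 hw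
      (by rw [p7]; exact h1) (by rw [p7]; exact h2)).frame.mono le_rfl ?_
    rintro τ ⟨h4, h5⟩
    rw [h5 .par (by simp [Code.placeChildren, Code.place]),
      h5 .U (by simp [Code.placeChildren, Code.place]), p7,
      h3 _ (by decide) (by decide) (by decide) (by decide), U6]
    rw [p7] at h4
    exact hh.step hp hs h4

theorem wp_hierarchy (hI : T.Reads I) (hR : T.Room A V) {σ : St} (hσ : T.Tree anc rk σ) :
    WP I A V Code.hierarchy σ (T.N * (11 * T.N + 16) + 4) fun τ =>
      T.Layout anc (τ .R) (τ .B) (τ .par) (τ .U) := by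
  have hNA := hR.N_A
  have hNV := hR.N_V
  have hN := T.N_pos
  have hidx : ∀ τ, (Code.NE - 1).eval I τ = T.N - 1 := fun τ => by
    rw [AExpr.eval_sub, Code.eval_NE, hI.N]; rfl
  refine (WP.seq (C := 1) (WP.set (by rw [hidx]; omega) (by simp; omega) (WP.seq (C := 1)
    (WP.set (by rw [hidx]; omega) (by rw [Code.eval_NE, hI.N]; omega) ((WP.for (n := T.N)
      (C := 11 * T.N + 14) (fun k τ => T.Hier (τ .par) anc (τ .R) (τ .B) (τ .U) (T.N - k)) (by omega)
      (by omega) (by simp [Code.writes_level]) ?_ ?_ ?_).mono le_rfl ?_))))).mono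
    (by ring_nf; omega) fun _ h => h
  · intro τ _; exact hI.N
  · rw [Nat.sub_zero, St.upd_ne _ (by decide), St.upd_ne _ (by decide), St.upd_ne _ (by decide),
      St.upd_ne _ (by decide)]
    refine hier_start hσ.rooted ?_ ?_
    · simp [hidx, St.upd]
    · simp [hidx, St.upd, hI.N, -List.getD_eq_getElem?_getD]
  · intro k hk τ h1 h2 h3
    have f1 : ∀ a : Arr, ¬ Code.level.writes a → a ≠ .i → a ≠ .R → a ≠ .B → τ a = σ a :=
      fun a q1 q2 q3 q4 => by rw [h1 a q1 q2, St.upd_ne _ q4, St.upd_ne _ q3]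
    have hτ := hσ.congr (f1 .par (by simp [Code.writes_level]) (by decide) (by decide) (by decide))
      (f1 .anc (by simp [Code.writes_level]) (by decide) (by decide) (by decide))
      (f1 .sz (by simp [Code.writes_level]) (by decide) (by decide) (by decide))
    refine (wp_level hI hR hτ (p := T.N - (k + 1)) (by omega) (by rw [h2]; omega)
      (by rwa [show T.N - (k + 1) + 1 = T.N - k by omega])).mono le_rfl fun υ hυ => ?_
    rwa [St.upd_ne _ (by decide), St.upd_ne _ (by decide), St.upd_ne _ (by decide),
      St.upd_ne _ (by decide)]
  · rintro τ ⟨h1, -, -⟩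
    rw [Nat.sub_self] at h1
    exact h1.layout

end Inst
-- Bags, place values and powers of two
namespace Code
open AExpr

def bagE (t v : AExpr) : AExpr :=
  lt v nE * inp (3 + 2 * (mE * nE) + NE * NE + (t * nE + v)) +
    (1 - lt v nE) * inp (3 + 2 * (mE * nE) + NE * NE + NE * nE + (t * mE + (v - nE)))

def cellE : AExpr := rd .i * (nE + mE) + rd .v

/-- Bags are scanned by increasing number, so `1 - seen v`, read before `seen v` is set, tells
whether this is the first bag that contains `v`. Meanwhile `cnt` is the next place value and `z` its
exponent. -/
def scanVertex : Cmd := .ite (bagE (rd .i) (rd .v))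
  (.seq (.set .pw cellE (rd .cnt)) (.seq (.set .first cellE (1 - arr .seen (rd .v)))
    (.seq (.set .seen (rd .v) 1) (.seq (.set .cnt 0 (2 * rd .cnt)) (.set .z 0 (rd .z + 1))))))
  (.set .f 0 0)

def scanBag : Cmd := .seq (.set .cnt 0 1) (.seq (.set .z 0 0) (.seq (.for .v (nE + mE) scanVertex)
  (.seq (.set .full (rd .i) (rd .cnt)) (.ite (lt (rd .w) (rd .z)) (.set .w 0 (rd .z)) (.set .f 0 0)))))

def bags : Cmd := .for .i NE scanBag

/-- `x := 2 ^ e`. -/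
def pow2 (x : Arr) (e : AExpr) : Cmd := .seq (.set x 0 1) (.for .i e (.set x 0 (2 * rd x)))

theorem writes_bags {a : Arr} : bags.writes a ↔ a = .pw ∨ a = .first ∨ a = .seen ∨ a = .cnt ∨
    a = .z ∨ a = .f ∨ a = .full ∨ a = .w ∨ a = .v ∨ a = .i := by
  simp [bags, scanBag, scanVertex]; tauto

@[simp] theorem writes_pow2 {x a : Arr} {e : AExpr} : (pow2 x e).writes a ↔ a = x ∨ a = .i := by
  simp [pow2]; tauto

end Code

namespace Inst
open Classical

variable {T : Inst} {I : List ℕ} {A V : ℕ}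

/-- The number of vertices in a bag. -/
noncomputable def bagSize (T : Inst) (t : ℕ) : ℕ := Nat.count (T.inB t) (T.n + T.m)

/-- The largest size of a bag. -/
noncomputable def maxBag (T : Inst) : ℕ := (Finset.range T.N).sup T.bagSize

theorem eval_bagE (hI : T.Reads I) {σ : St} {e f : AExpr} {t v : ℕ} (ht : t < T.N)
    (hv : v < T.n + T.m) (he : e.eval I σ = t) (hf : f.eval I σ = v) :
    (Code.bagE e f).eval I σ = if T.inB t v then 1 else 0 := by
  simp only [Code.bagE, AExpr.eval_add, AExpr.eval_mul, AExpr.eval_sub, AExpr.eval_lt,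
    AExpr.eval_inp, AExpr.eval_ofNat, Code.eval_nE, Code.eval_mE, Code.eval_NE, he, hf, hI.n, hI.m,
    hI.N]
  by_cases h : v < T.n
  · rw [if_pos h, hI.bagVar t ht v h]; simp
  · rw [if_neg h, hI.bagClause t ht (v - T.n) (by omega), show T.n + (v - T.n) = v by omega]; simp

/-- The tables of the bags with numbers below `i`, and of the vertices below `k` of the bag `i`. -/
structure Scanned (T : Inst) (i k : ℕ) (σ : St) : Prop where
  pw : ∀ t, ∀ v < T.n + T.m, σ .pw (t * (T.n + T.m) + v) =
    if t < i ∨ t = i ∧ v < k then T.pw t v else 0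
  first : ∀ t, ∀ v < T.n + T.m, σ .first (t * (T.n + T.m) + v) =
    if (t < i ∨ t = i ∧ v < k) ∧ T.first t v then 1 else 0
  seen : ∀ v < T.n + T.m, σ .seen v =
    if ∃ s, (s < i ∨ s = i ∧ v < k) ∧ T.inB s v then 1 else 0

theorem Scanned.congr {i k : ℕ} {σ τ : St} (h : T.Scanned i k σ) (h1 : τ .pw = σ .pw)
    (h2 : τ .first = σ .first) (h3 : τ .seen = σ .seen) : T.Scanned i k τ :=
  ⟨by rw [h1]; exact h.pw, by rw [h2]; exact h.first, by rw [h3]; exact h.seen⟩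

theorem scanned_succ {i k v t : ℕ} (hne : t * (T.n + T.m) + v ≠ i * (T.n + T.m) + k) :
    (t < i ∨ t = i ∧ v < k + 1) ↔ (t < i ∨ t = i ∧ v < k) := by
  have : ¬ (t = i ∧ v = k) := fun h => hne (by rw [h.1, h.2])
  omega

theorem Scanned.skip {i k : ℕ} {σ : St} (h : T.Scanned i k σ) (hk : k < T.n + T.m)
    (hb : ¬ T.inB i k) : T.Scanned i (k + 1) σ := by
  constructor
  · intro t v hv
    rw [h.pw t v hv]
    by_cases h1 : t = i ∧ v = k
    · obtain ⟨rfl, rfl⟩ := h1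
      rw [if_neg (by omega), if_pos (by omega), Inst.pw, if_neg hb]
    · have : (t < i ∨ t = i ∧ v < k + 1) ↔ (t < i ∨ t = i ∧ v < k) := by omega
      simp only [this]
  · intro t v hv
    rw [h.first t v hv]
    by_cases h1 : t = i ∧ v = k
    · obtain ⟨rfl, rfl⟩ := h1
      rw [if_neg (by omega), if_neg (fun h2 => hb h2.2.1)]
    · have : (t < i ∨ t = i ∧ v < k + 1) ↔ (t < i ∨ t = i ∧ v < k) := by omega
      simp only [this]
  · intro v hv
    rw [h.seen v hv]
    refine if_congr (exists_congr fun s => ?_) rfl rfl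
    by_cases h1 : s = i ∧ v = k
    · obtain ⟨rfl, rfl⟩ := h1
      simp [hb]
    · have : (s < i ∨ s = i ∧ v < k + 1) ↔ (s < i ∨ s = i ∧ v < k) := by omega
      simp only [this]

theorem wp_scanVertex (hI : T.Reads I) (hR : T.Room A V) {σ : St} {i k : ℕ} (hi : i < T.N)
    (hk : k < T.n + T.m) (hσi : σ .i 0 = i) (hσk : σ .v 0 = k) (h : T.Scanned i k σ)
    (hc : σ .cnt 0 = 2 ^ Nat.count (T.inB i) k) (hz : σ .z 0 = Nat.count (T.inB i) k) :
    WP I A V Code.scanVertex σ 6 fun τ => T.Scanned i (k + 1) τ ∧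
      τ .cnt 0 = 2 ^ Nat.count (T.inB i) (k + 1) ∧ τ .z 0 = Nat.count (T.inB i) (k + 1) := by
  have hNA := hR.N_A
  have hNV := hR.N_V
  have hcond := eval_bagE hI (e := Code.rd .i) (f := Code.rd .v) (σ := σ) hi hk hσi hσk
  have hcell : ∀ τ : St, τ .i = σ .i → τ .v = σ .v →
      Code.cellE.eval I τ = i * (T.n + T.m) + k := fun τ h1 h2 => by
    simp only [Code.cellE, AExpr.eval_add, AExpr.eval_mul, Code.eval_rd, Code.eval_nE, Code.eval_mE,
      h1, h2, hσi, hσk, hI.n, hI.m]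
  have hcellA : i * (T.n + T.m) + k < A :=
    (mul_add_lt hi hk).trans_le (le_trans (Nat.mul_le_mul_right _ (by omega)) hR.Nv_A)
  have hkA : k < A := by
    refine lt_of_lt_of_le hk (le_trans ?_ hR.Nv_A)
    exact Nat.le_mul_of_pos_left _ (by omega)
  have hcount : Nat.count (T.inB i) (k + 1) ≤ T.n + T.m := (Nat.count_le _).trans hk
  have hzV : T.n + T.m < V := by
    refine lt_of_le_of_lt ?_ hR.Nv_V
    exact (Nat.le_succ _).trans (Nat.le_mul_of_pos_left _ (by omega))
  have hpV : 2 ^ Nat.count (T.inB i) (k + 1) < V :=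
    lt_of_le_of_lt (Nat.pow_le_pow_right two_pos hcount) hR.pow_V
  refine WP.ite (C := 5) (fun h1 => ?_) (fun h1 => ?_)
  · have hb : T.inB i k := by
      by_contra hb; rw [hcond, if_neg hb] at h1; exact h1 rfl
    rw [Nat.count_succ, if_pos hb] at hpV hcount ⊢
    rw [pow_succ] at hpV
    refine WP.seq (C := 1) (C' := 1 + (1 + (1 + 1))) (WP.set (by rw [hcell σ rfl rfl]; exact hcellA)
      (by rw [Code.eval_rd, hc]; omega) ?_)
    rw [hcell σ rfl rfl, Code.eval_rd, hc]
    set σ1 := σ.upd .pw (i * (T.n + T.m) + k) (2 ^ Nat.count (T.inB i) k) with hσ1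
    have f1 : ∀ a, a ≠ .pw → σ1 a = σ a := fun a ha => St.upd_ne _ ha _ _
    have hfv : (1 - AExpr.arr .seen (Code.rd .v)).eval I σ1 = if T.first i k then 1 else 0 := by
      simp only [AExpr.eval_sub, AExpr.eval_ofNat, AExpr.eval_arr, Code.eval_rd, f1 .v (by decide),
        f1 .seen (by decide), hσk, h.seen k hk]
      have : T.first i k ↔ ¬ ∃ s, (s < i ∨ s = i ∧ k < k) ∧ T.inB s k := by
        simp only [first, hb, true_and, lt_irrefl, and_false, or_false, not_exists, not_and]
      by_cases h2 : ∃ s, (s < i ∨ s = i ∧ k < k) ∧ T.inB s k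
      · rw [if_pos h2, if_neg (fun h3 => this.1 h3 h2)]
      · rw [if_neg h2, if_pos (this.2 h2)]
    refine WP.seq (WP.set (by
      rw [hcell _ (f1 _ (by decide)) (f1 _ (by decide))]; exact hcellA)
      (by rw [hfv]; split_ifs <;> omega) ?_)
    rw [hcell _ (f1 _ (by decide)) (f1 _ (by decide)), hfv]
    set σ2 := σ1.upd .first (i * (T.n + T.m) + k) (if T.first i k then 1 else 0) with hσ2
    have f2 : ∀ a, a ≠ .pw → a ≠ .first → σ2 a = σ a := fun a h1 h2 => by
      rw [hσ2, St.upd_ne _ h2, f1 a h1]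
    have v2 : (Code.rd .v).eval I σ2 = k := by
      rw [Code.eval_rd, f2 .v (by decide) (by decide), hσk]
    refine WP.seq (WP.set (by rw [v2]; exact hkA) (by simp; omega) ?_)
    rw [v2, AExpr.eval_ofNat]
    set σ3 := σ2.upd .seen k 1 with hσ3
    have f3 : ∀ a, a ≠ .pw → a ≠ .first → a ≠ .seen → σ3 a = σ a := fun a h1 h2 h3 => by
      rw [hσ3, St.upd_ne _ h3, f2 a h1 h2]
    have c3 : (2 * Code.rd .cnt).eval I σ3 = 2 ^ Nat.count (T.inB i) k * 2 := by
      rw [AExpr.eval_mul, Code.eval_rd, f3 .cnt (by decide) (by decide) (by decide), hc,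
        AExpr.eval_ofNat, mul_comm]
    refine WP.seq (WP.set (by simp; omega) (by rw [c3]; exact hpV) ?_)
    rw [c3, AExpr.eval_ofNat]
    set σ4 := σ3.upd .cnt 0 (2 ^ Nat.count (T.inB i) k * 2) with hσ4
    have z4 : (Code.rd .z + 1).eval I σ4 = Nat.count (T.inB i) k + 1 := by
      rw [AExpr.eval_add, Code.eval_rd, hσ4, St.upd_ne _ (by decide),
        f3 .z (by decide) (by decide) (by decide), hz, AExpr.eval_ofNat]
    refine WP.set (by simp; omega) (by rw [z4]; omega) ?_
    rw [z4, AExpr.eval_ofNat]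
    refine ⟨?_, by rw [St.upd_ne _ (by decide), hσ4, St.upd_same, pow_succ], by rw [St.upd_same]⟩
    have e1 : (σ4.upd .z 0 (Nat.count (T.inB i) k + 1)) .pw = σ1 .pw := by
      rw [St.upd_ne _ (by decide), hσ4, St.upd_ne _ (by decide), hσ3, St.upd_ne _ (by decide), hσ2,
        St.upd_ne _ (by decide)]
    have e2 : (σ4.upd .z 0 (Nat.count (T.inB i) k + 1)) .first = σ2 .first := by
      rw [St.upd_ne _ (by decide), hσ4, St.upd_ne _ (by decide), hσ3, St.upd_ne _ (by decide)]
    have e3 : (σ4.upd .z 0 (Nat.count (T.inB i) k + 1)) .seen = σ3 .seen := by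
      rw [St.upd_ne _ (by decide), hσ4, St.upd_ne _ (by decide)]
    constructor
    · intro t v hv
      rw [e1]
      by_cases h2 : t * (T.n + T.m) + v = i * (T.n + T.m) + k
      · obtain ⟨rfl, rfl⟩ := mul_add_inj hv hk h2
        rw [hσ1, St.upd_same, if_pos (by omega), Inst.pw, if_pos hb]
      · rw [hσ1, St.upd_of_ne _ _ h2, h.pw t v hv]
        simp only [scanned_succ h2]
    · intro t v hv
      rw [e2]
      by_cases h2 : t * (T.n + T.m) + v = i * (T.n + T.m) + k
      · obtain ⟨rfl, rfl⟩ := mul_add_inj hv hk h2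
        rw [hσ2, St.upd_same]
        exact if_congr ⟨fun h3 => ⟨by omega, h3⟩, fun h3 => h3.2⟩ rfl rfl
      · rw [hσ2, St.upd_of_ne _ _ h2, f1 .first (by decide), h.first t v hv]
        simp only [scanned_succ h2]
    · intro v hv
      rw [e3]
      by_cases h2 : v = k
      · subst h2
        rw [hσ3, St.upd_same, if_pos ⟨i, by omega, hb⟩]
      · rw [hσ3, St.upd_of_ne _ _ h2, f2 .seen (by decide) (by decide), h.seen v hv]
        refine if_congr (exists_congr fun s => ?_) rfl rfl
        have : (s < i ∨ s = i ∧ v < k + 1) ↔ (s < i ∨ s = i ∧ v < k) := by omega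
        simp only [this]
  · have hb : ¬ T.inB i k := fun hb => by rw [hcond, if_pos hb] at h1; omega
    refine (WP.set (by simp; omega) (by simp; omega) ?_).mono (show 1 ≤ 5 by omega) fun _ h => h
    rw [Nat.count_succ, if_neg hb, add_zero, St.upd_ne _ (by decide), St.upd_ne _ (by decide)]
    exact ⟨(h.skip hk hb).congr (St.upd_ne _ (by decide) _ _) (St.upd_ne _ (by decide) _ _)
      (St.upd_ne _ (by decide) _ _), hc, hz⟩

theorem wp_scanBag (hI : T.Reads I) (hR : T.Room A V) {σ : St} {i : ℕ} (hi : i < T.N)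
    (hσi : σ .i 0 = i) (h : T.Scanned i 0 σ) (hf : ∀ t < i, σ .full t = T.full t)
    (hw : σ .w 0 = (Finset.range i).sup T.bagSize) :
    WP I A V Code.scanBag σ ((T.n + T.m) * 8 + 7) fun τ => T.Scanned (i + 1) 0 τ ∧
      (∀ t < i + 1, τ .full t = T.full t) ∧ τ .w 0 = (Finset.range (i + 1)).sup T.bagSize := by
  have hNA := hR.N_A
  have hNV := hR.N_V
  have hzV : T.n + T.m < V := by
    refine lt_of_le_of_lt ?_ hR.Nv_V
    exact (Nat.le_succ _).trans (Nat.le_mul_of_pos_left _ (by omega))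
  have hcount : T.bagSize i ≤ T.n + T.m := Nat.count_le _
  refine (WP.seq (C := 1) (WP.set (by simp; omega) (by simp; omega) (WP.seq (C := 1)
    (WP.set (by simp; omega) (by simp; omega) (WP.seq (C' := 1 + (1 + 1)) ((WP.for (n := T.n + T.m)
      (C := 6) (fun k τ => T.Scanned i k τ ∧ τ .cnt 0 = 2 ^ Nat.count (T.inB i) k ∧
        τ .z 0 = Nat.count (T.inB i) k) (by omega) hzV (by simp [Code.scanVertex]) ?_ ?_ ?_).mono
      le_rfl ?_)))))).mono (by omega) fun _ h => h
  · intro τ _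
    simp only [AExpr.eval_add, Code.eval_nE, Code.eval_mE, hI.n, hI.m]
  · refine ⟨h.congr ?_ ?_ ?_, ?_, ?_⟩
    · rw [St.upd_ne _ (by decide), St.upd_ne _ (by decide), St.upd_ne _ (by decide)]
    · rw [St.upd_ne _ (by decide), St.upd_ne _ (by decide), St.upd_ne _ (by decide)]
    · rw [St.upd_ne _ (by decide), St.upd_ne _ (by decide), St.upd_ne _ (by decide)]
    · simp [St.upd]
    · simp [St.upd]
  · rintro k hk τ h1 h2 ⟨h3, h4, h5⟩
    have iτ : τ .i 0 = i := by
      rw [h1 .i (by simp [Code.scanVertex]) (by decide), St.upd_ne _ (by decide),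
        St.upd_ne _ (by decide), hσi]
    refine (wp_scanVertex hI hR hi hk iτ h2 h3 h4 h5).mono le_rfl ?_
    rintro υ ⟨q1, q2, q3⟩
    rw [St.upd_ne _ (by decide), St.upd_ne _ (by decide)]
    exact ⟨q1.congr (St.upd_ne _ (by decide) _ _) (St.upd_ne _ (by decide) _ _)
      (St.upd_ne _ (by decide) _ _), q2, q3⟩
  · rintro τ ⟨⟨h1, h2, h3⟩, h4, -⟩
    have iτ : τ .i 0 = i := by
      rw [h4 .i (by simp [Code.scanVertex]) (by decide), St.upd_ne _ (by decide),
        St.upd_ne _ (by decide), hσi]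
    have wτ : τ .w = σ .w := by
      rw [h4 .w (by simp [Code.scanVertex]) (by decide), St.upd_ne _ (by decide),
        St.upd_ne _ (by decide)]
    have fτ : τ .full = σ .full := by
      rw [h4 .full (by simp [Code.scanVertex]) (by decide), St.upd_ne _ (by decide),
        St.upd_ne _ (by decide)]
    -- All vertices of the bag `i` scanned and none of the bag `i + 1` scanned: the same set of
    -- cells.
    have hsc : T.Scanned (i + 1) 0 τ := by
      constructor
      · intro t v hv
        rw [h1.pw t v hv]
        exact if_congr (by omega) rfl rfl
      · intro t v hv
        rw [h1.first t v hv]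
        exact if_congr (and_congr_left fun _ => by omega) rfl rfl
      · intro v hv
        rw [h1.seen v hv]
        exact if_congr (exists_congr fun s => and_congr_left fun _ => by omega) rfl rfl
    refine WP.seq (WP.set (by rw [Code.eval_rd, iτ]; omega) (by
      rw [Code.eval_rd, h2]
      exact lt_of_le_of_lt (Nat.pow_le_pow_right two_pos hcount) hR.pow_V) ?_)
    rw [Code.eval_rd, Code.eval_rd, iτ, h2]
    set τ1 := τ.upd .full i (2 ^ Nat.count (T.inB i) (T.n + T.m)) with hτ1
    have f1 : ∀ a, a ≠ .full → τ1 a = τ a := fun a ha => St.upd_ne _ ha _ _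
    have hsc1 : T.Scanned (i + 1) 0 τ1 :=
      hsc.congr (f1 _ (by decide)) (f1 _ (by decide)) (f1 _ (by decide))
    have hf1 : ∀ t < i + 1, τ1 .full t = T.full t := fun t ht => by
      by_cases h5 : t = i
      · rw [h5, hτ1, St.upd_same]; rfl
      · rw [hτ1, St.upd_of_ne _ _ h5, fτ]; exact hf t (by omega)
    have hsup : (Finset.range (i + 1)).sup T.bagSize = max (T.bagSize i) (τ .w 0) := by
      rw [Finset.range_add_one, Finset.sup_insert, wτ, hw]
    have hcond : (AExpr.lt (Code.rd .w) (Code.rd .z)).eval I τ1 =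
        if τ .w 0 < T.bagSize i then 1 else 0 := by
      rw [AExpr.eval_lt, Code.eval_rd, Code.eval_rd, f1 .w (by decide), f1 .z (by decide), h3]; rfl
    refine WP.ite (fun h5 => ?_) (fun h5 => ?_)
    · have h6 : τ .w 0 < T.bagSize i := by
        by_contra h6; rw [hcond, if_neg h6] at h5; exact h5 rfl
      have hz1 : (Code.rd .z).eval I τ1 = T.bagSize i := by
        rw [Code.eval_rd, f1 .z (by decide), h3]; rfl
      refine WP.set (by simp; omega) (by rw [hz1]; omega) ?_
      rw [hz1, AExpr.eval_ofNat, St.upd_ne _ (show Arr.full ≠ Arr.w by decide), St.upd_same, hsup,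
        max_eq_left h6.le]
      exact ⟨hsc1.congr (St.upd_ne _ (by decide) _ _) (St.upd_ne _ (by decide) _ _)
        (St.upd_ne _ (by decide) _ _), hf1, rfl⟩
    · have h6 : ¬ τ .w 0 < T.bagSize i := fun h6 => by rw [hcond, if_pos h6] at h5; omega
      refine WP.set (by simp; omega) (by simp; omega) ?_
      rw [St.upd_ne _ (show Arr.full ≠ Arr.f by decide), St.upd_ne _ (show Arr.w ≠ Arr.f by decide),
        hsup, max_eq_right (by omega), f1 .w (by decide)]
      exact ⟨hsc1.congr (St.upd_ne _ (by decide) _ _) (St.upd_ne _ (by decide) _ _)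
        (St.upd_ne _ (by decide) _ _), hf1, rfl⟩

theorem wp_bags (hI : T.Reads I) (hR : T.Room A V) {σ : St} (h1 : σ .pw = 0) (h2 : σ .first = 0)
    (h3 : σ .seen = 0) (h4 : σ .w 0 = 0) :
    WP I A V Code.bags σ (T.N * ((T.n + T.m) * 8 + 9) + 2) fun τ =>
      (∀ t ≤ T.N, ∀ v < T.n + T.m, τ .pw (t * (T.n + T.m) + v) = T.pw t v) ∧
      (∀ t < T.N, ∀ v < T.n + T.m, τ .first (t * (T.n + T.m) + v) = if T.first t v then 1 else 0) ∧
      (∀ t < T.N, τ .full t = T.full t) ∧ τ .w 0 = T.maxBag := by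
  have hNA := hR.N_A
  have hNV := hR.N_V
  refine (WP.for (n := T.N) (C := (T.n + T.m) * 8 + 7) (fun k τ => T.Scanned k 0 τ ∧
      (∀ t < k, τ .full t = T.full t) ∧ τ .w 0 = (Finset.range k).sup T.bagSize) (by omega)
      (by omega) (by simp [Code.scanBag, Code.scanVertex]) ?_ ?_ ?_).mono le_rfl ?_
  · intro τ _; exact hI.N
  · refine ⟨⟨fun t v _ => ?_, fun t v _ => ?_, fun v _ => ?_⟩, fun t ht => absurd ht (by omega), ?_⟩
    · rw [St.upd_ne _ (by decide), h1, if_neg (by omega)]; rfl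
    · rw [St.upd_ne _ (by decide), h2, if_neg (by omega)]; rfl
    · rw [St.upd_ne _ (by decide), h3, if_neg]
      · rfl
      · rintro ⟨s, h5, -⟩; omega
    · rw [St.upd_ne _ (by decide), h4]; rfl
  · rintro k hk τ - q2 ⟨q3, q4, q5⟩
    refine (wp_scanBag hI hR hk q2 q3 q4 q5).mono le_rfl ?_
    rintro υ ⟨k1, k2, k3⟩
    rw [St.upd_ne _ (show Arr.full ≠ Arr.i by decide), St.upd_ne _ (show Arr.w ≠ Arr.i by decide)]
    exact ⟨k1.congr (St.upd_ne _ (by decide) _ _) (St.upd_ne _ (by decide) _ _)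
      (St.upd_ne _ (by decide) _ _), k2, k3⟩
  · rintro τ ⟨⟨q1, q2, q3⟩, -, -⟩
    refine ⟨fun t ht v hv => ?_, fun t ht v hv => ?_, q2, q3⟩
    · rw [q1.pw t v hv]
      split_ifs with h5
      · rfl
      -- The row of the missing node `N` was never written; its zeros say that its bag is empty.
      · rw [Inst.pw, if_neg fun h6 => h5 (Or.inl (T.inB_lt h6).1)]
    · rw [q1.first t v hv]
      exact if_congr (and_iff_right (Or.inl ht)) rfl rfl

theorem wp_pow2 (hA : 0 < A) {σ : St} {x : Arr} {e : AExpr} {n : ℕ} (hx : x ≠ .i)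
    (he : ∀ τ : St, (∀ a, a ≠ x → a ≠ .i → τ a = σ a) → e.eval I τ = n) (hV : 2 ^ n < V) :
    WP I A V (Code.pow2 x e) σ (n * 3 + 3) fun τ => τ x 0 = 2 ^ n := by
  have hn : n < V := n.lt_two_pow_self.trans hV
  refine (WP.seq (C := 1) (WP.set (by simpa using hA) (by
    have := Nat.one_le_two_pow (n := n); simp; omega) ((WP.for (n := n) (C := 1)
    (fun k τ => τ x 0 = 2 ^ k) hA hn (by simpa using hx.symm) ?_ ?_ ?_).mono le_rfl ?_))).mono
    (by omega) fun _ h => h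
  · intro τ h1
    exact he τ fun a h2 h3 => by rw [h1 a (by simpa using h2) h3, St.upd_ne _ h2]
  · rw [St.upd_ne _ hx]; simp
  · intro k hk τ h1 h2 h3
    have hv : (2 * Code.rd x).eval I τ = 2 ^ (k + 1) := by
      rw [AExpr.eval_mul, Code.eval_rd, h3, AExpr.eval_ofNat, pow_succ, mul_comm]
    refine WP.set (by simpa using hA) (by
      rw [hv]; exact lt_of_le_of_lt (Nat.pow_le_pow_right two_pos hk) hV) ?_
    rw [hv, AExpr.eval_ofNat, St.upd_ne _ hx, St.upd_same]
  · rintro τ ⟨h1, -, -⟩; exact h1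

end Inst
-- The whole program, its memory and its number of steps
namespace Code
open AExpr

def shareE (a b : ℕ) : AExpr := lit a * rd .w / lit b

def prepare (a b : ℕ) : Cmd := .seq rooting (.seq sizes (.seq hierarchy (.seq bags
  (.seq (pow2 .M nE) (.seq (.set .M 0 (rd .M + 1)) (.seq (pow2 .Q (shareE a b))
  (pow2 .Y (rd .w - shareE a b))))))))

/-- The algorithm. The share `a / b` of the bits of a state is tabulated, and the others are tried
one after the other. -/
def program (a b : ℕ) : Cmd := .seq (prepare a b) (.seq mainLoop
  (.set .out 0 (nz (mod (arr .Tab ((NE - 1) * (rd .Q * rd .Q))) (rd .M)))))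

theorem writes_prepare {a b : ℕ} {x : Arr} : (prepare a b).writes x →
    x ≠ .ptr ∧ x ≠ .br ∧ x ≠ .Tab ∧ x ≠ .out := by
  simp only [prepare, Cmd.writes, writes_rooting, writes_sizes, writes_hierarchy, writes_bags,
    writes_pow2]
  cases x <;> simp

end Code

namespace Inst
open Classical

variable {T : Inst} {I : List ℕ} {A V : ℕ} {anc : ℕ → ℕ → Prop} {rk : ℕ → ℕ}

/-- The number of cells that every array needs. -/
def cells (T : Inst) (q : ℕ) : ℕ :=
  (T.N + 1) * (T.N + 1 + (T.n + T.m)) + T.N * (2 ^ q * 2 ^ q)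

/-- The length of the contents of the cells. -/
def valueSize (T : Inst) : ℕ := 2 * (T.n + T.m) + 2 * T.N + 8

/-- The bound on values is generous: it factors into powers of two that dominate `N`, `n + m` and
the numbers of states, so all the size conditions become comparisons of products. -/
theorem valueSize_bound (T : Inst) :
    256 * (2 ^ (T.n + T.m) * 2 ^ (T.n + T.m)) * (2 ^ T.N * 2 ^ T.N) = 2 ^ T.valueSize := by
  rw [valueSize, ← pow_add, ← pow_add, show (256 : ℕ) = 2 ^ 8 by norm_num, ← pow_add, ← pow_add]
  congr 1; ring

theorem room (T : Inst) (q : ℕ) : T.Room (T.cells q) (2 ^ T.valueSize) := by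
  have h0 := T.valueSize_bound
  have h1 : T.N + 1 ≤ 2 ^ T.N := T.N.lt_two_pow_self
  have h2 : T.n + T.m + 1 ≤ 2 ^ (T.n + T.m) := (T.n + T.m).lt_two_pow_self
  have h3 : 1 ≤ 2 ^ (T.n + T.m) := Nat.one_le_two_pow
  have h4 : 1 ≤ 2 ^ T.N := Nat.one_le_two_pow
  set x := 2 ^ (T.n + T.m)
  set y := 2 ^ T.N
  have h5 : 1 ≤ x * x := Nat.mul_le_mul h3 h3
  have h6 : 1 ≤ y * y := Nat.mul_le_mul h4 h4
  have h7 : x ≤ x * x := Nat.le_mul_of_pos_left _ h3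
  have h8 : y ≤ y * y := Nat.le_mul_of_pos_left _ h4
  have h9 : (T.N + 1) * (T.N + 1) ≤ y * y := Nat.mul_le_mul h1 h1
  constructor
  · rw [cells]; nlinarith
  · rw [cells]; nlinarith
  · rw [← h0]; nlinarith
  · rw [← h0]
    calc (T.N + 1) * (T.n + T.m + 1) ≤ y * x := Nat.mul_le_mul h1 h2
      _ ≤ (y * y) * (x * x) := Nat.mul_le_mul h8 h7
      _ < 256 * (x * x) * (y * y) := by nlinarith
  · rw [← h0]
    calc x ≤ x * x * (y * y) := h7.trans (Nat.le_mul_of_pos_right _ h6)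
      _ < 256 * (x * x) * (y * y) := by nlinarith

theorem bounds {D : Tables} {q k : ℕ} (hM : D.M = 2 ^ T.n + 1) (hQ : D.Q = 2 ^ q)
    (hY : D.Y = 2 ^ k) (hq : q ≤ T.n + T.m) (hk : k ≤ T.n + T.m) :
    T.Bounds D (T.cells q) (2 ^ T.valueSize) := by
  have h0 := T.valueSize_bound
  have hR := T.room q
  have h1 : T.N + 1 ≤ 2 ^ T.N := T.N.lt_two_pow_self
  have h2 : T.n + T.m + 1 ≤ 2 ^ (T.n + T.m) := (T.n + T.m).lt_two_pow_self
  have h4 : 1 ≤ 2 ^ T.N := Nat.one_le_two_pow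
  have h3 : 1 ≤ 2 ^ (T.n + T.m) := Nat.one_le_two_pow
  have hp : ∀ j ≤ T.n + T.m, 2 ^ j ≤ 2 ^ (T.n + T.m) := fun j => Nat.pow_le_pow_right two_pos
  have h10 := hp T.n (by omega)
  have h11 := hp q hq
  have h12 := hp k hk
  set x := 2 ^ (T.n + T.m)
  set y := 2 ^ T.N
  have h6 : 1 ≤ y * y := Nat.mul_le_mul h4 h4
  have h7 : x ≤ x * x := Nat.le_mul_of_pos_left _ h3
  have key : ∀ z, z < 256 * (x * x) → z < 2 ^ T.valueSize := fun z hz => by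
    rw [← h0]; exact hz.trans_le (Nat.le_mul_of_pos_right _ h6)
  have h13 : 2 ^ q * 2 ^ q ≤ x * x := Nat.mul_le_mul h11 h11
  constructor
  · rw [hQ, cells]; omega
  · exact hR.N_A
  · rw [hM]; exact (key _ (by omega)).le
  · rw [hQ]; exact key _ (by omega)
  · rw [hY]; exact key _ (by omega)
  · have := hR.N_V; omega
  · exact key _ (by omega)
  · refine key _ ?_
    have : T.m * T.n ≤ x * x := Nat.mul_le_mul (by omega) (by omega)
    omega

theorem full_le (T : Inst) {t : ℕ} (ht : t < T.N) : T.full t ≤ 2 ^ T.maxBag :=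
  Nat.pow_le_pow_right two_pos (Finset.le_sup (f := T.bagSize) (Finset.mem_range.2 ht))

theorem maxBag_le (T : Inst) : T.maxBag ≤ T.n + T.m := Finset.sup_le fun _ _ => Nat.count_le _

/-- The cost of the preparations. -/
def prepareCost (T : Inst) : ℕ :=
  T.N * (T.N * T.N * (3 * T.N + 7) + 4) + 4 + (T.N * (3 * T.N + 6) + 2 + (T.N * (11 * T.N + 16) + 4 +
    (T.N * ((T.n + T.m) * 8 + 9) + 2 + ((T.n * 3 + 3) + (1 + (((T.n + T.m) * 3 + 3) +
      ((T.n + T.m) * 3 + 3)))))))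

theorem wp_prepare (hI : T.Reads I) {a b : ℕ} (hab : a ≤ b) :
    WP I (T.cells (a * T.maxBag / b)) (2 ^ T.valueSize) (Code.prepare a b) (fun _ _ => 0)
      T.prepareCost fun τ => ∃ D anc rk, T.Good I D anc rk ∧ D.Ready τ ∧
        D.Q = 2 ^ (a * T.maxBag / b) ∧ D.Y = 2 ^ (T.maxBag - a * T.maxBag / b) := by
  set W := T.maxBag with hW
  set q := a * W / b with hq
  have hWnm : W ≤ T.n + T.m := T.maxBag_le
  have hqW : q ≤ W := Nat.div_le_of_le_mul (Nat.mul_le_mul_right W hab)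
  have hWq : W - q ≤ T.n + T.m := (Nat.sub_le _ _).trans hWnm
  have hR := T.room q
  have hA : 0 < T.cells q := by have := hR.N_A; omega
  have hpow : ∀ k ≤ T.n + T.m, 2 ^ k < 2 ^ T.valueSize := fun k hk =>
    Nat.pow_lt_pow_right one_lt_two (by unfold valueSize; omega)
  unfold Code.prepare prepareCost
  refine WP.seq ((wp_rooting hI hR rfl).frame.mono le_rfl ?_)
  rintro σ1 ⟨⟨anc, rk, h1, h2⟩, f1⟩
  simp only [Code.writes_rooting] at f1
  refine WP.seq ((wp_sizes hI hR h1 h2 (f1 _ (by decide))).frame.mono le_rfl ?_)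
  rintro σ2 ⟨h3, f2⟩
  simp only [Code.writes_sizes] at f2
  refine WP.seq ((wp_hierarchy hI hR h3).frame.mono le_rfl ?_)
  rintro σ3 ⟨h4, f3⟩
  simp only [Code.writes_hierarchy] at f3
  have z3 : ∀ x : Arr, x = .pw ∨ x = .first ∨ x = .seen ∨ x = .w → σ3 x = fun _ => 0 := by
    rintro x (rfl | rfl | rfl | rfl) <;>
      rw [f3 _ (by decide), f2 _ (by decide), f1 _ (by decide)]
  have h3' : T.Tree anc rk σ3 := h3.congr (f3 _ (by decide)) (f3 _ (by decide)) (f3 _ (by decide))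
  refine WP.seq ((wp_bags hI hR (z3 _ (by decide)) (z3 _ (by decide)) (z3 _ (by decide))
    (by rw [z3 _ (by decide)])).frame.mono le_rfl ?_)
  rintro σ4 ⟨⟨h5, h6, h7, h8⟩, f4⟩
  simp only [Code.writes_bags] at f4
  have h3'' : T.Tree anc rk σ4 := h3'.congr (f4 _ (by decide)) (f4 _ (by decide)) (f4 _ (by decide))
  rw [← f4 .R (by decide), ← f4 .B (by decide), ← f4 .par (by decide), ← f4 .U (by decide)] at h4
  refine WP.seq ((wp_pow2 (n := T.n) hA (by decide) (fun τ _ => by rw [Code.eval_nE, hI.n]) (hpow _ (by omega))).frame.mono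
    le_rfl ?_)
  rintro σ5 ⟨h9, f5⟩
  simp only [Code.writes_pow2] at f5
  have hMv : (Code.rd .M + 1).eval I σ5 = 2 ^ T.n + 1 := by
    rw [AExpr.eval_add, Code.eval_rd, h9, AExpr.eval_ofNat]
  refine WP.seq (WP.set (by simpa using hA) (by
    rw [hMv]
    have h10 := hpow (T.n + T.m) le_rfl
    have h11 : 2 ^ (T.n + 1) ≤ 2 ^ T.valueSize :=
      Nat.pow_le_pow_right two_pos (by unfold valueSize; omega)
    have h12 := Nat.one_le_two_pow (n := T.n)
    rw [pow_succ] at h11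
    have h13 : 2 ^ (T.n + 2) ≤ 2 ^ T.valueSize :=
      Nat.pow_le_pow_right two_pos (by unfold valueSize; omega)
    rw [pow_add] at h13
    omega) ?_)
  rw [hMv, AExpr.eval_ofNat]
  set σ6 := σ5.upd .M 0 (2 ^ T.n + 1) with hσ6
  have f6 : ∀ x : Arr, x ≠ .M → x ≠ .i → σ6 x = σ4 x := fun x h1 h2 => by
    rw [hσ6, St.upd_ne _ h1, f5 x (by simp [h1, h2])]
  have w6 : σ6 .w 0 = W := by rw [f6 _ (by decide) (by decide), h8]
  have hsh : ∀ τ : St, τ .w = σ6 .w → (Code.shareE a b).eval I τ = q := fun τ hτ => by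
    simp only [Code.shareE, AExpr.eval_div, AExpr.eval_mul, AExpr.eval_lit, Code.eval_rd, hτ, w6, hq]
  refine WP.seq ((wp_pow2 (n := q) hA (by decide) (fun τ hτ => hsh τ (hτ _ (by decide) (by decide)))
    (hpow _ (by omega))).frame.mono (by omega) ?_)
  rintro σ7 ⟨h10, f7⟩
  simp only [Code.writes_pow2] at f7
  have w7 : σ7 .w = σ6 .w := f7 _ (by decide)
  refine (wp_pow2 (n := W - q) hA (by decide) (fun τ hτ => ?_) (hpow _ hWq)).frame.mono
    (by gcongr) ?_
  · have := hτ .w (by decide) (by decide)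
    rw [AExpr.eval_sub, hsh τ (by rw [this, w7]), Code.eval_rd, this, w7, w6]
  rintro σ8 ⟨h11, f8⟩
  simp only [Code.writes_pow2] at f8
  have e8 : ∀ x : Arr, x ≠ .Y → x ≠ .Q → x ≠ .M → x ≠ .i → σ8 x = σ4 x := fun x q1 q2 q3 q4 => by
    rw [f8 x (by simp [q1, q4]), f7 x (by simp [q2, q4]), f6 x q3 q4]
  have M8 : σ8 .M 0 = 2 ^ T.n + 1 := by
    rw [f8 _ (by decide), f7 _ (by decide), hσ6, St.upd_same]
  have Q8 : σ8 .Q 0 = 2 ^ q := by rw [f8 _ (by decide), h10]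
  refine ⟨⟨σ4 .par, σ4 .U, σ4 .R, σ4 .B, σ4 .sz, σ4 .pw, σ4 .first, σ4 .full, 2 ^ T.n + 1, 2 ^ q,
    2 ^ (W - q)⟩, anc, rk, ?_, ?_, rfl, rfl⟩
  · exact
      { reads := hI
        rooted := h3''.rooted
        layout := h4
        sz := h3''.sz
        pw := h5
        first := h6
        full := h7
        M := rfl
        Q_pos := by positivity
        Y_pos := by positivity
        le := fun t ht => by
          rw [← pow_add, Nat.sub_add_cancel hqW]; exact T.full_le ht }
  · exact
      { par := e8 _ (by decide) (by decide) (by decide) (by decide)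
        U := e8 _ (by decide) (by decide) (by decide) (by decide)
        R := e8 _ (by decide) (by decide) (by decide) (by decide)
        B := e8 _ (by decide) (by decide) (by decide) (by decide)
        sz := e8 _ (by decide) (by decide) (by decide) (by decide)
        pw := e8 _ (by decide) (by decide) (by decide) (by decide)
        first := e8 _ (by decide) (by decide) (by decide) (by decide)
        full := e8 _ (by decide) (by decide) (by decide) (by decide)
        M := M8
        Q := Q8
        Y := h11 }

/-- The number of steps of the algorithm, up to a constant factor. -/
noncomputable def stepBound (T : Inst) (q d : ℕ) : ℕ :=
  (T.n + T.m + T.N) ^ 4 * (2 ^ q) ^ 3 * (2 ^ (T.maxBag - q)) ^ d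

/-- There are `Q ^ 2` entries, each a sum over the `Q` low parts of the split state, with a
quadratic cost per summand. -/
theorem roundCost_le {D : Tables} (hQ : 0 < D.Q) :
    T.roundCost D ≤ 40 * (T.n + T.m + T.N) ^ 2 * D.Q ^ 3 := by
  have hN := T.N_pos
  set S := T.n + T.m + T.N with hS
  have hinner : T.innerCost ≤ 16 * S ^ 2 + 10 := by
    have h1 : T.m * T.n ≤ S ^ 2 := by rw [pow_two]; exact Nat.mul_le_mul (by omega) (by omega)
    have h2 : S ≤ S ^ 2 := Nat.le_self_pow (by norm_num) S
    unfold innerCost; omega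
  have h3 : 1 ≤ S ^ 2 := Nat.one_le_pow _ _ (by omega)
  have h4 : D.Q * D.Q ≤ D.Q ^ 3 := by
    calc D.Q * D.Q ≤ D.Q * D.Q * D.Q := Nat.le_mul_of_pos_right _ hQ
      _ = D.Q ^ 3 := by ring
  have h5 : 1 ≤ D.Q ^ 3 := Nat.one_le_pow _ _ hQ
  calc T.roundCost D = D.Q ^ 3 * (T.innerCost + 2) + 6 * (D.Q * D.Q) + 6 := by
        unfold roundCost combineCost; ring
    _ ≤ D.Q ^ 3 * (28 * S ^ 2) + 6 * (D.Q ^ 3 * S ^ 2) + 6 * (D.Q ^ 3 * S ^ 2) := by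
        have h6 : T.innerCost + 2 ≤ 28 * S ^ 2 := by omega
        have h7 : D.Q ^ 3 ≤ D.Q ^ 3 * S ^ 2 := Nat.le_mul_of_pos_right _ h3
        have h8 : D.Q * D.Q ≤ D.Q ^ 3 * S ^ 2 := h4.trans h7
        have h9 : 1 ≤ D.Q ^ 3 * S ^ 2 := Nat.mul_le_mul h5 h3
        have h10 := Nat.mul_le_mul_left (D.Q ^ 3) h6
        omega
    _ = 40 * S ^ 2 * D.Q ^ 3 := by ring

theorem prepareCost_le : T.prepareCost ≤ 150 * (T.n + T.m + T.N) ^ 4 := by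
  have hN := T.N_pos
  set S := T.n + T.m + T.N with hS
  have hS1 : 1 ≤ S := by omega
  have h1 : S ≤ S ^ 4 := Nat.le_self_pow (by norm_num) S
  have h2 : T.N * T.N ≤ S ^ 4 := by
    calc T.N * T.N ≤ S * S := Nat.mul_le_mul (by omega) (by omega)
      _ = S ^ 2 := by ring
      _ ≤ S ^ 4 := Nat.pow_le_pow_right hS1 (by norm_num)
  have h3 : T.N * (T.n + T.m) ≤ S ^ 4 := by
    calc T.N * (T.n + T.m) ≤ S * S := Nat.mul_le_mul (by omega) (by omega)
      _ = S ^ 2 := by ring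
      _ ≤ S ^ 4 := Nat.pow_le_pow_right hS1 (by norm_num)
  have h4 : T.N ^ 3 ≤ S ^ 4 := by
    calc T.N ^ 3 ≤ S ^ 3 := Nat.pow_le_pow_left (by omega) 3
      _ ≤ S ^ 4 := Nat.pow_le_pow_right hS1 (by norm_num)
  have h5 : T.N ^ 4 ≤ S ^ 4 := Nat.pow_le_pow_left (by omega) 4
  have e : T.prepareCost = 3 * T.N ^ 4 + 7 * T.N ^ 3 + 14 * (T.N * T.N) + 8 * (T.N * (T.n + T.m)) +
      35 * T.N + 6 * (T.n + T.m) + 3 * T.n + 22 := by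
    unfold prepareCost; ring
  rw [e]
  omega

theorem wp_program (hI : T.Reads I) {a b d : ℕ} (hab : a ≤ b)
    (hd : T.N * 5 ^ d < 8 ^ d) :
    WP I (T.cells (a * T.maxBag / b)) (2 ^ T.valueSize) (Code.program a b) (fun _ _ => 0)
      (200 * T.stepBound (a * T.maxBag / b) d) fun τ =>
        τ .out 0 = if T.models.card = 0 then 0 else 1 := by
  set q := a * T.maxBag / b with hq
  have hWnm : T.maxBag ≤ T.n + T.m := T.maxBag_le
  have hqW : q ≤ T.maxBag := Nat.div_le_of_le_mul (Nat.mul_le_mul_right _ hab)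
  have hN := T.N_pos
  set S := T.n + T.m + T.N with hS
  have hcost : T.prepareCost + (40 * T.stepBound q d + 1 + 1) ≤ 200 * T.stepBound q d := by
    have h1 : T.prepareCost ≤ 150 * S ^ 4 := prepareCost_le
    have h2 : S ^ 4 ≤ T.stepBound q d := by
      unfold stepBound
      rw [mul_assoc]
      exact Nat.le_mul_of_pos_right _ (by positivity)
    have h3 : 1 ≤ S ^ 4 := Nat.one_le_pow _ _ (by omega)
    omega
  refine (WP.seq ((wp_prepare hI hab).frame.mono le_rfl ?_)).mono hcost fun _ h => h
  rintro σ ⟨⟨D, anc, rk, G, hσ, hQ, hY⟩, f1⟩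
  have hz : ∀ x : Arr, x = .ptr ∨ x = .br → σ x = fun _ => 0 := fun x hx =>
    f1 x fun h1 => by
      have h2 := Code.writes_prepare h1
      rcases hx with rfl | rfl <;> simp at h2
  have Bd := bounds (T := T) G.M hQ hY (by omega) ((Nat.sub_le _ _).trans hWnm)
  -- The whole tree is a component without bottom of size `N`.
  have hsmall : T.Small anc d 0 T.N := by
    refine Or.inl ⟨rfl, ?_⟩
    rwa [G.rooted.size_zero, G.rooted.size_none, Nat.sub_zero]
  refine WP.seq ((G.wp_mainLoop Bd hsmall hσ (by rw [hz _ (Or.inl rfl)])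
    (fun t _ => by rw [hz _ (Or.inr rfl)])).mono ?_ ?_)
  · refine Nat.add_le_add_right ?_ 1
    calc T.N * D.Y ^ d * T.roundCost D ≤ T.N * D.Y ^ d * (40 * S ^ 2 * D.Q ^ 3) :=
          Nat.mul_le_mul_left _ (roundCost_le G.Q_pos)
      _ = T.N * S ^ 2 * (40 * (D.Q ^ 3 * D.Y ^ d)) := by ring
      _ ≤ S ^ 4 * (40 * (D.Q ^ 3 * D.Y ^ d)) := by
          refine Nat.mul_le_mul_right _ ?_
          calc T.N * S ^ 2 ≤ S * S ^ 2 := Nat.mul_le_mul_right _ (by omega)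
            _ = S ^ 3 := by ring
            _ ≤ S ^ 4 := Nat.pow_le_pow_right (by omega) (by norm_num)
      _ = 40 * T.stepBound q d := by rw [stepBound, ← hS, hQ, hY]; ring
  · rintro τ ⟨hτ, h1⟩
    have hM1 := T.card_models_le
    have hval : (AExpr.nz (AExpr.mod (.arr .Tab ((Code.NE - 1) * (Code.rd .Q * Code.rd .Q)))
        (Code.rd .M))).eval I τ = if T.models.card = 0 then 0 else 1 := by
      simp only [AExpr.eval_nz, AExpr.eval_mod, AExpr.eval_arr, AExpr.eval_mul, AExpr.eval_sub,
        Code.eval_NE, Code.eval_rd, AExpr.eval_ofNat, hI.N, hτ.Q, hτ.M]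
      refine if_congr ?_ rfl rfl
      rw [← Nat.dvd_iff_mod_eq_zero, ← ZMod.natCast_eq_zero_iff, h1, ZMod.natCast_eq_zero_iff]
      refine ⟨fun h2 => ?_, fun h2 => by rw [h2]; exact dvd_zero _⟩
      -- The number of satisfying assignments is at most `2 ^ n`, hence below `M`, so it is 0 if it
      -- is 0 modulo `M`.
      by_contra h3
      have := Nat.le_of_dvd (Nat.pos_of_ne_zero h3) h2
      rw [G.M] at this
      omega
    refine WP.set ?_ ?_ ?_
    · have := Bd.N_A; simp; omega
    · rw [hval]; have := Bd.N_V; split_ifs <;> omega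
    · rw [hval, AExpr.eval_ofNat, St.upd_same]

end Inst

/-! ## The instance that is given by a formula and a tree decomposition -/

section
variable {n m N : ℕ} (φ : CNF n m) (D : TreeDecomposition φ.incidenceGraph N)

theorem matrixBits_getD {r s : ℕ} (R : Fin r → Fin s → Prop) {i j : ℕ} (hi : i < r) (hj : j < s)
    {Q : Prop} [Decidable Q] (hQ : R ⟨i, hi⟩ ⟨j, hj⟩ ↔ Q) :
    (matrixBits R).getD (i * s + j) 0 = if Q then 1 else 0 := by
  have h := mul_add_lt hi hj
  have h1 : (i * s + j) / s = i := by
    rw [mul_comm, Nat.mul_add_div (by omega), Nat.div_eq_of_lt hj, add_zero]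
  have h2 : (i * s + j) % s = j := by rw [mul_comm, Nat.mul_add_mod, Nat.mod_eq_of_lt hj]
  rw [matrixBits, List.getD_eq_getElem _ _ (by simpa using h), List.getElem_ofFn, bit]
  have h3 : (⟨i * s + j, h⟩ : Fin (r * s)).divNat = ⟨i, hi⟩ := Fin.ext h1
  have h4 : (⟨i * s + j, h⟩ : Fin (r * s)).modNat = ⟨j, hj⟩ := Fin.ext h2
  rw [h3, h4]
  by_cases h5 : Q
  · rw [if_pos h5, if_pos (hQ.2 h5)]
  · rw [if_neg h5, if_neg fun h6 => h5 (hQ.1 h6)]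

@[simp] theorem length_matrixBits {r s : ℕ} (R : Fin r → Fin s → Prop) :
    (matrixBits R).length = r * s := by simp [matrixBits]

theorem getD_append_add {l l' : List ℕ} {k x : ℕ} (h : l.length = k) :
    (l ++ l').getD (k + x) 0 = l'.getD x 0 := by
  rw [List.getD_append_right _ _ _ _ (by omega), h, Nat.add_sub_cancel_left]

/-- The vertex with the number `v`. -/
def vertex (v : Fin (n + m)) : Fin n ⊕ Fin m := finSumFinEquiv.symm v

theorem vertex_var (u : Fin n) (h : (u : ℕ) < n + m) : vertex (m := m) ⟨u, h⟩ = Sum.inl u := by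
  rw [vertex, Equiv.symm_apply_eq]; rfl

theorem vertex_clause (j : Fin m) (h : n + (j : ℕ) < n + m) :
    vertex (n := n) ⟨n + j, h⟩ = Sum.inr j := by
  rw [vertex, Equiv.symm_apply_eq]; rfl

/-- Ordered adjacent pairs are the darts of the tree, two for each of its `N - 1` edges. -/
theorem tree_card : {p : ℕ × ℕ | ∃ s t : Fin N, D.tree.Adj s t ∧ p = (↑s, ↑t)}.ncard =
    2 * (N - 1) := by
  classical
  have h1 := D.isTree.card_edgeFinset
  have h2 := D.tree.dart_card_eq_twice_card_edges
  rw [Fintype.card_fin] at h1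
  have h3 : {p : ℕ × ℕ | ∃ s t : Fin N, D.tree.Adj s t ∧ p = (↑s, ↑t)} =
      Set.range fun d : D.tree.Dart => ((d.fst : ℕ), (d.snd : ℕ)) := by
    ext p
    constructor
    · rintro ⟨s, t, h4, rfl⟩
      exact ⟨⟨(s, t), h4⟩, rfl⟩
    · rintro ⟨d, rfl⟩
      exact ⟨d.fst, d.snd, d.adj, rfl⟩
  have h4 : Function.Injective fun d : D.tree.Dart => ((d.fst : ℕ), (d.snd : ℕ)) := by
    intro d d' h
    obtain ⟨h5, h6⟩ := Prod.mk.inj h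
    exact SimpleGraph.Dart.ext _ _ (Prod.ext (Fin.ext h5) (Fin.ext h6))
  rw [h3, ← Nat.card_coe_set_eq, Nat.card_range_of_injective h4, Nat.card_eq_fintype_card, h2]
  omega

/-- The instance in terms of natural numbers. -/
def instOf : Inst where
  n := n
  m := m
  N := N
  pos j u := ∃ (hj : j < m) (hu : u < n), (⟨u, hu⟩, true) ∈ φ.clause ⟨j, hj⟩
  neg j u := ∃ (hj : j < m) (hu : u < n), (⟨u, hu⟩, false) ∈ φ.clause ⟨j, hj⟩
  adj s t := ∃ (hs : s < N) (ht : t < N), D.tree.Adj ⟨s, hs⟩ ⟨t, ht⟩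
  inB t v := ∃ (ht : t < N) (hv : v < n + m), vertex ⟨v, hv⟩ ∈ D.bag ⟨t, ht⟩
  N_pos := Fin.pos_iff_nonempty.2 D.isTree.connected.nonempty
  adj_symm := fun ⟨hs, ht, h⟩ => ⟨ht, hs, h.symm⟩
  adj_lt := fun ⟨hs, _, _⟩ => hs
  adj_ne := by
    rintro s t ⟨hs, ht, h⟩ rfl
    exact h.ne rfl
  connected t ht := by
    have hN : 0 < N := by omega
    have h1 := (SimpleGraph.reachable_iff_reflTransGen _ _).1
      (D.isTree.connected.preconnected ⟨0, hN⟩ ⟨t, ht⟩)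
    exact h1.lift (fun x : Fin N => (x : ℕ)) fun a b hab => ⟨a.2, b.2, hab⟩
  card_adj := by
    rw [← tree_card φ D]
    congr 1
    ext ⟨s, t⟩
    constructor
    · rintro ⟨hs, ht, h⟩
      exact ⟨⟨s, hs⟩, ⟨t, ht⟩, h, rfl⟩
    · rintro ⟨s', t', h, h'⟩
      obtain ⟨rfl, rfl⟩ := Prod.mk.inj h'
      exact ⟨s'.2, t'.2, h⟩
  inB_lt := fun ⟨ht, hv, _⟩ => ⟨ht, hv⟩
  cover v hv := by
    obtain ⟨t, ht⟩ := D.cover (vertex ⟨v, hv⟩)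
    exact ⟨t, t.2, hv, ht⟩
  edge j hj u hu h := by
    have hadj : φ.incidenceGraph.Adj (Sum.inl ⟨u, hu⟩) (Sum.inr ⟨j, hj⟩) := by
      rw [CNF.incidenceGraph, SimpleGraph.fromRel_adj]
      refine ⟨by simp, Or.inl ?_⟩
      rcases h with ⟨_, _, h⟩ | ⟨_, _, h⟩
      · exact ⟨⟨u, hu⟩, ⟨j, hj⟩, true, rfl, rfl, h⟩
      · exact ⟨⟨u, hu⟩, ⟨j, hj⟩, false, rfl, rfl, h⟩
    obtain ⟨t, h1, h2⟩ := D.edge _ _ hadj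
    refine ⟨t, ⟨t.2, by omega, ?_⟩, ⟨t.2, by omega, ?_⟩⟩
    · rw [vertex_var ⟨u, hu⟩]; exact h1
    · rw [vertex_clause ⟨j, hj⟩]; exact h2
  subtree := by
    rintro v s t ⟨hs, hv, h1⟩ ⟨ht, _, h2⟩
    have h3 := (SimpleGraph.reachable_iff_reflTransGen _ _).1
      ((D.subtree (vertex ⟨v, hv⟩)).preconnected ⟨⟨s, hs⟩, h1⟩ ⟨⟨t, ht⟩, h2⟩)
    exact h3.lift (fun x : {t | vertex ⟨v, hv⟩ ∈ D.bag t} => ((x : Fin N) : ℕ)) fun a b hab =>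
      ⟨⟨a.1.2, b.1.2, hab⟩, ⟨a.1.2, hv, a.2⟩, ⟨b.1.2, hv, b.2⟩⟩

open Classical in
theorem reads_encode : (instOf φ D).Reads (encode φ D) := by
  have hadd : ∀ {a b c : ℕ}, a + b + c = a + (b + c) := fun {a b c} => add_assoc a b c
  unfold encode
  constructor
  · simp only [List.append_assoc]; rfl
  · simp only [List.append_assoc]; rfl
  · simp only [List.append_assoc]; rfl
  · intro j (hj : j < m) u (hu : u < n)
    change List.getD _ (3 + (j * n + u)) 0 = _
    simp only [List.append_assoc]
    rw [getD_append_add (by rfl), List.getD_append _ _ _ _ (by simpa using mul_add_lt hj hu)]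
    exact matrixBits_getD _ hj hu ⟨fun h => ⟨hj, hu, h⟩, fun ⟨_, _, h⟩ => h⟩
  · intro j (hj : j < m) u (hu : u < n)
    change List.getD _ (3 + m * n + (j * n + u)) 0 = _
    simp only [List.append_assoc]
    rw [hadd, getD_append_add (by rfl), getD_append_add (by simp),
      List.getD_append _ _ _ _ (by simpa using mul_add_lt hj hu)]
    exact matrixBits_getD _ hj hu ⟨fun h => ⟨hj, hu, h⟩, fun ⟨_, _, h⟩ => h⟩
  · intro s (hs : s < N) t (ht : t < N)
    change List.getD _ (3 + 2 * (m * n) + (s * N + t)) 0 = _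
    simp only [List.append_assoc, two_mul]
    rw [show 3 + (m * n + m * n) + (s * N + t) = 3 + (m * n + (m * n + (s * N + t))) by ring,
      getD_append_add (by rfl), getD_append_add (by simp),
      getD_append_add (by simp), List.getD_append _ _ _ _ (by simpa using mul_add_lt hs ht)]
    exact matrixBits_getD _ hs ht ⟨fun h => ⟨hs, ht, h⟩, fun ⟨_, _, h⟩ => h⟩
  · intro t (ht : t < N) u (hu : u < n)
    change List.getD _ (3 + 2 * (m * n) + N * N + (t * n + u)) 0 = _
    simp only [List.append_assoc, two_mul]
    rw [show 3 + (m * n + m * n) + N * N + (t * n + u) =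
        3 + (m * n + (m * n + (N * N + (t * n + u)))) by ring,
      getD_append_add (by rfl), getD_append_add (by simp),
      getD_append_add (by simp), getD_append_add (by simp),
      List.getD_append _ _ _ _ (by simpa using mul_add_lt ht hu)]
    refine matrixBits_getD _ ht hu ⟨fun h => ⟨ht, by omega, ?_⟩, fun ⟨_, h1, h⟩ => ?_⟩
    · rw [vertex_var ⟨u, hu⟩]; exact h
    · rwa [vertex_var ⟨u, hu⟩ h1] at h
  · intro t (ht : t < N) j (hj : j < m)
    change List.getD _ (3 + 2 * (m * n) + N * N + N * n + (t * m + j)) 0 = _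
    simp only [List.append_assoc, two_mul]
    rw [show 3 + (m * n + m * n) + N * N + N * n + (t * m + j) =
        3 + (m * n + (m * n + (N * N + (N * n + (t * m + j))))) by ring,
      getD_append_add (by rfl), getD_append_add (by simp),
      getD_append_add (by simp), getD_append_add (by simp), getD_append_add (by simp)]
    refine matrixBits_getD _ ht hj ⟨fun h => ⟨ht, by change n + j < n + m; omega, ?_⟩, fun ⟨_, h1, h⟩ => ?_⟩
    · exact (vertex_clause ⟨j, hj⟩ (by change n + j < n + m; omega)).symm ▸ h
    · exact vertex_clause ⟨j, hj⟩ h1 ▸ h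

theorem mem_encode_le {x : ℕ} (hx : x ∈ encode φ D) : x ≤ n + m + N := by
  have hN : 0 < N := (instOf φ D).N_pos
  have hbit : ∀ {r s : ℕ} (R : Fin r → Fin s → Prop), x ∈ matrixBits R → x ≤ n + m + N := by
    intro r s R h
    rw [matrixBits, List.mem_ofFn] at h
    obtain ⟨i, rfl⟩ := h
    unfold bit
    split_ifs <;> omega
  unfold encode at hx
  simp only [List.mem_append, List.mem_cons, List.not_mem_nil, or_false] at hx
  rcases hx with (((((rfl | rfl | rfl) | h) | h) | h) | h) | h
  · omega
  · omega
  · omega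
  all_goals exact hbit _ h

theorem size_encode_le (x : ℕ) : ((encode φ D).getD x 0).size ≤ n + m + N := by
  rw [Nat.size_le]
  have : (encode φ D).getD x 0 ≤ n + m + N := by
    by_cases h : x < (encode φ D).length
    · rw [List.getD_eq_getElem _ _ h]
      exact mem_encode_le φ D (List.getElem_mem h)
    · rw [List.getD_eq_default _ _ (by omega)]
      exact Nat.zero_le _
  exact this.trans_lt Nat.lt_two_pow_self

theorem bit_satisfiable :
    bit φ.Satisfiable = if (instOf φ D).models.card = 0 then 0 else 1 := by
  classical
  have : φ.Satisfiable ↔ (instOf φ D).models.card ≠ 0 := by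
    rw [Finset.card_ne_zero, Inst.models, Finset.filter_nonempty_iff]
    constructor
    · rintro ⟨α, hα⟩
      refine ⟨α, Finset.mem_univ _, fun j (hj : j < m) => ?_⟩
      obtain ⟨⟨u, b⟩, h1, h2⟩ := hα ⟨j, hj⟩
      refine ⟨u, ?_⟩
      cases b
      · exact Or.inr ⟨⟨hj, u.2, h1⟩, h2⟩
      · exact Or.inl ⟨⟨hj, u.2, h1⟩, h2⟩
    · rintro ⟨α, -, hα⟩
      refine ⟨α, fun j => ?_⟩
      obtain ⟨u, ⟨⟨_, _, h1⟩, h2⟩ | ⟨⟨_, _, h1⟩, h2⟩⟩ := hα j j.2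
      · exact ⟨(u, true), h1, h2⟩
      · exact ⟨(u, false), h1, h2⟩
  unfold bit
  by_cases h : φ.Satisfiable
  · rw [if_pos h, if_neg (this.1 h)]
  · rw [if_neg h, if_pos (not_not.1 fun h1 => h (this.2 h1))]

theorem maxBag_instOf_le : (instOf φ D).maxBag ≤ D.width + 1 := by
  classical
  refine Finset.sup_le fun t ht => ?_
  have htN : t < N := Finset.mem_range.1 ht
  have h1 : (instOf φ D).bagSize t ≤ (D.bag ⟨t, htN⟩).card := by
    rw [Inst.bagSize, Nat.count_eq_card_filter_range]
    refine le_trans (Finset.card_le_card ?_)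
      (Finset.card_image_le (f := fun w => ((finSumFinEquiv w : Fin (n + m)) : ℕ)))
    intro v hv
    obtain ⟨_, _, hv', h⟩ := Finset.mem_filter.1 hv
    exact Finset.mem_image.2 ⟨_, h, by simp [vertex]⟩
  have h2 := Finset.le_sup (f := fun t => (D.bag t).card) (Finset.mem_univ (⟨t, htN⟩ : Fin N))
  unfold TreeDecomposition.width
  beta_reduce at h2
  omega

end

/-! ## The constants of the theorem -/

/-- The polynomial is `1 - c < 0` at 1 and 1 at 2. For a root, `x ^ c * (x - 1) = x ^ c - 1` by the
geometric sum, which is impossible for `x > 2`. -/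
theorem gamma_mem_Ioc {c : ℕ} (hc : 2 ≤ c) : gamma c ∈ Set.Ioc (1 : ℝ) 2 := by
  have hc' : (2 : ℝ) ≤ c := by exact_mod_cast hc
  have hcont : Continuous fun x : ℝ => x ^ c - ∑ i ∈ Finset.range c, x ^ i := by fun_prop
  obtain ⟨hroot, hmax⟩ := isGreatest_gamma c hc
  constructor
  · have h0 : (0 : ℝ) ∈ Set.Icc ((1 : ℝ) ^ c - ∑ i ∈ Finset.range c, (1 : ℝ) ^ i)
        ((2 : ℝ) ^ c - ∑ i ∈ Finset.range c, (2 : ℝ) ^ i) := by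
      have h2 := geom_sum_mul (2 : ℝ) c
      constructor
      · simp; linarith
      · linarith
    obtain ⟨x, ⟨hx, -⟩, hx0⟩ :=
      intermediate_value_Icc (show (1 : ℝ) ≤ 2 by norm_num) hcont.continuousOn h0
    refine lt_of_lt_of_le (lt_of_le_of_ne hx ?_) (hmax hx0)
    rintro rfl
    simp at hx0
    linarith
  · by_contra! h
    have hx : gamma c ^ c = ∑ i ∈ Finset.range c, gamma c ^ i := sub_eq_zero.mp hroot
    have h1 := geom_sum_mul (gamma c) c
    rw [← hx] at h1
    have h3 : (0 : ℝ) < gamma c ^ c := by positivity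
    nlinarith

/-- The only property of `lam c` that the comparison of exponents uses; it comes from `γ_c ≤ 2`. -/
theorem one_le_lam {c : ℕ} (hc : 2 ≤ c) : 1 ≤ lam c := by
  obtain ⟨h1, h2⟩ := gamma_mem_Ioc hc
  have h3 : 0 < Real.logb 2 (gamma c) := Real.logb_pos one_lt_two h1
  rw [lam, le_div_iff₀ h3, one_mul, Real.logb_le_iff_le_rpow one_lt_two (by linarith), Real.rpow_one]
  exact h2

/-- That is, 8 < 9. On the left is the coefficient of `log N` in the recursion depth, on the right
what the base 3 of the bound provides. -/
theorem three_halves_lt_logb : (3 / 2 : ℝ) < Real.logb 2 3 := by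
  rw [Real.lt_logb_iff_rpow_lt one_lt_two (by norm_num), Real.rpow_div_two_eq_sqrt _ (by norm_num)]
  rw [show (3 : ℝ) = ((3 : ℕ) : ℝ) by norm_num, Real.rpow_natCast]
  have h := Real.sq_sqrt (show (0 : ℝ) ≤ 2 by norm_num)
  have h0 := Real.sqrt_nonneg (2 : ℝ)
  push_cast
  nlinarith

/-- A rational number slightly below `ε`. -/
theorem exists_ratio {ε : ℝ} (hε0 : 0 < ε) (hε1 : ε < 1) :
    ∃ a b : ℕ, 0 < b ∧ a ≤ b ∧ (a / b : ℝ) ≤ ε ∧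
      3 / 2 * (1 - a / b : ℝ) < Real.logb 2 3 * (1 - ε) := by
  have h := three_halves_lt_logb
  set θ := Real.logb 2 3 * (1 - ε) with hθ
  have h1 : 3 / 2 * (1 - ε) < θ := mul_lt_mul_of_pos_right h (by linarith)
  -- At `r = 1 - θ / (3/2)` the claimed strict inequality would be an equality; this value is below
  -- `ε` because `3/2 < log 3`.
  obtain ⟨r, hr1, hr2⟩ := exists_rat_btwn (show max 0 (1 - θ / (3 / 2)) < ε from
    max_lt hε0 (by linarith))
  have hr0 : (0 : ℝ) < r := (le_max_left _ _).trans_lt hr1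
  have hr : ((r.num.toNat : ℝ) / (r.den : ℝ)) = r := by
    have h2 : 0 ≤ r.num := Rat.num_nonneg.2 (by exact_mod_cast hr0.le)
    have h3 : ((r.num.toNat : ℕ) : ℝ) = (r.num : ℝ) := by
      exact_mod_cast congrArg (Int.cast (R := ℝ)) (Int.toNat_of_nonneg h2)
    rw [h3, Rat.cast_def]
  have hden : (0 : ℝ) < r.den := by exact_mod_cast r.den_pos
  refine ⟨r.num.toNat, r.den, r.den_pos, ?_, hr ▸ hr2.le, ?_⟩
  · have h4 : (r.num.toNat : ℝ) / (r.den : ℝ) ≤ 1 := by rw [hr]; linarith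
    rw [div_le_one hden] at h4
    exact_mod_cast h4
  · rw [hr]
    have := (le_max_right _ _).trans_lt hr1
    linarith

/-- A recursion depth that suffices for a hierarchy whose levels shrink by the factor `5 / 8`. -/
theorem exists_depth {N : ℕ} (hN : 0 < N) :
    ∃ d : ℕ, N * 5 ^ d < 8 ^ d ∧ (d : ℝ) ≤ 3 / 2 * Real.logb 2 N + 1 := by
  classical
  have hNR : (1 : ℝ) ≤ N := by exact_mod_cast hN
  have hex : ∃ d : ℕ, N * 5 ^ d < 8 ^ d := by
    obtain ⟨d, hd⟩ := pow_unbounded_of_one_lt (N : ℝ) (show (1 : ℝ) < 8 / 5 by norm_num)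
    refine ⟨d, ?_⟩
    rw [div_pow, lt_div_iff₀ (by positivity)] at hd
    exact_mod_cast hd
  refine ⟨Nat.find hex, Nat.find_spec hex, ?_⟩
  have hl := Real.logb_nonneg one_lt_two hNR
  rcases Nat.eq_zero_or_pos (Nat.find hex) with h0 | h0
  · rw [h0]; push_cast; linarith
  obtain ⟨d, hd⟩ := Nat.exists_eq_succ_of_ne_zero h0.ne'
  have h1 := not_lt.1 (Nat.find_min hex (m := d) (by omega))
  -- One level less than the least sufficient depth does not suffice, so `(8/5) ^ d ≤ N`. Cubing and
  -- `4 * 125 ≤ 512` give `4 ^ d ≤ N ^ 3`, that is `2 * d ≤ 3 * log N`.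
  have h2 : (4 : ℝ) ^ d ≤ (N : ℝ) ^ 3 := by
    have h3 : (8 ^ d) ^ 3 ≤ (N * 5 ^ d) ^ 3 := Nat.pow_le_pow_left h1 3
    have h4 : 4 ^ d * 125 ^ d ≤ (8 ^ d) ^ 3 := by
      rw [← mul_pow, ← pow_mul, mul_comm d 3, pow_mul]
      exact Nat.pow_le_pow_left (by norm_num) d
    have h5 : (N * 5 ^ d) ^ 3 = N ^ 3 * 125 ^ d := by
      rw [mul_pow, ← pow_mul, mul_comm d 3, pow_mul]; norm_num
    have h6 : 4 ^ d ≤ N ^ 3 :=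
      Nat.le_of_mul_le_mul_right ((h4.trans h3).trans_eq h5) (by positivity)
    exact_mod_cast h6
  have h3 := Real.logb_le_logb_of_le one_lt_two (by positivity) h2
  rw [Real.logb_pow, Real.logb_pow, show (4 : ℝ) = 2 ^ 2 by norm_num, Real.logb_pow,
    Real.logb_self_eq_one one_lt_two] at h3
  rw [hd]
  push_cast at h3 ⊢
  linarith

/-! ## The costs of the machine -/

namespace Inst

theorem cells_mul_lt (T : Inst) {q : ℕ} (hq : q ≤ T.n + T.m) :
    64 * T.cells q < 2 ^ T.valueSize := by
  rw [← T.valueSize_bound, cells]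
  have h1 : T.N + 1 ≤ 2 ^ T.N := T.N.lt_two_pow_self
  have h2 : T.n + T.m + 1 ≤ 2 ^ (T.n + T.m) := (T.n + T.m).lt_two_pow_self
  have h3 : 2 ^ q ≤ 2 ^ (T.n + T.m) := Nat.pow_le_pow_right two_pos hq
  set x := 2 ^ (T.n + T.m)
  set y := 2 ^ T.N
  have hx : 1 ≤ x := by omega
  have hy : 1 ≤ y := by omega
  have hyy : y ≤ y * y := Nat.le_mul_of_pos_left _ hy
  have hxx : x ≤ x * x := Nat.le_mul_of_pos_left _ hx
  have h4 : T.N + 1 + (T.n + T.m) ≤ y * x := by nlinarith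
  have h5 : (T.N + 1) * (T.N + 1 + (T.n + T.m)) ≤ x * x * (y * y) :=
    calc _ ≤ y * (y * x) := Nat.mul_le_mul h1 h4
      _ = x * (y * y) := by ring
      _ ≤ _ := Nat.mul_le_mul_right _ hxx
  have h6 : T.N * (2 ^ q * 2 ^ q) ≤ x * x * (y * y) :=
    calc _ ≤ y * (x * x) := Nat.mul_le_mul (by omega) (Nat.mul_le_mul h3 h3)
      _ = x * x * y := by ring
      _ ≤ _ := Nat.mul_le_mul_left _ hyy
  have h7 : 0 < x * x * (y * y) := by positivity
  rw [mul_assoc 256]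
  omega

/-- All numbers have length at most `L = 11 * S` with `S = n + m + N`. This gives `24200 = 200 * 11
^ 2` for the time; in the space, `11 * 640 = 64 * 5 * 2 * 11` comes from `64 * cells` addresses with
`cells ≤ 5 * S ^ 2 * 2 ^ (2 * q)`. -/
theorem computes_program {T : Inst} {I : List ℕ} (hI : T.Reads I)
    (hsize : ∀ x, (I.getD x 0).size ≤ T.n + T.m + T.N) {a b d w : ℕ} (hab : a ≤ b)
    (hd : T.N * 5 ^ d < 8 ^ d) (hw : (Code.program a b).HasWeight w) :
    ∃ t s : ℕ, (Code.program a b).compile.Computes I (if T.models.card = 0 then 0 else 1) t s ∧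
      t ≤ 24200 * (4 * w + 1) * (T.n + T.m + T.N) ^ 6 *
        2 ^ (3 * (a * T.maxBag / b) + (T.maxBag - a * T.maxBag / b) * d) ∧
      s ≤ 11 * (640 + 2 * w) * (T.n + T.m + T.N) ^ 3 * 2 ^ (2 * (a * T.maxBag / b)) := by
  obtain ⟨σ, c, hrun, hc, hout⟩ := T.wp_program hI hab hd
  have hq : a * T.maxBag / b ≤ T.n + T.m :=
    (Nat.div_le_of_le_mul (Nat.mul_le_mul_right _ hab)).trans T.maxBag_le
  have hcells := T.cells_mul_lt hq
  set q := a * T.maxBag / b with hqdef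
  have hN := T.N_pos
  obtain ⟨S, hS⟩ : ∃ S, S = T.n + T.m + T.N := ⟨_, rfl⟩
  have hS1 : 1 ≤ S := by omega
  have hL : T.valueSize + 1 ≤ 11 * S := by rw [valueSize]; omega
  obtain ⟨M, t, s, h1, h2, h3, h4⟩ := hrun.compile (L := 11 * S) (by omega)
    ((Nat.size_le.2 hcells).trans (by omega)) (by rw [Nat.size_pow]; exact hL)
    (fun x => (hsize x).trans (by omega)) hw (Stores.zero (by positivity))
  refine ⟨t, s, ⟨M, h1, ?_⟩, h3.trans ?_, h4.trans ?_⟩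
  · rw [← hout]; exact h2.rep .out 0
  · calc _ ≤ 200 * T.stepBound q d * ((4 * w + 1) * (11 * S) ^ 2) := Nat.mul_le_mul_right _ hc
      _ = _ := by rw [stepBound, ← hS, pow_add, pow_mul, pow_mul, pow_right_comm 2 3 q]; ring
  · rw [← hS]
    have hQ : 1 ≤ 2 ^ (2 * q) := Nat.one_le_two_pow
    have h5 : T.cells q ≤ 5 * S ^ 2 * 2 ^ (2 * q) := by
      rw [cells, ← pow_add, ← two_mul]
      have h6 : (T.N + 1) * (T.N + 1 + (T.n + T.m)) ≤ 4 * S ^ 2 :=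
        calc _ ≤ (2 * S) * (2 * S) := Nat.mul_le_mul (by omega) (by omega)
          _ = _ := by ring
      have h7 : T.N ≤ S ^ 2 := (show T.N ≤ S by omega).trans (Nat.le_self_pow two_ne_zero S)
      calc _ ≤ 4 * S ^ 2 * 2 ^ (2 * q) + S ^ 2 * 2 ^ (2 * q) :=
            Nat.add_le_add (h6.trans (Nat.le_mul_of_pos_right _ hQ)) (Nat.mul_le_mul_right _ h7)
        _ = _ := by ring
    have h8 : 1 ≤ S ^ 2 * 2 ^ (2 * q) := Nat.mul_pos (by positivity) (by positivity)
    calc _ ≤ 64 * (5 * S ^ 2 * 2 ^ (2 * q)) * (2 * (11 * S)) +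
          2 * (w * (11 * S)) * (S ^ 2 * 2 ^ (2 * q)) :=
          Nat.add_le_add (Nat.mul_le_mul_right _ (Nat.mul_le_mul_left _ h5))
            (Nat.le_mul_of_pos_right _ h8)
      _ = _ := by ring

end Inst

/-! ## The exponents -/

section
variable {a b W k d : ℕ} {l ε : ℝ}

/-- Here `k` is the width. The rounding of `a * W / b` and `W ≤ k + 1` together cost at most 2 in `W
- q`, hence the summand `3 * l`; the constant 3 covers the rest. Both end up in the polynomial
factor. -/
theorem time_exponent_le (hb : 0 < b) (hab : a ≤ b) (hW : W ≤ k + 1) (hl : 0 ≤ l)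
    (hd : (d : ℝ) ≤ 3 / 2 * l + 1) :
    ((3 * (a * W / b) + (W - a * W / b) * d : ℕ) : ℝ) ≤
      3 + 3 * l + k * (3 + 3 / 2 * (1 - a / b) * l) := by
  have hbR : (0 : ℝ) < b := by exact_mod_cast hb
  have hr : (a / b : ℝ) ≤ 1 := by rw [div_le_one hbR]; exact_mod_cast hab
  have hq : a * W / b ≤ W := Nat.div_le_of_le_mul (Nat.mul_le_mul_right _ hab)
  have hq1 : (a / b : ℝ) * W - 1 ≤ ((a * W / b : ℕ) : ℝ) := by
    have := Nat.lt_div_mul_add (a := a * W) hb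
    have h1 : ((a * W : ℕ) : ℝ) ≤ ((a * W / b : ℕ) : ℝ) * b + b := by exact_mod_cast this.le
    rw [div_mul_eq_mul_div, sub_le_iff_le_add, div_le_iff₀ hbR]
    push_cast at h1 ⊢
    linarith
  have hqR : ((a * W / b : ℕ) : ℝ) ≤ W := by exact_mod_cast hq
  have hWR : (W : ℝ) ≤ k + 1 := by exact_mod_cast hW
  push_cast [Nat.cast_sub hq] at *
  generalize ((a * W / b : ℕ) : ℝ) = q at *
  have h1 : (W - q) * d ≤ (W - q) * (3 / 2 * l + 1) :=
    mul_le_mul_of_nonneg_left hd (by linarith)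
  have hr0 : (0 : ℝ) ≤ a / b := by positivity
  have h2 : W - q ≤ (1 - a / b) * k + 2 := by
    have := mul_le_mul_of_nonneg_left hWR (show (0 : ℝ) ≤ 1 - a / b by linarith)
    linarith
  have h3 : (W - q) * (3 / 2 * l) ≤ ((1 - a / b) * k + 2) * (3 / 2 * l) :=
    mul_le_mul_of_nonneg_right h2 (by linarith)
  nlinarith

/-- A table has two indices of `q` bits each, and `2 ≤ c`. -/
theorem space_exponent_le {c : ℕ} (hc : 2 ≤ c) (hW : W ≤ k + 1) (hε : (a / b : ℝ) ≤ ε)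
    (hε1 : ε ≤ 1) :
    ((2 * (a * W / b) : ℕ) : ℝ) ≤ 2 + c * ε * k := by
  have hcR : (2 : ℝ) ≤ c := by exact_mod_cast hc
  have hq : ((a * W / b : ℕ) : ℝ) ≤ a / b * W := by
    refine Nat.cast_div_le.trans_eq ?_
    push_cast; ring
  have hWR : (W : ℝ) ≤ k + 1 := by exact_mod_cast hW
  have h0 : (0 : ℝ) ≤ a / b := by positivity
  have h1 : (a / b : ℝ) * W ≤ ε * (k + 1) := mul_le_mul hε hWR (by positivity) (h0.trans hε)
  have h2 : 2 * (ε * k) ≤ c * (ε * k) := 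
    mul_le_mul_of_nonneg_right hcR (mul_nonneg (h0.trans hε) k.cast_nonneg)
  push_cast
  linarith

theorem three_rpow (x : ℝ) : (3 : ℝ) ^ x = 2 ^ (Real.logb 2 3 * x) := by
  rw [Real.rpow_mul two_pos.le, Real.rpow_logb two_pos (by norm_num) (by norm_num)]

end


/-- Moves the harmless parts of an exponent into the polynomial factor: a constant `y` becomes `2 ^
y`, and `j * l` becomes `S ^ j`. -/
theorem rpow_bound {x y z C l S : ℝ} {e i : ℕ} (hx : x ≤ C * S ^ i * 2 ^ e) (hC : 0 ≤ C)
    (hl : l ≤ Real.logb 2 S) (hS : 0 < S) {j : ℕ} (he : (e : ℝ) ≤ y + j * l + z) :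
    x ≤ C * 2 ^ y * S ^ (i + j) * (2 : ℝ) ^ z := by
  refine hx.trans ?_
  have h1 : ((2 : ℝ) ^ e) ≤ 2 ^ y * S ^ j * (2 : ℝ) ^ z := by
    rw [← Real.rpow_natCast 2 e]
    refine (Real.rpow_le_rpow_of_exponent_le one_le_two
      (he.trans (add_le_add_left (add_le_add_right
        (mul_le_mul_of_nonneg_left hl j.cast_nonneg) y) z))).trans_eq ?_
    rw [Real.rpow_add two_pos, Real.rpow_add two_pos, mul_comm (j : ℝ), Real.rpow_mul two_pos.le,
      Real.rpow_logb two_pos (by norm_num) hS, Real.rpow_natCast]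
  calc _ ≤ C * S ^ i * (2 ^ y * S ^ j * (2 : ℝ) ^ z) :=
        mul_le_mul_of_nonneg_left h1 (by positivity)
    _ = _ := by rw [pow_add]; ring

end WidthSat

theorem mainTheorem1 (c : ℕ) (hc : 2 ≤ c) (ε : ℝ) (hε0 : 0 < ε) (hε1 : ε < 1) :
    ∃ (P : WidthSat.Prog) (A k N₀ : ℕ) (K : ℝ),
      ∀ (n m N : ℕ) (φ : WidthSat.CNF n m)
        (D : WidthSat.TreeDecomposition φ.incidenceGraph N), D.DegreeLE 3 →
        ∃ t s : ℕ,
          P.Computes (WidthSat.encode φ D) (WidthSat.bit φ.Satisfiable) t s ∧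
          (N₀ ≤ N →
            (t : ℝ) ≤ A * ((n : ℝ) + m + N) ^ k *
              (3 : ℝ) ^ ((WidthSat.lam c * (Real.logb 2 N - c) + c) * (1 - ε) * D.width)) ∧
          (t : ℝ) ≤ A * ((n : ℝ) + m + N) ^ k *
            (3 : ℝ) ^ ((WidthSat.lam c * (Real.logb 2 N - c) + c + K) * (1 - ε) * D.width) ∧
          (s : ℝ) ≤ A * ((n : ℝ) + m + N) ^ k * (2 : ℝ) ^ (c * ε * D.width) := by
  obtain ⟨a, b, hb, hab, hε, hlt⟩ := WidthSat.exists_ratio hε0 hε1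
  obtain ⟨w, hw⟩ := (WidthSat.Code.program a b).exists_weight
  have hlam := WidthSat.one_le_lam hc
  set θ : ℝ := Real.logb 2 3 * (1 - ε) with hθ
  set β : ℝ := 3 / 2 * (1 - a / b : ℝ) with hβ
  have hθ0 : 0 < θ := mul_pos (Real.logb_pos one_lt_two (by norm_num)) (by linarith)
  -- For `N ≥ N₀` the logarithm `l` of `N` is at least `c`, whence `λ * (l - c) + c ≥ l`, and at
  -- least `3 / (θ - β)`, whence `3 + β * l ≤ θ * l`.
  obtain ⟨N₀, hN₀⟩ := exists_nat_ge ((2 : ℝ) ^ max (c : ℝ) (3 / (θ - β)))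
  -- The factor `8 = 2 ^ 3` and the degree `9 = 6 + 3` absorb the summand `3 + 3 * l` of the
  -- exponent. In `K`, the part `λ * c` cancels the negative term of the bound and `3 / θ` pays for
  -- the summand 3.
  refine ⟨(WidthSat.Code.program a b).compile, 24200 * (4 * w + 1) * 8, 9, N₀,
    3 / θ + WidthSat.lam c * c, fun n m N φ D _ => ?_⟩
  have hN : 0 < N := (WidthSat.instOf φ D).N_pos
  have hN1 : (1 : ℝ) ≤ N := by exact_mod_cast hN
  obtain ⟨d, hd, hdl⟩ := WidthSat.exists_depth hN
  have hl := Real.logb_nonneg one_lt_two hN1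
  have hW := WidthSat.maxBag_instOf_le φ D
  obtain ⟨t, s, h, ht, hs⟩ := WidthSat.Inst.computes_program (WidthSat.reads_encode φ D)
    (WidthSat.size_encode_le φ D) hab hd hw
  rw [← WidthSat.bit_satisfiable] at h
  have ht' := WidthSat.time_exponent_le hb hab hW hl hdl
  have hs' := WidthSat.space_exponent_le hc hW hε hε1.le
  change t ≤ _ * (n + m + N) ^ 6 * _ at ht
  change s ≤ _ * (n + m + N) ^ 3 * _ at hs
  have htR := (Nat.cast_le (α := ℝ)).2 ht
  have hsR := (Nat.cast_le (α := ℝ)).2 hs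
  rw [Nat.cast_mul, Nat.cast_mul, Nat.cast_pow, Nat.cast_pow] at htR hsR
  set S : ℝ := (n : ℝ) + m + N with hS
  have hSN : (N : ℝ) ≤ S := by
    have h1 : (0 : ℝ) ≤ n := n.cast_nonneg
    have h2 : (0 : ℝ) ≤ m := m.cast_nonneg
    linarith
  have hSC : ((n + m + N : ℕ) : ℝ) = S := by push_cast; rfl
  rw [hSC] at htR hsR
  have hlS : Real.logb 2 N ≤ Real.logb 2 S :=
    Real.logb_le_logb_of_le one_lt_two (by linarith) hSN
  have hlarge : N₀ ≤ N → max (c : ℝ) (3 / (θ - β)) ≤ Real.logb 2 N := fun hNN => by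
    rw [Real.le_logb_iff_rpow_le one_lt_two (by linarith)]
    exact hN₀.trans (by exact_mod_cast hNN)
  have hk : (0 : ℝ) ≤ D.width := D.width.cast_nonneg
  generalize (D.width : ℝ) = k at *
  generalize Real.logb 2 (N : ℝ) = l at *
  have hS1 : 1 ≤ S := hN1.trans hSN
  have hA0 : (0 : ℝ) ≤ (24200 * (4 * w + 1) : ℕ) := Nat.cast_nonneg _
  have htime := WidthSat.rpow_bound (y := 3) (z := k * (3 + β * l)) (j := 3) (l := l) (S := S) (i := 6)
    (by exact_mod_cast htR) hA0 hlS (by linarith) (ht'.trans_eq (by rw [hβ]; push_cast; ring))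
  have hspace := WidthSat.rpow_bound (y := 2) (z := c * ε * k) (j := 0) (l := l) (S := S) (i := 3)
    (by exact_mod_cast hsR) (Nat.cast_nonneg _) hlS (by linarith)
    (hs'.trans_eq (by push_cast; ring))
  -- Written to the base 2, both time bounds reduce to one linear inequality for the factor `E` of
  -- the exponent.
  have htime' : ∀ E : ℝ, 3 + β * l ≤ θ * E → (t : ℝ) ≤ (24200 * (4 * w + 1) * 8 : ℕ) * S ^ 9 *
      (3 : ℝ) ^ (E * (1 - ε) * k) := fun E hE => by
    refine htime.trans ?_
    rw [WidthSat.three_rpow, Nat.cast_mul _ 8]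
    refine mul_le_mul (le_of_eq (by norm_num)) (Real.rpow_le_rpow_of_exponent_le one_le_two ?_)
      (by positivity) (by positivity)
    calc k * (3 + β * l) ≤ k * (θ * E) := mul_le_mul_of_nonneg_left hE hk
      _ = Real.logb 2 3 * (E * (1 - ε) * k) := by simp only [hθ]; ring
  refine ⟨t, s, h, fun hNN => htime' _ ?_, htime' _ ?_, hspace.trans ?_⟩
  · have h1 := hlarge hNN
    have h2 : (c : ℝ) ≤ l := (le_max_left _ _).trans h1
    have h3 : 3 ≤ l * (θ - β) := (div_le_iff₀ (by linarith)).1 ((le_max_right _ _).trans h1)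
    have h4 : l ≤ WidthSat.lam c * (l - c) + c := by
      have := mul_le_mul_of_nonneg_right hlam (show 0 ≤ l - c by linarith)
      linarith
    have h5 := mul_le_mul_of_nonneg_left h4 hθ0.le
    linarith
  · have h1 : l ≤ WidthSat.lam c * l := le_mul_of_one_le_left hl hlam
    have h2 : θ * (3 / θ) = 3 := mul_div_cancel₀ _ hθ0.ne'
    have h3 := mul_le_mul_of_nonneg_left h1 hθ0.le
    have h4 : β * l ≤ θ * l := mul_le_mul_of_nonneg_right hlt.le hl
    have h5 : 0 ≤ θ * c := by positivity
    linarith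
  -- The constant and the degree chosen for the time also dominate those of the space, `4 * 11 *
  -- (640 + 2 * w)` and 3.
  · refine mul_le_mul_of_nonneg_right (mul_le_mul ?_ (pow_le_pow_right₀ hS1 (by norm_num))
      (by positivity) (by positivity)) (by positivity)
    have hw0 : (0 : ℝ) ≤ w := w.cast_nonneg
    push_cast
    norm_num
    linarith
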